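/- Let $k$ be a field, let $n\ge 1$ and $p\ge 0$ be integers, and let $i\colon \mathbb P^{n-1}\hookrightarrow \mathbb P^n=\operatorname{Proj} k[x_0,\dots,x_n]$ be the inclusion of the hyperplane $H=\{x_n=0\}$ on which the last coordinate vanishes. For a scheme $X$ over $k$ let $\Omega^q_X$ be the sheaf of Kähler $q$-forms of $X$ over $k$, let $(d)$ denote tensoring with $\mathcal O(d)$, and regard sheaves on $\mathbb P^{n-1}$ as sheaves on $\mathbb P^n$ by means of $i_*$. Let $$\psi\colon \Omega^{p+1}_{\mathbb P^n}(p+2)\to \Omega^{p+1}_{\mathbb P^{n-1}}(p+2)$$ be the restriction of twisted forms to the hyperplane, and let $\psi|_{\mathbb P^{n-1}}\colon\Omega^{p+1}_{\mathbb P^n}|_{\mathbb P^{n-1}}(p+2)\to\Omega^{p+1}_{\mathbb P^{n-1}}(p+2)$ be the morphism that it induces on $\Omega^{p+1}_{\mathbb P^n}|_{\mathbb P^{n-1}}(p+2)=i^*\bigl(\Omega^{p+1}_{\mathbb P^n}(p+2)\bigr)$. Theorem. There is an elementary transformation of vector bundles on $\mathbb P^n$ along $\psi$, in the following sense. The sheaves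 $\Omega^{p+1}_{\mathbb P^n}(p+1)$ and $\Omega^{p+1}_{\mathbb P^n}(p+2)$ are locally free of finite rank on $\mathbb P^n$, the sheaves $\Omega^{p}_{\mathbb P^{n-1}}(p+1)$ and $\Omega^{p+1}_{\mathbb P^{n-1}}(p+2)$ are locally free of finite rank on $\mathbb P^{n-1}$, and there is a commutative diagram with exact rows and columns $$\begin{array}{ccccccccc} &&0&&0&&&&\\ &&\downarrow&&\downarrow&&&&\\ &&\Omega^{p+1}_{\mathbb P^n}(p+1)&=&\Omega^{p+1}_{\mathbb P^n}(p+1)&&&&\\ &&\downarrow&&\downarrow{\scriptstyle\, x_n}&&&&\\ 0&\to&\mathcal O_{\mathbb P^n}^{\oplus\binom{n}{p+1}}&\to&\Omega^{p+1}_{\mathbb P^n}(p+2)&\xrightarrow{\ \psi\ }&\Omega^{p+1}_{\mathbb P^{n-1}}(p+2)&\to&0\\ &&\downarrow&&\downarrow&&\|&&\\ 0&\to&\Omega^{p}_{\mathbb P^{n-1}}(p+1)&\to&\Omega^{p+1}_{\mathbb P^n}|_{\mathbb P^{n-1}}(p+2)&\xrightarrow{\psi|_{\mathbb P^{n-1}}}&\Omega^{p+1}_{\mathbb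 P^{n-1}}(p+2)&\to&0\\ &&\downarrow&&\downarrow&&&&\\ &&0&&0&&&& \end{array}$$ in which the map $\Omega^{p+1}_{\mathbb P^n}(p+1)\to\Omega^{p+1}_{\mathbb P^n}(p+2)$ is multiplication by $x_n$ and the map $\Omega^{p+1}_{\mathbb P^n}(p+2)\to\Omega^{p+1}_{\mathbb P^n}|_{\mathbb P^{n-1}}(p+2)$ is the canonical restriction. -/

import Mathlib

open CategoryTheory AlgebraicGeometry TopologicalSpace Opposite

universe u

noncomputable section

namespace ElementaryTransformations

/-! ### Exterior powers along a semilinear map -/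

section Exterior

variable {A B : Type*} [CommRing A] [CommRing B] {σ : A →+* B}
  {M N : Type*} [AddCommGroup M] [Module A M] [AddCommGroup N] [Module B N]

/-- The map `m₁ ∧ ⋯ ∧ mₚ ↦ f m₁ ∧ ⋯ ∧ f mₚ` induced by a semilinear map `f`. -/
def exteriorPowerMap (f : M →ₛₗ[σ] N) (p : ℕ) : ⋀[A]^p M →ₛₗ[σ] ⋀[B]^p N :=
  letI : Module A (⋀[B]^p N) := Module.compHom _ σ
  let g : M [⋀^Fin p]→ₗ[A] ⋀[B]^p N :=
    { toFun := fun m => exteriorPower.ιMulti B p (fun i => f (m i))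
      map_update_add' := by
        intro _ m i x y
        have h : ∀ z, (fun j => f (Function.update m i z j)) =
            Function.update (fun j => f (m j)) i (f z) := fun z => by
          funext j
          by_cases hj : j = i
          · subst hj; simp
          · simp [hj]
        convert (exteriorPower.ιMulti B p).map_update_add (fun j => f (m j)) i (f x) (f y) using 2
        · convert h (x + y) using 1
          simp
        · congr 1; convert h x
        · congr 1; convert h y
      map_update_smul' := by
        intro _ m i c x
        have h : ∀ z, (fun j => f (Function.update m i z j)) =
            Function.update (fun j => f (m j)) i (f z) := fun z => by
          funext j
          by_cases hj : j = i
          · subst hj; simp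
          · simp [hj]
        refine Eq.trans
          (b := σ c • exteriorPower.ιMulti B p (fun j => f (Function.update m i x j))) ?_ rfl
        convert (exteriorPower.ιMulti B p).map_update_smul (fun j => f (m j)) i (σ c) (f x) using 2
        · convert h (c • x) using 1
          simp
        · congr 1; convert h x
      map_eq_zero_of_eq' := by
        intro v i j hv hij
        exact (exteriorPower.ιMulti B p).map_eq_zero_of_eq _ (by simp [hv]) hij }
  let h : ⋀[A]^p M →ₗ[A] ⋀[B]^p N := exteriorPower.alternatingMapLinearEquiv g
  { toFun := h
    map_add' := map_add h
    map_smul' := fun c x => h.map_smul c x }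

theorem exteriorPowerMap_ιMulti (f : M →ₛₗ[σ] N) (p : ℕ) (m : Fin p → M) :
    exteriorPowerMap f p (exteriorPower.ιMulti A p m) =
      exteriorPower.ιMulti B p (fun i => f (m i)) := by
  let _ : Module A (⋀[B]^p N) := Module.compHom _ σ
  exact exteriorPower.alternatingMapLinearEquiv_apply_ιMulti _ m

theorem exteriorPower_induction {p : ℕ} {P : ⋀[A]^p M → Prop}
    (mk : ∀ m, P (exteriorPower.ιMulti A p m)) (zero : P 0)
    (add : ∀ x y, P x → P y → P (x + y)) (smul : ∀ (a : A) x, P x → P (a • x))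
    (x : ⋀[A]^p M) : P x := by
  have hx : x ∈ Submodule.span A (Set.range (exteriorPower.ιMulti A p (M := M))) := by
    rw [exteriorPower.ιMulti_span]; trivial
  induction hx using Submodule.span_induction with
  | mem x hx => obtain ⟨m, rfl⟩ := hx; exact mk m
  | zero => exact zero
  | add x y _ _ hx hy => exact add x y hx hy
  | smul a x _ hx => exact smul a x hx

theorem exteriorPowerMap_id {σ : A →+* A} (hσ : σ = RingHom.id A) (f : M →ₛₗ[σ] M)
    (hf : ∀ x, f x = x) (p : ℕ) (x : ⋀[A]^p M) : exteriorPowerMap f p x = x := by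
  refine exteriorPower_induction (P := fun x => exteriorPowerMap f p x = x)
    (fun m => ?_) (map_zero _) (fun x y hx hy => by simp only [map_add, hx, hy])
    (fun a x hx => by rw [map_smulₛₗ, hx, hσ]; rfl) x
  rw [exteriorPowerMap_ιMulti]
  exact congrArg _ (funext fun i => hf (m i))

theorem exteriorPowerMap_square {B' L : Type*} [CommRing B'] [CommRing L] {N' P : Type*}
    [AddCommGroup N'] [Module B' N'] [AddCommGroup P] [Module L P] {σ' : A →+* B'} {τ : B →+* L}
    {τ' : B' →+* L} (f : M →ₛₗ[σ] N) (g : N →ₛₗ[τ] P) (f' : M →ₛₗ[σ'] N') (g' : N' →ₛₗ[τ'] P)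
    (hσ : ∀ a, τ (σ a) = τ' (σ' a)) (h : ∀ x, g (f x) = g' (f' x)) (p : ℕ) (x : ⋀[A]^p M) :
    exteriorPowerMap g p (exteriorPowerMap f p x) =
      exteriorPowerMap g' p (exteriorPowerMap f' p x) := by
  refine exteriorPower_induction (P := fun x => exteriorPowerMap g p (exteriorPowerMap f p x) =
      exteriorPowerMap g' p (exteriorPowerMap f' p x))
    (fun m => ?_) (by simp only [map_zero]) (fun x y hx hy => by simp only [map_add, hx, hy])
    (fun a x hx => by simp only [map_smulₛₗ, hx, hσ]) x
  simp only [exteriorPowerMap_ιMulti, h]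

theorem exteriorPowerMap_comp {L P : Type*} [CommRing L] [AddCommGroup P] [Module L P]
    {τ : B →+* L} {ρ : A →+* L} (f : M →ₛₗ[σ] N) (g : N →ₛₗ[τ] P) (h : M →ₛₗ[ρ] P)
    (hσ : ∀ a, ρ a = τ (σ a)) (H : ∀ x, h x = g (f x)) (p : ℕ) (x : ⋀[A]^p M) :
    exteriorPowerMap h p x = exteriorPowerMap g p (exteriorPowerMap f p x) := by
  rw [← exteriorPowerMap_id rfl (LinearMap.id (R := A) (M := M)) (fun _ => rfl) p x,
    exteriorPowerMap_square LinearMap.id h f g hσ H p x,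
    exteriorPowerMap_id rfl (LinearMap.id (R := A) (M := M)) (fun _ => rfl) p x]

theorem tensorMap_square {B' L : Type*} [CommRing B'] [CommRing L] {N' P M₂ N₂ N₂' P₂ : Type*}
    [AddCommGroup N'] [Module B' N'] [AddCommGroup P] [Module L P]
    [AddCommGroup M₂] [Module A M₂] [AddCommGroup N₂] [Module B N₂]
    [AddCommGroup N₂'] [Module B' N₂'] [AddCommGroup P₂] [Module L P₂]
    {σ' : A →+* B'} {τ : B →+* L} {τ' : B' →+* L}
    (f : M →ₛₗ[σ] N) (g : N →ₛₗ[τ] P) (f' : M →ₛₗ[σ'] N') (g' : N' →ₛₗ[τ'] P)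
    (f₂ : M₂ →ₛₗ[σ] N₂) (g₂ : N₂ →ₛₗ[τ] P₂) (f₂' : M₂ →ₛₗ[σ'] N₂') (g₂' : N₂' →ₛₗ[τ'] P₂)
    (h : ∀ x, g (f x) = g' (f' x)) (h₂ : ∀ x, g₂ (f₂ x) = g₂' (f₂' x))
    (x : TensorProduct A M M₂) :
    TensorProduct.map g g₂ (TensorProduct.map f f₂ x) =
      TensorProduct.map g' g₂' (TensorProduct.map f' f₂' x) := by
  induction x using TensorProduct.induction_on with
  | zero => simp only [map_zero]
  | add x y hx hy => simp only [map_add, hx, hy]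
  | tmul x y => simp only [TensorProduct.map_tmul, h, h₂]

end Exterior

/-! ### Presheaves of modules given by semilinear maps -/

section Presheaf

variable {C D : Type*} [Category* C] [Category* D] {R : Cᵒᵖ ⥤ CommRingCat.{u}}
  {S : Dᵒᵖ ⥤ CommRingCat.{u}}

/-- Presheaves of modules over a presheaf of commutative rings. -/
abbrev PMod (R : Cᵒᵖ ⥤ CommRingCat.{u}) := PresheafOfModules.{u} (R ⋙ forget₂ _ RingCat)

/-- A presheaf of modules from modules of sections and semilinear restriction maps. -/
def mkPMod (M : ∀ U, ModuleCat.{u} (R.obj U))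
    (map : ∀ {U V : Cᵒᵖ} (i : U ⟶ V), M U →ₛₗ[(R.map i).hom] M V)
    (map_id : ∀ U (x : M U), map (𝟙 U) x = x)
    (map_comp : ∀ {U V W : Cᵒᵖ} (i : U ⟶ V) (j : V ⟶ W) (x : M U),
      map (i ≫ j) x = map j (map i x)) : PMod R where
  obj U := M U
  map {U V} i := ModuleCat.ofHom (Y := (ModuleCat.restrictScalars (R.map i).hom).obj (M V))
    { toFun := map i
      map_add' := map_add _
      map_smul' := fun c x => map_smulₛₗ (map i) c x }
  map_id U := ConcreteCategory.hom_ext _ _ fun x => map_id U x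
  map_comp i j := ConcreteCategory.hom_ext _ _ fun x => map_comp i j x

/-- The restriction maps of a presheaf of modules, as semilinear maps. -/
def res (M : PMod R) {U V : Cᵒᵖ} (i : U ⟶ V) : M.obj U →ₛₗ[(R.map i).hom] M.obj V :=
  M.restrictₛₗ i

theorem res_id (M : PMod R) (U : Cᵒᵖ) (m : M.obj U) : res M (𝟙 U) m = m := by
  change M.map (𝟙 U) m = m
  rw [M.map_id]
  rfl

theorem res_comp (M : PMod R) {U V W : Cᵒᵖ} (i : U ⟶ V) (j : V ⟶ W) (m : M.obj U) :
    res M (i ≫ j) m = res M j (res M i m) :=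
  M.map_comp_apply i j m

/-- The pushforward of a presheaf of modules along `F` and `φ : R ⟶ F.op ⋙ S`. -/
abbrev pushPMod {F : C ⥤ D} (φ : R ⟶ F.op ⋙ S) (N : PMod S) : PMod R :=
  (PresheafOfModules.pushforward (F := F)
      (Functor.whiskerRight φ (forget₂ CommRingCat RingCat))).obj N

/-- A morphism from `M` to the pushforward of `N`, from semilinear maps on sections. -/
def mkPModHom {F : C ⥤ D} (φ : R ⟶ F.op ⋙ S) (M : PMod R) (N : PMod S)
    (α : ∀ U, M.obj U →ₛₗ[(φ.app U).hom] N.obj (F.op.obj U))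
    (nat : ∀ {U V : Cᵒᵖ} (i : U ⟶ V) (x : M.obj U),
      α V (res M i x) = res N (F.op.map i) (α U x)) :
    M ⟶ pushPMod φ N where
  app U := ModuleCat.ofHom
      (Y := (ModuleCat.restrictScalars (φ.app U).hom).obj (N.obj (F.op.obj U)))
    { toFun := α U
      map_add' := map_add _
      map_smul' := fun c x => map_smulₛₗ (α U) c x }
  naturality i := ConcreteCategory.hom_ext _ _ fun x => nat i x

/-- The semilinear maps on sections of a morphism from `M` to the pushforward of `N`. -/
def pmodHomApp {F : C ⥤ D} (φ : R ⟶ F.op ⋙ S) {M : PMod R} {N : PMod S}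
    (α : M ⟶ pushPMod φ N) (U : Cᵒᵖ) :
    M.obj U →ₛₗ[(φ.app U).hom] N.obj (F.op.obj U) where
  toFun x := (α.app U).hom x
  map_add' x y := map_add (α.app U).hom x y
  map_smul' c x := (α.app U).hom.map_smul c x

theorem pmodHomApp_naturality {F : C ⥤ D} {φ : R ⟶ F.op ⋙ S} {M : PMod R} {N : PMod S}
    (α : M ⟶ pushPMod φ N) {U V : Cᵒᵖ} (i : U ⟶ V)
    (x : M.obj U) : pmodHomApp φ α V (res M i x) = res N (F.op.map i) (pmodHomApp φ α U x) :=
  PresheafOfModules.naturality_apply (M₁ := M) (M₂ := pushPMod φ N) α i x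

/-- The presheaf `U ↦ ⋀ᵖ M(U)`. -/
def exteriorPresheaf (M : PMod R) (p : ℕ) : PMod R :=
  mkPMod (fun U => ModuleCat.of (R.obj U) (⋀[R.obj U]^p (M.obj U)))
    (fun i => exteriorPowerMap (res M i) p)
    (fun U x => exteriorPowerMap_id (congrArg CommRingCat.Hom.hom (R.map_id U)) _
      (fun m => res_id M U m) p x)
    (fun i j x => exteriorPowerMap_comp _ _ _ (fun a => congr($(R.map_comp i j) a))
      (fun m => res_comp M i j m) p x)

/-- The morphism of exterior powers induced by a morphism from `M` to the pushforward of `N`. -/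
def exteriorPresheafMap {F : C ⥤ D} {φ : R ⟶ F.op ⋙ S} {M : PMod R} {N : PMod S}
    (α : M ⟶ pushPMod φ N) (p : ℕ) :
    exteriorPresheaf M p ⟶ pushPMod φ (exteriorPresheaf N p) :=
  mkPModHom φ _ _ (fun U => exteriorPowerMap (pmodHomApp φ α U) p) (fun {U V} i x =>
    exteriorPowerMap_square (res M i) (pmodHomApp φ α V) (pmodHomApp φ α U) (res N (F.op.map i))
      (fun a => congr($(φ.naturality i) a)) (pmodHomApp_naturality α i) p x)

/-- The morphism `M ⊗ P ⟶ f_* (N ⊗ Q)` induced by `M ⟶ f_* N` and `P ⟶ f_* Q`. -/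
def tensorPresheafMap {F : C ⥤ D} {φ : R ⟶ F.op ⋙ S} {M P : PMod R} {N Q : PMod S}
    (α : M ⟶ pushPMod φ N)
    (β : P ⟶ pushPMod φ Q) :
    PresheafOfModules.Monoidal.tensorObj M P ⟶ pushPMod φ (PresheafOfModules.Monoidal.tensorObj N Q) :=
  mkPModHom φ (PresheafOfModules.Monoidal.tensorObj M P) (PresheafOfModules.Monoidal.tensorObj N Q)
    (fun U => TensorProduct.map (pmodHomApp φ α U) (pmodHomApp φ β U)) (fun {U V} i x =>
    tensorMap_square (res M i) (pmodHomApp φ α V) (pmodHomApp φ α U) (res N (F.op.map i))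
      (res P i) (pmodHomApp φ β V) (pmodHomApp φ β U) (res Q (F.op.map i))
      (pmodHomApp_naturality α i) (pmodHomApp_naturality β i) x)

end Presheaf

/-! ### Differential forms on a scheme over an affine base -/

section Forms

variable {X Y : Scheme.{u}}

/-- The sheaf of modules associated with a presheaf of modules. -/
def assocSheaf (P : PMod X.presheaf) : X.Modules :=
  (PresheafOfModules.sheafification (R := X.ringCatSheaf) (𝟙 X.ringCatSheaf.obj)).obj P

/-- The presheaf of modules underlying a sheaf of modules. -/
def underlying (M : X.Modules) : PMod X.presheaf :=
  (Scheme.Modules.toPresheafOfModules X).obj M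

/-- The canonical morphism to the associated sheaf. -/
def toAssocSheaf (P : PMod X.presheaf) : P ⟶ underlying (assocSheaf P) :=
  (PresheafOfModules.sheafificationAdjunction
    (R := X.ringCatSheaf) (𝟙 X.ringCatSheaf.obj)).unit.app P

/-- The extension of `P ⟶ M` to the sheaf associated with `P`, for a sheaf `M`. -/
def assocSheafLift {P : PMod X.presheaf} {M : X.Modules} (α : P ⟶ underlying M) :
    assocSheaf P ⟶ M :=
  ((PresheafOfModules.sheafificationAdjunction
    (R := X.ringCatSheaf) (𝟙 X.ringCatSheaf.obj)).homEquiv P M).symm α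

/-- The pushforward of presheaves of modules along a morphism of schemes `f : Y ⟶ X`. -/
abbrev push (f : Y ⟶ X) (N : PMod Y.presheaf) : PMod X.presheaf :=
  pushPMod (F := Opens.map f.base) f.c N

/-- A morphism `P ⟶ f_* Q` of presheaves induces a morphism of associated sheaves. -/
def assocSheafPush (f : Y ⟶ X) {P : PMod X.presheaf} {Q : PMod Y.presheaf} (α : P ⟶ push f Q) :
    assocSheaf P ⟶ (Scheme.Modules.pushforward f).obj (assocSheaf Q) :=
  assocSheafLift (M := (Scheme.Modules.pushforward f).obj (assocSheaf Q))
    (α ≫ (PresheafOfModules.pushforward f.toRingCatSheafHom.hom).map (toAssocSheaf Q))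

variable {k : Type u} [CommRing k]

/-- The `k`-algebra structure on the sections of a scheme over `Spec k`. -/
def baseMap (s : X ⟶ Spec (.of k)) :
    (Functor.const X.Opensᵒᵖ).obj (CommRingCat.of k) ⟶ X.presheaf where
  app U := (Scheme.ΓSpecIso (.of k)).inv ≫ s.appTop ≫
    X.presheaf.map (homOfLE le_top : U.unop ⟶ ⊤).op
  naturality U V i := by
    simp [← Functor.map_comp]
    rfl

/-- The presheaf `U ↦ Ω_{Γ(X, U) / k}` of Kähler differentials. -/
def kaehlerPresheaf (s : X ⟶ Spec (.of k)) : PMod X.presheaf :=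
  PresheafOfModules.DifferentialsConstruction.relativeDifferentials' (baseMap s)

/-- The sheaf `Ω^p_{X/k}`, associated with `U ↦ ⋀ᵖ Ω_{Γ(X, U) / k}`. -/
def forms (s : X ⟶ Spec (.of k)) (p : ℕ) : X.Modules :=
  assocSheaf (exteriorPresheaf (kaehlerPresheaf s) p)

variable {sX : X ⟶ Spec (.of k)} {sY : Y ⟶ Spec (.of k)} (f : Y ⟶ X) (hf : f ≫ sX = sY)

theorem baseMap_comp (hf : f ≫ sX = sY) (U : X.Opens) :
    𝟙 _ ≫ (baseMap sY).app (op (f ⁻¹ᵁ U)) = (baseMap sX).app (op U) ≫ f.app U := by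
  subst hf
  simp only [baseMap, Category.id_comp, Category.assoc, Scheme.Hom.comp_appTop]
  rw [Scheme.Hom.naturality]
  rfl

theorem kaehler_induction {A B : CommRingCat.{u}} {φ : A ⟶ B}
    {P : CommRingCat.KaehlerDifferential φ → Prop}
    (d : ∀ b, P (CommRingCat.KaehlerDifferential.d b)) (zero : P 0)
    (add : ∀ x y, P x → P y → P (x + y)) (smul : ∀ (b : B) x, P x → P (b • x))
    (x : CommRingCat.KaehlerDifferential φ) : P x := by
  let _ := φ.hom.toAlgebra
  have hx : x ∈ Submodule.span B (Set.range (KaehlerDifferential.D A B)) := by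
    rw [KaehlerDifferential.span_range_derivation]; trivial
  induction hx using Submodule.span_induction with
  | mem x hx => obtain ⟨b, rfl⟩ := hx; exact d b
  | zero => exact zero
  | add x y _ _ hx hy => exact add x y hx hy
  | smul a x _ hx => exact smul a x hx

/-- The semilinear map `db ↦ d(g b)` induced by a commutative square of rings. -/
def kaehlerMap {A B A' B' : CommRingCat.{u}} {φ : A ⟶ B} {φ' : A' ⟶ B'} {a : A ⟶ A'} {g : B ⟶ B'}
    (h : a ≫ φ' = φ ≫ g) :
    CommRingCat.KaehlerDifferential φ →ₛₗ[g.hom] CommRingCat.KaehlerDifferential φ' where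
  toFun x := CommRingCat.KaehlerDifferential.map h x
  map_add' := map_add _
  map_smul' c x := (CommRingCat.KaehlerDifferential.map h).hom.map_smul c x

theorem kaehlerMap_d {A B A' B' : CommRingCat.{u}} {φ : A ⟶ B} {φ' : A' ⟶ B'} {a : A ⟶ A'}
    {g : B ⟶ B'} (h : a ≫ φ' = φ ≫ g) (b : B) :
    kaehlerMap h (CommRingCat.KaehlerDifferential.d b) =
      CommRingCat.KaehlerDifferential.d (g b) :=
  CommRingCat.KaehlerDifferential.map_d h b

theorem kaehlerMap_square {A A₁ A₂ A₃ B B₁ B₂ B₃ : CommRingCat.{u}} {φ : A ⟶ B} {φ₁ : A₁ ⟶ B₁}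
    {φ₂ : A₂ ⟶ B₂} {φ₃ : A₃ ⟶ B₃} {a₁ : A ⟶ A₁} {b₁ : B ⟶ B₁} {a₂ : A ⟶ A₂} {b₂ : B ⟶ B₂}
    {a₁' : A₁ ⟶ A₃} {b₁' : B₁ ⟶ B₃} {a₂' : A₂ ⟶ A₃} {b₂' : B₂ ⟶ B₃}
    (h₁ : a₁ ≫ φ₁ = φ ≫ b₁) (h₂ : a₂ ≫ φ₂ = φ ≫ b₂) (h₁' : a₁' ≫ φ₃ = φ₁ ≫ b₁')
    (h₂' : a₂' ≫ φ₃ = φ₂ ≫ b₂') (h : b₁ ≫ b₁' = b₂ ≫ b₂')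
    (x : CommRingCat.KaehlerDifferential φ) :
    kaehlerMap h₁' (kaehlerMap h₁ x) = kaehlerMap h₂' (kaehlerMap h₂ x) := by
  have key : ∀ b : B, b₁' (b₁ b) = b₂' (b₂ b) := fun b => congr($h b)
  exact kaehler_induction (P := fun x =>
    kaehlerMap h₁' (kaehlerMap h₁ x) = kaehlerMap h₂' (kaehlerMap h₂ x))
    (fun b => by simp only [kaehlerMap_d, key]) (by simp only [map_zero])
    (fun x y hx hy => by simp only [map_add, hx, hy])
    (fun b x hx => by simp only [map_smulₛₗ, hx, key]) x

/-- The pullback of Kähler differentials, `dg ↦ d(f^* g)`. -/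
def kaehlerPullback : kaehlerPresheaf sX ⟶ push f (kaehlerPresheaf sY) :=
  mkPModHom (F := Opens.map f.base) f.c _ _
    (fun U => kaehlerMap (baseMap_comp f hf U.unop))
    (fun {U V} i x =>
      kaehlerMap_square ((baseMap sX).naturality i) (baseMap_comp f hf U.unop)
        (baseMap_comp f hf V.unop) ((baseMap sY).naturality ((Opens.map f.base).op.map i))
        (f.c.naturality i) x)

/-- The pullback of `p`-forms along a morphism over `k`, as a morphism `Ω^p_X ⟶ f_* Ω^p_Y`. -/
def formsPullback (p : ℕ) : forms sX p ⟶ (Scheme.Modules.pushforward f).obj (forms sY p) :=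
  assocSheafPush f (exteriorPresheafMap (F := Opens.map f.base) (φ := f.c)
    (kaehlerPullback f hf) p)

end Forms

/-! ### Twisting sheaves on `Proj` -/

section Twist

variable {A B σ τ : Type u} [CommRing A] [SetLike σ A] [AddSubgroupClass σ A]
  [CommRing B] [SetLike τ B] [AddSubgroupClass τ B]
  (𝒜 : ℕ → σ) [GradedRing 𝒜] (ℬ : ℕ → τ) [GradedRing ℬ]

/-- The localization `A_x` at the homogeneous prime of a point `x` of `Proj`. -/
abbrev LocalAt (x : ProjectiveSpectrum 𝒜) : Type u :=
  Localization.AtPrime x.asHomogeneousIdeal.toIdeal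

/-- Families of elements `s x ∈ A_x`, for `x ∈ U`. -/
abbrev LocalFamily (U : (Proj 𝒜).Opens) : Type u :=
  ∀ x : {x : ProjectiveSpectrum 𝒜 // x ∈ U}, LocalAt 𝒜 x.1

variable {𝒜} in
/-- The family `s` is locally a quotient `a / b` of homogeneous elements of `A` with
`deg a = deg b + d`. -/
def IsLocallyQuotient (d : ℕ) {U : (Proj 𝒜).Opens} (s : LocalFamily 𝒜 U) : Prop :=
  ∀ x ∈ U, ∃ V : (Proj 𝒜).Opens, x ∈ V ∧ ∃ (j : ℕ) (a b : A), a ∈ 𝒜 (j + d) ∧ b ∈ 𝒜 j ∧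
    ∀ (y : ProjectiveSpectrum 𝒜) (hy : y ∈ U), y ∈ V → b ∉ y.asHomogeneousIdeal.toIdeal ∧
      algebraMap A (LocalAt 𝒜 y) b * s ⟨y, hy⟩ = algebraMap A (LocalAt 𝒜 y) a

/-- The sections over `U` of the twisting sheaf `O(d)`, for `d ≥ 0`. -/
def twistSections (d : ℕ) (U : (Proj 𝒜).Opens) : AddSubgroup (LocalFamily 𝒜 U) where
  carrier := {s | IsLocallyQuotient d s}
  zero_mem' x _ := ⟨⊤, trivial, 0, 0, 1, zero_mem _, SetLike.GradedOne.one_mem,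
    fun y _ _ => ⟨fun h => y.isPrime.ne_top ((Ideal.eq_top_iff_one _).2 h), by simp⟩⟩
  add_mem' {s t} hs ht x hx := by
    obtain ⟨V, hV, j, a, b, ha, hb, h⟩ := hs x hx
    obtain ⟨V', hV', j', a', b', ha', hb', h'⟩ := ht x hx
    refine ⟨V ⊓ V', ⟨hV, hV'⟩, j + j', b' * a + b * a', b * b', add_mem ?_ ?_,
      SetLike.mul_mem_graded hb hb', fun y hy hyV => ⟨fun hbb => ?_, ?_⟩⟩
    · have := SetLike.mul_mem_graded hb' ha
      rwa [show j' + (j + d) = j + j' + d by omega] at this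
    · have := SetLike.mul_mem_graded hb ha'
      rwa [show j + (j' + d) = j + j' + d by omega] at this
    · exact (y.isPrime.mem_or_mem hbb).elim (h y hy hyV.1).1 (h' y hy hyV.2).1
    · simp only [Pi.add_apply, map_add, map_mul, ← (h y hy hyV.1).2, ← (h' y hy hyV.2).2]
      ring
  neg_mem' {s} hs x hx := by
    obtain ⟨V, hV, j, a, b, ha, hb, h⟩ := hs x hx
    refine ⟨V, hV, j, -a, b, neg_mem ha, hb, fun y hy hyV => ⟨(h y hy hyV).1, ?_⟩⟩
    simp only [Pi.neg_apply, map_neg, ← (h y hy hyV).2, mul_neg]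

/-- The value in `A_x` of a section of the structure sheaf. -/
def sectionVal {U : (Proj 𝒜).Opens} (r : Γ(Proj 𝒜, U)) : LocalFamily 𝒜 U :=
  fun x => (r.1 x).val

theorem algebraMap_mul_mk {x : ProjectiveSpectrum 𝒜} (a b : A)
    (hb : b ∈ x.asHomogeneousIdeal.toIdeal.primeCompl) :
    algebraMap A (LocalAt 𝒜 x) b * Localization.mk a ⟨b, hb⟩ = algebraMap A (LocalAt 𝒜 x) a := by
  rw [Localization.mk_eq_mk']
  exact IsLocalization.mk'_spec' _ a ⟨b, hb⟩

theorem sectionVal_isLocallyQuotient {U : (Proj 𝒜).Opens} (r : Γ(Proj 𝒜, U)) :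
    IsLocallyQuotient 0 (sectionVal 𝒜 r) := by
  intro x hx
  obtain ⟨V, hV, i, j, a, b, hb, h⟩ := r.2 ⟨x, hx⟩
  refine ⟨V, hV, j, a, b, a.2, b.2, fun y hy hyV => ⟨hb ⟨y, hyV⟩, ?_⟩⟩
  have h' : r.1 ⟨y, hy⟩ = _ := h ⟨y, hyV⟩
  refine (congrArg (fun z => algebraMap A (LocalAt 𝒜 y) b * HomogeneousLocalization.val z)
    h').trans ?_
  exact algebraMap_mul_mk 𝒜 _ _ _

variable {𝒜} in
theorem IsLocallyQuotient.mul {d e : ℕ} {U : (Proj 𝒜).Opens} {s t : LocalFamily 𝒜 U}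
    (hs : IsLocallyQuotient d s) (ht : IsLocallyQuotient e t) :
    IsLocallyQuotient (d + e) (fun x => s x * t x) := by
  intro x hx
  obtain ⟨V, hV, j, a, b, ha, hb, h⟩ := hs x hx
  obtain ⟨V', hV', j', a', b', ha', hb', h'⟩ := ht x hx
  refine ⟨V ⊓ V', ⟨hV, hV'⟩, j + j', a * a', b * b', ?_,
    SetLike.mul_mem_graded hb hb', fun y hy hyV => ⟨fun hbb => ?_, ?_⟩⟩
  · have := SetLike.mul_mem_graded ha ha'
    rwa [show j + d + (j' + e) = j + j' + (d + e) by omega] at this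
  · exact (y.isPrime.mem_or_mem hbb).elim (h y hy hyV.1).1 (h' y hy hyV.2).1
  · simp only [map_mul, ← (h y hy hyV.1).2, ← (h' y hy hyV.2).2]
    ring

variable {𝒜} in
theorem IsLocallyQuotient.algebraMap {d : ℕ} (U : (Proj 𝒜).Opens) {a : A} (ha : a ∈ 𝒜 d) :
    IsLocallyQuotient (U := U) d (fun x => algebraMap A (LocalAt 𝒜 x.1) a) := fun x _ =>
  ⟨⊤, trivial, 0, a, 1, by rwa [zero_add], SetLike.GradedOne.one_mem,
    fun y _ _ => ⟨fun h => y.isPrime.ne_top ((Ideal.eq_top_iff_one _).2 h), by simp⟩⟩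

instance (d : ℕ) (U : (Proj 𝒜).Opens) : Module Γ(Proj 𝒜, U) (twistSections 𝒜 d U) where
  smul r s := ⟨fun x => sectionVal 𝒜 r x * s.1 x, by
    have := (sectionVal_isLocallyQuotient 𝒜 r).mul s.2
    rwa [zero_add] at this⟩
  one_smul s := Subtype.ext (funext fun x => by
    change (1 : HomogeneousLocalization.AtPrime 𝒜 _).val * s.1 x = s.1 x
    simp)
  mul_smul r r' s := Subtype.ext (funext fun x => by
    change (r.1 x * r'.1 x).val * s.1 x =
      (r.1 x).val * ((r'.1 x).val * s.1 x)
    simp [mul_assoc])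
  smul_zero r := Subtype.ext (funext fun x => mul_zero _)
  smul_add r s s' := Subtype.ext (funext fun x => mul_add _ _ _)
  add_smul r r' s := Subtype.ext (funext fun x => by
    change (r.1 x + r'.1 x).val * s.1 x =
      (r.1 x).val * s.1 x + (r'.1 x).val * s.1 x
    simp [add_mul])
  zero_smul s := Subtype.ext (funext fun x => by
    change (0 : HomogeneousLocalization.AtPrime 𝒜 _).val * s.1 x = 0
    simp)

instance (d : ℕ) (U : (Proj 𝒜).Opensᵒᵖ) :
    Module ((Proj 𝒜).presheaf.obj U) (twistSections 𝒜 d U.unop) :=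
  inferInstanceAs (Module Γ(Proj 𝒜, U.unop) (twistSections 𝒜 d U.unop))

/-- The restriction of sections of `O(d)`. -/
def twistRes (d : ℕ) {U V : (Proj 𝒜).Opensᵒᵖ} (i : U ⟶ V) :
    twistSections 𝒜 d U.unop →ₛₗ[((Proj 𝒜).presheaf.map i).hom] twistSections 𝒜 d V.unop where
  toFun s := ⟨fun x => s.1 ⟨x.1, i.unop.le x.2⟩, fun x hx => by
    obtain ⟨W, hW, j, a, b, ha, hb, h⟩ := s.2 x (i.unop.le hx)
    exact ⟨W, hW, j, a, b, ha, hb, fun y hy => h y (i.unop.le hy)⟩⟩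
  map_add' _ _ := rfl
  map_smul' _ _ := rfl

/-- The twisting sheaf `O(d)` on `Proj`, as a presheaf of modules. -/
def twistingSheaf (d : ℕ) : PMod (Proj 𝒜).presheaf :=
  mkPMod (fun U => ModuleCat.of ((Proj 𝒜).presheaf.obj U) (twistSections 𝒜 d U.unop))
    (fun i => twistRes 𝒜 d i) (fun _ _ => rfl) (fun _ _ _ => rfl)

/-- Multiplication by a homogeneous element `a ∈ A_e` on the sections of `O(d)`. -/
def twistSectionsMul {e : ℕ} {a : A} (ha : a ∈ 𝒜 e) (d : ℕ) (U : (Proj 𝒜).Opens) :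
    twistSections 𝒜 d U →ₗ[Γ(Proj 𝒜, U)] twistSections 𝒜 (d + e) U where
  toFun s := ⟨fun x => s.1 x * algebraMap A (LocalAt 𝒜 x.1) a,
    s.2.mul (IsLocallyQuotient.algebraMap U ha)⟩
  map_add' _ _ := Subtype.ext (funext fun _ => add_mul _ _ _)
  map_smul' _ _ := Subtype.ext (funext fun _ => mul_assoc _ _ _)

/-- Multiplication by a homogeneous element `a ∈ A_e`, as a morphism `O(d) ⟶ O(d + e)`. -/
def twistingMul {e : ℕ} {a : A} (ha : a ∈ 𝒜 e) (d : ℕ) :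
    twistingSheaf 𝒜 d ⟶ twistingSheaf 𝒜 (d + e) where
  app U := ModuleCat.ofHom (twistSectionsMul 𝒜 ha d U.unop)
  naturality _ := ConcreteCategory.hom_ext _ _ fun _ => rfl

variable {𝒜 ℬ} in
/-- The map `a / b ↦ f a / f b` on the sections of `O(d)`, for a homomorphism `f` of graded
rings. -/
def twistSectionsMap (f : 𝒜 →+*ᵍ ℬ)
    (hf : HomogeneousIdeal.irrelevant ℬ ≤ (HomogeneousIdeal.irrelevant 𝒜).map f) (d : ℕ)
    (U : (Proj 𝒜).Opens) :
    twistSections 𝒜 d U →ₛₗ[((Proj.map f hf).app U).hom]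
      twistSections ℬ d ((Proj.map f hf) ⁻¹ᵁ U) where
  toFun s := ⟨fun y => Localization.localRingHom _ _ f.toRingHom rfl
      (s.1 ⟨ProjectiveSpectrum.comapFun f hf y.1, y.2⟩), by
    intro y hy
    obtain ⟨V, hV, j, a, b, ha, hb, h⟩ := s.2 _ hy
    refine ⟨(Proj.map f hf) ⁻¹ᵁ V, hV, j, f a, f b, f.map_mem ha, f.map_mem hb,
      fun z hz hzV => ⟨(h _ hz hzV).1, ?_⟩⟩
    have := congrArg (Localization.localRingHom _ _ f.toRingHom rfl) (h _ hz hzV).2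
    exact ((map_mul (Localization.localRingHom _ _ f.toRingHom rfl) _ _).trans
      (congrArg (· * _) (Localization.localRingHom_to_map _ _ _ rfl b))).symm.trans
        (this.trans (Localization.localRingHom_to_map _ _ _ rfl a))⟩
  map_add' _ _ := Subtype.ext (funext fun _ => map_add _ _ _)
  map_smul' r s := Subtype.ext (funext fun y => by
    refine (map_mul (Localization.localRingHom _ _ f.toRingHom rfl) _ _).trans ?_
    refine congrArg (· * _) ?_
    exact (HomogeneousLocalization.val_localRingHom _).symm)

variable {𝒜 ℬ} in
/-- The morphism `O(d) ⟶ f_* O(d)` for the morphism of `Proj`s induced by a homomorphism of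
graded rings. -/
def twistingPullback (f : 𝒜 →+*ᵍ ℬ)
    (hf : HomogeneousIdeal.irrelevant ℬ ≤ (HomogeneousIdeal.irrelevant 𝒜).map f) (d : ℕ) :
    twistingSheaf 𝒜 d ⟶ push (Proj.map f hf) (twistingSheaf ℬ d) :=
  mkPModHom (F := Opens.map (Proj.map f hf).base) (Proj.map f hf).c
    (twistingSheaf 𝒜 d) (twistingSheaf ℬ d)
    (fun U => twistSectionsMap f hf d U.unop) (fun _ _ => rfl)

/-- The twist `M(d) = M ⊗ O(d)`. -/
def twist (M : (Proj 𝒜).Modules) (d : ℕ) : (Proj 𝒜).Modules :=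
  assocSheaf (PresheafOfModules.Monoidal.tensorObj (underlying M) (twistingSheaf 𝒜 d))

/-- Multiplication by a homogeneous element `a ∈ A_e`, as a morphism `M(d) ⟶ M(d + e)`. -/
def twistMul (M : (Proj 𝒜).Modules) {e : ℕ} {a : A} (ha : a ∈ 𝒜 e) (d : ℕ) :
    twist 𝒜 M d ⟶ twist 𝒜 M (d + e) :=
  (PresheafOfModules.sheafification (R := (Proj 𝒜).ringCatSheaf)
      (𝟙 (Proj 𝒜).ringCatSheaf.obj)).map
    (PresheafOfModules.Monoidal.tensorHom (𝟙 (underlying M)) (twistingMul 𝒜 ha d))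

variable {𝒜 ℬ} in
/-- The twist `M(d) ⟶ f_* (N(d))` of a morphism `M ⟶ f_* N`. -/
def twistPush (f : 𝒜 →+*ᵍ ℬ)
    (hf : HomogeneousIdeal.irrelevant ℬ ≤ (HomogeneousIdeal.irrelevant 𝒜).map f)
    {M : (Proj 𝒜).Modules} {N : (Proj ℬ).Modules}
    (φ : M ⟶ (Scheme.Modules.pushforward (Proj.map f hf)).obj N) (d : ℕ) :
    twist 𝒜 M d ⟶ (Scheme.Modules.pushforward (Proj.map f hf)).obj (twist ℬ N d) :=
  assocSheafPush (Proj.map f hf) (tensorPresheafMap (F := Opens.map (Proj.map f hf).base)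
    (φ := (Proj.map f hf).c) (N := underlying N)
    ((Scheme.Modules.toPresheafOfModules (Proj 𝒜)).map φ) (twistingPullback f hf d))

end Twist

/-! ### Projective space and its hyperplane -/

section ProjectiveSpace

variable (k : Type u) [Field k] (n : ℕ)

/-- The polynomial ring `k[x₀, …, xₙ]` with its grading by degree. -/
abbrev grading : ℕ → Submodule k (MvPolynomial (Fin (n + 1)) k) :=
  MvPolynomial.homogeneousSubmodule (Fin (n + 1)) k

instance : GradedAlgebra (grading k n) := MvPolynomial.gradedAlgebra

/-- Projective `n`-space `Proj k[x₀, …, xₙ]`. -/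
abbrev ProjectiveSpace : Scheme.{u} := Proj (grading k n)

/-- The structure morphism of projective space. -/
def ProjectiveSpace.toSpec : ProjectiveSpace k n ⟶ Spec (.of k) :=
  Proj.toSpecZero (grading k n) ≫ Spec.map (CommRingCat.ofHom (algebraMap k (grading k n 0)))

/-- The homomorphism `k[x₀, …, xₙ₊₁] → k[x₀, …, xₙ]` with kernel `(xₙ₊₁)`. -/
def killLast : grading k (n + 1) →+*ᵍ grading k n where
  toRingHom := (MvPolynomial.aeval (R := k)
    (Fin.snoc (α := fun _ => MvPolynomial (Fin (n + 1)) k) MvPolynomial.X 0)).toRingHom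
  map_mem {d p} hp := by
    have h : ∀ j : Fin (n + 1 + 1), (Fin.snoc (α := fun _ => MvPolynomial (Fin (n + 1)) k)
        MvPolynomial.X 0 j).IsHomogeneous 1 := by
      intro j
      refine Fin.lastCases ?_ (fun j => ?_) j
      · rw [Fin.snoc_last]; exact MvPolynomial.isHomogeneous_zero _ _ _
      · rw [Fin.snoc_castSucc]; exact MvPolynomial.isHomogeneous_X _ _
    have := MvPolynomial.IsHomogeneous.aeval hp _ h
    rwa [one_mul] at this

theorem killLast_irrelevant : HomogeneousIdeal.irrelevant (grading k n) ≤
    (HomogeneousIdeal.irrelevant (grading k (n + 1))).map (killLast k n) := by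
  refine (HomogeneousIdeal.irrelevant_le _).2 fun d hd q hq => ?_
  have hq' : MvPolynomial.rename Fin.castSucc q ∈ grading k (n + 1) d :=
    MvPolynomial.IsHomogeneous.rename_isHomogeneous hq
  have h : killLast k n (MvPolynomial.rename Fin.castSucc q) = q := by
    change MvPolynomial.aeval (R := k) (Fin.snoc (α := fun _ => MvPolynomial (Fin (n + 1)) k)
      MvPolynomial.X 0) (MvPolynomial.rename Fin.castSucc q) = q
    rw [MvPolynomial.aeval_rename]
    have : (Fin.snoc (α := fun _ => MvPolynomial (Fin (n + 1)) k) MvPolynomial.X 0) ∘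
        Fin.castSucc = MvPolynomial.X := funext fun j => Fin.snoc_castSucc _ _ _
    rw [this, MvPolynomial.aeval_X_left_apply]
  rw [← h]
  exact Ideal.mem_map_of_mem _ (HomogeneousIdeal.mem_irrelevant_of_mem _ hd hq')

/-- The inclusion of the hyperplane `xₙ₊₁ = 0`. -/
def hyperplane : ProjectiveSpace k n ⟶ ProjectiveSpace k (n + 1) :=
  Proj.map (killLast k n) (killLast_irrelevant k n)

theorem awayι_hyperplane_toSpec {d : ℕ} (hd : 0 < d) (s : MvPolynomial (Fin (n + 1 + 1)) k)
    (hs : s ∈ grading k (n + 1) d) :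
    Proj.awayι (grading k n) (killLast k n s) ((killLast k n).map_mem hs) hd ≫
      hyperplane k n ≫ ProjectiveSpace.toSpec k (n + 1) =
    Proj.awayι (grading k n) (killLast k n s) ((killLast k n).map_mem hs) hd ≫
      ProjectiveSpace.toSpec k n := by
  rw [hyperplane, ProjectiveSpace.toSpec, ProjectiveSpace.toSpec,
    Proj.awayι_comp_map_assoc _ _ hd s hs, Proj.awayι_toSpecZero_assoc,
    Proj.awayι_toSpecZero_assoc, ← Spec.map_comp, ← Spec.map_comp, ← Spec.map_comp,
    ← CommRingCat.ofHom_comp, ← CommRingCat.ofHom_comp, ← CommRingCat.ofHom_comp]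
  congr 2
  refine RingHom.ext fun x => ?_
  have h0 : killLast k n (MvPolynomial.C x) = MvPolynomial.C x := MvPolynomial.aeval_C _ x
  exact congrArg HomogeneousLocalization.mk
    (HomogeneousLocalization.NumDenSameDeg.ext _ rfl h0 (map_one (killLast k n)))

theorem hyperplane_toSpec :
    hyperplane k n ≫ ProjectiveSpace.toSpec k (n + 1) = ProjectiveSpace.toSpec k n :=
  (Proj.mapAffineOpenCover (killLast k n)
    (killLast_irrelevant k n)).openCover.hom_ext _ _ fun s =>
      awayι_hyperplane_toSpec k n s.1.2 s.2.1 s.2.2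

/-- The sheaf of twisted forms `Ω^p(d)` on projective `n`-space. -/
def twistedForms (p d : ℕ) : (ProjectiveSpace k n).Modules :=
  twist (grading k n) (forms (ProjectiveSpace.toSpec k n) p) d

/-- The restriction of twisted forms to the hyperplane `xₙ₊₁ = 0`. -/
def restrictForms (p d : ℕ) : twistedForms k (n + 1) p d ⟶
    (Scheme.Modules.pushforward (hyperplane k n)).obj (twistedForms k n p d) :=
  twistPush (killLast k n) (killLast_irrelevant k n)
    (formsPullback (hyperplane k n) (hyperplane_toSpec k n) p) d

/-- Multiplication by the last coordinate `xₙ`. -/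
def mulLast (p d : ℕ) : twistedForms k n p d ⟶ twistedForms k n p (d + 1) :=
  twistMul (grading k n) _
    (show MvPolynomial.X (Fin.last n) ∈ grading k n 1 from MvPolynomial.isHomogeneous_X _ _) d

end ProjectiveSpace

/-! ### Elementary transformations -/

section ElementaryTransformation

/-- The free module of rank `r`. -/
def freeModule (X : Scheme.{u}) (r : ℕ) : X.Modules :=
  SheafOfModules.free (R := X.ringCatSheaf) (ULift.{u} (Fin r))

/-- Vector bundles: locally free sheaves of finite rank. -/
def IsVectorBundle {X : Scheme.{u}} (M : X.Modules) : Prop :=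
  ∀ x : X, ∃ U : X.Opens, x ∈ U ∧ ∃ r : ℕ, Nonempty (M.restrict U.ι ≅ freeModule U.toScheme r)

variable {X H : Scheme.{u}} (i : H ⟶ X)

/-- The canonical morphism `F ⟶ F|_H = i_* i^* F`. -/
def toRestriction (F : X.Modules) :
    F ⟶ (Scheme.Modules.pushforward i).obj ((Scheme.Modules.pullback i).obj F) :=
  (Scheme.Modules.pullbackPushforwardAdjunction i).unit.app F

/-- The restriction `ψ|_H : i^* F ⟶ F'` of a morphism `ψ : F ⟶ i_* F'`. -/
def restrictionHom {F : X.Modules} {F' : H.Modules}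
    (ψ : F ⟶ (Scheme.Modules.pushforward i).obj F') : (Scheme.Modules.pullback i).obj F ⟶ F' :=
  ((Scheme.Modules.pullbackPushforwardAdjunction i).homEquiv F F').symm ψ

/-- The display of an elementary transformation of vector bundles along a divisor `i : H ⟶ X`.
Given vector bundles `F` on `X` and `F'` on `H`, a morphism `ψ : F ⟶ i_* F'` and the inclusion
`m : F(-H) ⟶ F`, it consists of a commutative diagram
```
            0           0
            ↓           ↓
          F(-H)   =   F(-H)
            ↓ j         ↓ m
      0  →  E     →a    F     →ψ      F'  →  0
            ↓ b         ↓             ‖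
      0  →  F''   →c   F|_H   →ψ|_H   F'  →  0
            ↓           ↓
            0           0
```
with exact rows and columns, where `E` and `F''` are vector bundles on `X` and on `H`. Modules on
`H` are viewed as modules on `X` through `i_*`; the exactness of the bottom row is stated on `H`. -/
structure ElementaryTransformation {FH F : X.Modules} {F' : H.Modules} (m : FH ⟶ F)
    (ψ : F ⟶ (Scheme.Modules.pushforward i).obj F') (E : X.Modules) (F'' : H.Modules) where
  a : E ⟶ F
  b : E ⟶ (Scheme.Modules.pushforward i).obj F''
  c : F'' ⟶ (Scheme.Modules.pullback i).obj F
  j : FH ⟶ E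
  isVectorBundle_F : IsVectorBundle F
  isVectorBundle_F' : IsVectorBundle F'
  isVectorBundle_E : IsVectorBundle E
  isVectorBundle_F'' : IsVectorBundle F''
  isVectorBundle_FH : IsVectorBundle FH
  comm_top : j ≫ a = m
  comm_left : a ≫ toRestriction i F = b ≫ (Scheme.Modules.pushforward i).map c
  comm_right : toRestriction i F ≫ (Scheme.Modules.pushforward i).map (restrictionHom i ψ) = ψ
  a_ψ : a ≫ ψ = 0
  c_ψ : c ≫ restrictionHom i ψ = 0
  j_b : j ≫ b = 0
  m_res : m ≫ toRestriction i F = 0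
  middleRow : (ShortComplex.mk a ψ a_ψ).ShortExact
  bottomRow : (ShortComplex.mk c (restrictionHom i ψ) c_ψ).ShortExact
  leftColumn : (ShortComplex.mk j b j_b).ShortExact
  middleColumn : (ShortComplex.mk m (toRestriction i F) m_res).ShortExact

end ElementaryTransformation

end ElementaryTransformations

end

/-!
Write `H` for the hyperplane `xₙ₊₁ = 0` of `ℙⁿ⁺¹`. The kernel of the restriction of
`Ω^{p+1}(p+2)` to `H` is trivial because of contraction with the Euler vector field
`ξ = ∑ⱼ xⱼ ∂/∂xⱼ`: for a set `T` of `p + 1` of the indices `0, …, n`, the contraction of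
`dxₙ₊₁ ∧ dx_T` with `ξ` is a global section of `Ω^{p+1}(p+2)` on `ℙⁿ⁺¹` that vanishes on restriction
to `H`, and these sections are a basis of the kernel. This is the map `a = lastContraction` of the
middle row. The map `b = hyperplaneContraction` of the left column sends the same basis vector to the
contraction of `dx_T` with `ξ` on `H`, a section of `Ω^p(p+1)`. Sections of `Ω^q(q+1)` of this kind
are defined chart by chart (`contractionOn`). They agree on overlaps (`contractionOn_eq`) because a
change of chart multiplies all pairs `(yⱼ, dyⱼ)` by a common unit, after adding to each `dyⱼ` the
multiple `yⱼ η` of a fixed form `η`; such a shear leaves the contraction unchanged (`eulerForm_shear`).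

All exactness statements are local, and they are read off from frames in which every map is diagonal
with entries `1`, `t` and `0`, where `t` is an equation of `H` (`AdaptedFrames`). On the chart `xᵢ ≠ 0`
with `i ≤ n`, with coordinates `yⱼ = xⱼ / xᵢ` and `t = yₙ₊₁`, the frames of the twisted forms consist of
the products of the `dyⱼ` without and with the factor `dt`. The free module of rank `n + 1`, of which
the source of `a` is an exterior power, is given the basis `eᵢ`, `eⱼ - yⱼ eᵢ`. Then `a` takes the
products without `eᵢ` to `t` times the forms without `dt`, and those with `eᵢ` to the forms with `dt`,
up to a sign that is absorbed in the frame; `b` kills the former and takes the latter to a frame of the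
forms on `H` (`adaptedFramesCastSucc`). On the chart `xₙ₊₁ ≠ 0`, which does not meet `H`, `a` is an
isomorphism (`adaptedFramesLast`).

The display follows formally (`nonempty_elementaryTransformation`): the remaining maps are induced by
kernels and cokernels, and the one between sheaves on `H` descends from `ℙⁿ⁺¹` because `i_*` is full
and faithful. Three facts about sheaves of modules enter. A frame of `F` over `U` gives a frame of
`i^* F` over the inverse image of `U` (`IsFrame.pullback`). Functions on `H` lift locally to `ℙⁿ⁺¹`
(`hyperplane_surjectiveOnFunctions`), and those that vanish on `H` are the multiples of `t`
(`exists_eq_coord_mul`). Products of the `dyⱼ` are frames of the sheaves of twisted forms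
(`isFrame_twForm`), because the functions on a chart are polynomials in the `yⱼ` (`chart_bijective`)
and Kähler differentials of localizations of polynomial rings are free (`isLocalBasis_dSec`).
-/

noncomputable section

namespace ElementaryTransformations

/-! ### Sections of sheaves of modules -/

section Sections

variable {X Y : Scheme.{u}}

/-- Restriction of sections of a presheaf of modules to a smaller open set. -/
def rs (P : PMod X.presheaf) {V U : X.Opens} (h : V ≤ U) :
    P.obj (op U) →ₛₗ[(X.presheaf.map (homOfLE h).op).hom] P.obj (op V) :=
  res P (homOfLE h).op

/-- Restriction of functions to a smaller open set. -/
abbrev rr {V U : X.Opens} (h : V ≤ U) : Γ(X, U) →+* Γ(X, V) :=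
  (X.presheaf.map (homOfLE h).op).hom

theorem rr_rr {U V W : X.Opens} (h : V ≤ U) (h' : W ≤ V) (c : Γ(X, U)) :
    rr h' (rr h c) = rr (h'.trans h) c := by
  change (X.presheaf.map _ ≫ X.presheaf.map _) c = _
  rw [← Functor.map_comp]
  rfl

theorem rr_self {U : X.Opens} (h : U ≤ U) (c : Γ(X, U)) : rr h c = c := by
  change X.presheaf.map (𝟙 (op U)) c = c
  rw [X.presheaf.map_id]
  rfl

theorem rs_rs (P : PMod X.presheaf) {U V W : X.Opens} (h : V ≤ U) (h' : W ≤ V)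
    (s : P.obj (op U)) : rs P h' (rs P h s) = rs P (h'.trans h) s :=
  (res_comp P _ _ _).symm

theorem rs_self (P : PMod X.presheaf) {U : X.Opens} (h : U ≤ U) (s : P.obj (op U)) :
    rs P h s = s :=
  res_id P _ s

theorem rs_smul (P : PMod X.presheaf) {U V : X.Opens} (h : V ≤ U) (c : Γ(X, U))
    (s : P.obj (op U)) : rs P h (c • s) = rr h c • rs P h s :=
  map_smulₛₗ _ _ _

theorem rs_sum_smul (P : PMod X.presheaf) {U V W : X.Opens} {ι : Type*} [Fintype ι]
    (s : ι → P.obj (op U)) (h : V ≤ U) (h' : W ≤ V) (c : ι → Γ(X, V)) :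
    rs P h' (∑ j, c j • rs P h (s j)) = ∑ j, rr h' (c j) • rs P (h'.trans h) (s j) := by
  rw [map_sum]
  refine Finset.sum_congr rfl fun j _ => ?_
  rw [rs_smul, rs_rs]

/-- The action of a morphism of presheaves of modules on sections. -/
def pap {P Q : PMod X.presheaf} (φ : P ⟶ Q) (U : X.Opens) :
    P.obj (op U) →ₗ[Γ(X, U)] Q.obj (op U) :=
  (φ.app (op U)).hom

theorem pap_rs {P Q : PMod X.presheaf} (φ : P ⟶ Q) {U V : X.Opens} (h : V ≤ U)
    (s : P.obj (op U)) : pap φ V (rs P h s) = rs Q h (pap φ U s) :=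
  PresheafOfModules.naturality_apply φ (homOfLE h).op s

theorem pmod_hom_ext {P Q : PMod X.presheaf} {φ ψ : P ⟶ Q}
    (h : ∀ U s, pap φ U s = pap ψ U s) : φ = ψ := by
  ext U s
  exact h U.unop s

/-- A morphism of presheaves of modules from linear maps on sections. -/
def mkHom {P Q : PMod X.presheaf} (α : ∀ U : X.Opens, P.obj (op U) →ₗ[Γ(X, U)] Q.obj (op U))
    (nat : ∀ {U V : X.Opens} (h : V ≤ U) (s : P.obj (op U)),
      α V (rs P h s) = rs Q h (α U s)) : P ⟶ Q where
  app U := ModuleCat.ofHom (α U.unop)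
  naturality i := ConcreteCategory.hom_ext _ _ fun x => nat i.unop.le x

/-- The module of sections of a sheaf of modules. -/
abbrev Sec (M : X.Modules) (U : X.Opens) : Type u := (underlying M).obj (op U)

/-- The action of a morphism of sheaves of modules on sections. -/
def ap {M N : X.Modules} (φ : M ⟶ N) (U : X.Opens) : Sec M U →ₗ[Γ(X, U)] Sec N U :=
  pap ((Scheme.Modules.toPresheafOfModules X).map φ) U

theorem ap_rs {M N : X.Modules} (φ : M ⟶ N) {U V : X.Opens} (h : V ≤ U) (s : Sec M U) :
    ap φ V (rs (underlying M) h s) = rs (underlying N) h (ap φ U s) :=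
  pap_rs _ h s

theorem ap_comp {M N K : X.Modules} (φ : M ⟶ N) (ψ : N ⟶ K) (U : X.Opens) (s : Sec M U) :
    ap (φ ≫ ψ) U s = ap ψ U (ap φ U s) := rfl

theorem ap_id (M : X.Modules) (U : X.Opens) (s : Sec M U) : ap (𝟙 M) U s = s := rfl

theorem ap_zero {M N : X.Modules} (U : X.Opens) (s : Sec M U) : ap (0 : M ⟶ N) U s = 0 := rfl

theorem ap_add {M N : X.Modules} (φ ψ : M ⟶ N) (U : X.Opens) (s : Sec M U) :
    ap (φ + ψ) U s = ap φ U s + ap ψ U s := rfl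

theorem mod_hom_ext {M N : X.Modules} {φ ψ : M ⟶ N}
    (h : ∀ U s, ap φ U s = ap ψ U s) : φ = ψ :=
  (Scheme.Modules.toPresheafOfModules X).map_injective (pmod_hom_ext h)

/-- A morphism of sheaves of modules from a morphism of the underlying presheaves. -/
def liftHom {M N : X.Modules} (φ : underlying M ⟶ underlying N) : M ⟶ N :=
  Scheme.Modules.fullyFaithfulToPresheafOfModules.preimage φ

theorem fun_ext {U : X.Opens} {s t : Γ(X, U)}
    (h : ∀ x ∈ U, ∃ (V : X.Opens) (hV : V ≤ U), x ∈ V ∧ rr hV s = rr hV t) : s = t := by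
  choose V hV hx he using h
  exact X.sheaf.eq_of_locally_eq' (fun x : U => V x.1 x.2) U
    (fun x => homOfLE (hV x.1 x.2)) (fun x hxU => Opens.mem_iSup.2 ⟨⟨x, hxU⟩, hx x hxU⟩) s t
    (fun x => he x.1 x.2)

/-- The sheaf of abelian groups underlying a sheaf of modules. -/
abbrev abSheaf (M : X.Modules) : TopCat.Sheaf Ab X := ⟨M.presheaf, M.isSheaf⟩

theorem sec_ext (M : X.Modules) {U : X.Opens} {s t : Sec M U}
    (h : ∀ x ∈ U, ∃ (V : X.Opens) (hV : V ≤ U), x ∈ V ∧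
      rs (underlying M) hV s = rs (underlying M) hV t) : s = t := by
  choose V hV hx he using h
  exact (abSheaf M).eq_of_locally_eq' (fun x : U => V x.1 x.2) U
    (fun x => homOfLE (hV x.1 x.2)) (fun x hxU => Opens.mem_iSup.2 ⟨⟨x, hxU⟩, hx x hxU⟩) s t
    (fun x => he x.1 x.2)

theorem fun_glue {U : X.Opens} {ι : Type*} (V : ι → X.Opens) (hV : ∀ i, V i ≤ U)
    (hcov : U ≤ iSup V) (s : ∀ i, Γ(X, V i))
    (hs : ∀ i j, rr (inf_le_left : V i ⊓ V j ≤ V i) (s i) = rr inf_le_right (s j)) :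
    ∃ t : Γ(X, U), ∀ i, rr (hV i) t = s i :=
  (X.sheaf.existsUnique_gluing' V U (fun i => homOfLE (hV i)) hcov s hs).exists

theorem sec_glue (M : X.Modules) {U : X.Opens} {ι : Type*} (V : ι → X.Opens)
    (hV : ∀ i, V i ≤ U) (hcov : U ≤ iSup V) (s : ∀ i, Sec M (V i))
    (hs : ∀ i j, rs (underlying M) (inf_le_left : V i ⊓ V j ≤ V i) (s i) =
      rs (underlying M) inf_le_right (s j)) :
    ∃ t : Sec M U, ∀ i, rs (underlying M) (hV i) t = s i := by
  let s' : ∀ i, ToType ((abSheaf M).obj.obj (op (V i))) := s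
  have hs' : TopCat.Presheaf.IsCompatible (abSheaf M).obj V s' := hs
  exact ((abSheaf M).existsUnique_gluing' V U (fun i => homOfLE (hV i)) hcov s' hs').exists

theorem sec_eq_of_le_bot (M : X.Modules) {U : X.Opens} (hU : U ≤ ⊥) (s t : Sec M U) : s = t :=
  sec_ext M fun _ hx => (hU hx).elim

end Sections

section Exactness

variable {X : Scheme.{u}} {M N K : X.Modules}

theorem mono_of_injective (φ : M ⟶ N) (h : ∀ U, Function.Injective (ap φ U)) : Mono φ :=
  ⟨fun f g e => mod_hom_ext fun U s => h U (by rw [← ap_comp, ← ap_comp, e])⟩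

theorem injective_of_mono (φ : M ⟶ N) [Mono φ] (U : X.Opens) : Function.Injective (ap φ U) := by
  have h1 : Mono ((Scheme.Modules.toPresheaf X).map φ) := inferInstance
  have h2 : Mono (((Scheme.Modules.toPresheaf X).map φ).app (op U)) :=
    (NatTrans.mono_iff_mono_app _).1 h1 (op U)
  exact (AddCommGrpCat.mono_iff_injective _).1 h2

/-- Only local surjectivity is needed, since sections of the target are determined locally. -/
theorem epi_of_locally_surjective (φ : M ⟶ N)
    (h : ∀ (U : X.Opens) (s : Sec N U), ∀ x ∈ U, ∃ (V : X.Opens) (hV : V ≤ U), x ∈ V ∧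
      ∃ t, ap φ V t = rs (underlying N) hV s) : Epi φ := by
  refine ⟨fun f g e => mod_hom_ext fun U s => sec_ext _ fun x hx => ?_⟩
  obtain ⟨V, hV, hxV, t, ht⟩ := h U s x hx
  refine ⟨V, hV, hxV, ?_⟩
  rw [← ap_rs, ← ap_rs, ← ht, ← ap_comp, ← ap_comp, e]

/-- Exactness at `N`: the morphism from `M` to the kernel of `g` is locally surjective. -/
theorem exact_of_locally_exact (f : M ⟶ N) (g : N ⟶ K) (w : f ≫ g = 0)
    (h : ∀ (U : X.Opens) (s : Sec N U), ap g U s = 0 → ∀ x ∈ U,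
      ∃ (V : X.Opens) (hV : V ≤ U), x ∈ V ∧ ∃ t, ap f V t = rs (underlying N) hV s) :
    (ShortComplex.mk f g w).Exact := by
  rw [ShortComplex.exact_iff_epi_kernel_lift]
  refine epi_of_locally_surjective _ fun U s x hx => ?_
  have hs : ap g U (ap (Limits.kernel.ι g) U s) = 0 := by
    rw [← ap_comp, Limits.kernel.condition, ap_zero]
  obtain ⟨V, hV, hxV, t, ht⟩ := h U _ hs x hx
  refine ⟨V, hV, hxV, t, injective_of_mono (Limits.kernel.ι g) V ?_⟩
  rw [← ap_comp, Limits.kernel.lift_ι, ap_rs]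
  exact ht

end Exactness

/-! ### Frames -/

section Frames

variable {X : Scheme.{u}} {U : X.Opens} {ι : Type*} [Fintype ι]

/-- The sections `s` of a sheaf of modules over `U` form a frame if on every smaller open set
each section is a unique linear combination of them. -/
def IsFrame (M : X.Modules) (s : ι → Sec M U) : Prop :=
  ∀ (V : X.Opens) (h : V ≤ U),
    Function.Bijective fun c : ι → Γ(X, V) => ∑ j, c j • rs (underlying M) h (s j)

/-- The sections `s` of a presheaf of modules over `U` form a local basis if they are a basis of
the sections over arbitrarily small neighbourhoods of each point of `U`. -/
def IsLocalBasis (P : PMod X.presheaf) (s : ι → P.obj (op U)) : Prop :=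
  ∀ (V : X.Opens) (_ : V ≤ U), ∀ x ∈ V, ∃ (W : X.Opens) (h : W ≤ U), W ≤ V ∧ x ∈ W ∧
    Function.Bijective fun c : ι → Γ(X, W) => ∑ j, c j • rs P h (s j)

theorem IsFrame.restrict {M : X.Modules} {s : ι → Sec M U} (hs : IsFrame M s) {V : X.Opens}
    (h : V ≤ U) : IsFrame M (fun j => rs (underlying M) h (s j)) := fun W hW => by
  simpa only [rs_rs] using hs W (hW.trans h)

theorem isFrame_of_le_bot (M : X.Modules) (s : ι → Sec M U) (hU : U ≤ ⊥) : IsFrame M s :=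
  fun _ h => ⟨fun _ _ _ => funext fun _ => fun_ext fun _ hx => (hU (h hx)).elim,
    fun _ => ⟨0, sec_eq_of_le_bot M (h.trans hU) _ _⟩⟩

/-- A local basis of a presheaf stays a frame in the associated sheaf, or in any sheaf
that receives a locally bijective morphism. -/
theorem IsLocalBasis.isFrame {P : PMod X.presheaf} {s : ι → P.obj (op U)} (hs : IsLocalBasis P s)
    {M : X.Modules} (α : P ⟶ underlying M)
    (hinj : ∀ (V : X.Opens) (t : P.obj (op V)), pap α V t = 0 → ∀ x ∈ V,
      ∃ (W : X.Opens) (h : W ≤ V), x ∈ W ∧ rs P h t = 0)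
    (hsurj : ∀ (V : X.Opens) (t : Sec M V), ∀ x ∈ V,
      ∃ (W : X.Opens) (h : W ≤ V), x ∈ W ∧ ∃ r, pap α W r = rs (underlying M) h t) :
    IsFrame M (fun j => pap α U (s j)) := by
  have hsum : ∀ (V : X.Opens) (h : V ≤ U) (c : ι → Γ(X, V)),
      ∑ j, c j • rs (underlying M) h (pap α U (s j)) = pap α V (∑ j, c j • rs P h (s j)) := by
    intro V h c
    rw [map_sum]
    exact Finset.sum_congr rfl fun j _ => by rw [map_smul, pap_rs]
  have inj : ∀ (V : X.Opens) (h : V ≤ U),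
      Function.Injective fun c : ι → Γ(X, V) => ∑ j, c j • rs (underlying M) h (pap α U (s j)) := by
    intro V h c d hcd
    simp only [hsum] at hcd
    rw [← sub_eq_zero, ← map_sub] at hcd
    refine funext fun j => fun_ext fun x hx => ?_
    obtain ⟨W, hW, hxW, h0⟩ := hinj V _ hcd x hx
    obtain ⟨W', hW', hWW', hxW', hb⟩ := hs W (hW.trans h) x hxW
    refine ⟨W', hWW'.trans hW, hxW', ?_⟩
    have h1 := congrArg (rs P hWW') h0
    rw [rs_rs, map_zero, map_sub, rs_sum_smul, rs_sum_smul, sub_eq_zero] at h1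
    exact congrFun (hb.1 h1) j
  refine fun V h => ⟨inj V h, fun t => ?_⟩
  have loc : ∀ x : V, ∃ (W : X.Opens) (hW : W ≤ V), x.1 ∈ W ∧ ∃ c : ι → Γ(X, W),
      ∑ j, c j • rs (underlying M) (hW.trans h) (pap α U (s j)) = rs (underlying M) hW t := by
    rintro ⟨x, hx⟩
    obtain ⟨W, hW, hxW, r, hr⟩ := hsurj V t x hx
    obtain ⟨W', hW', hWW', hxW', hb⟩ := hs W (hW.trans h) x hxW
    obtain ⟨c, hc⟩ := hb.2 (rs P hWW' r)
    refine ⟨W', hWW'.trans hW, hxW', c, ?_⟩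
    rw [hsum]
    refine (congrArg _ hc).trans ?_
    rw [pap_rs, hr, rs_rs]
  choose W hW hxW c hc using loc
  have hcov : V ≤ iSup W := fun x hx => Opens.mem_iSup.2 ⟨⟨x, hx⟩, hxW ⟨x, hx⟩⟩
  have glue : ∀ j, ∃ d : Γ(X, V), ∀ x, rr (hW x) d = c x j := fun j =>
    fun_glue W hW hcov (fun x => c x j) fun x y => by
      refine congrFun (inj (W x ⊓ W y) (inf_le_left.trans ((hW x).trans h))
        (a₁ := fun j => rr inf_le_left (c x j)) (a₂ := fun j => rr inf_le_right (c y j)) ?_) j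
      have e1 := congrArg (rs (underlying M) (inf_le_left : W x ⊓ W y ≤ W x)) (hc x)
      have e2 := congrArg (rs (underlying M) (inf_le_right : W x ⊓ W y ≤ W y)) (hc y)
      rw [rs_sum_smul, rs_rs] at e1 e2
      exact e1.trans e2.symm
  choose d hd using glue
  refine ⟨d, sec_ext M fun x hx => ⟨W ⟨x, hx⟩, hW _, hxW _, ?_⟩⟩
  rw [← hc ⟨x, hx⟩]
  simp only [rs_sum_smul, hd]

theorem toAssocSheaf_locally_injective (P : PMod X.presheaf) (V : X.Opens) (t : P.obj (op V))
    (h : pap (toAssocSheaf P) V t = 0) (x : X) (hx : x ∈ V) :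
    ∃ (W : X.Opens) (h : W ≤ V), x ∈ W ∧ rs P h t = 0 := by
  have key : Presheaf.IsLocallyInjective (Opens.grothendieckTopology X)
      (CategoryTheory.toSheafify (Opens.grothendieckTopology X) P.presheaf) := inferInstance
  have h' := key.equalizerSieve_mem (X := op V) t 0 (h.trans (map_zero _).symm)
  obtain ⟨W, i, hi, hxW⟩ := h' x hx
  exact ⟨W, i.le, hxW, hi.trans (map_zero (P.presheaf.map i.op).hom)⟩

theorem toAssocSheaf_locally_surjective (P : PMod X.presheaf) (V : X.Opens)
    (t : Sec (assocSheaf P) V) (x : X) (hx : x ∈ V) :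
    ∃ (W : X.Opens) (h : W ≤ V), x ∈ W ∧ ∃ r, pap (toAssocSheaf P) W r =
      rs (underlying (assocSheaf P)) h t := by
  have key : Presheaf.IsLocallySurjective (Opens.grothendieckTopology X)
      (CategoryTheory.toSheafify (Opens.grothendieckTopology X) P.presheaf) := inferInstance
  have h' := key.imageSieve_mem (U := V) t
  obtain ⟨W, i, ⟨r, hr⟩, hxW⟩ := h' x hx
  exact ⟨W, i.le, hxW, r, hr⟩

theorem IsLocalBasis.assocSheaf {P : PMod X.presheaf} {s : ι → P.obj (op U)}
    (hs : IsLocalBasis P s) :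
    IsFrame (assocSheaf P) (fun j => pap (toAssocSheaf P) U (s j)) :=
  hs.isFrame (toAssocSheaf P) (toAssocSheaf_locally_injective P)
    (toAssocSheaf_locally_surjective P)

end Frames

section FrameChange

variable {X : Scheme.{u}} {U : X.Opens} {ι ι' : Type*} [Fintype ι] [Fintype ι']

/-- A spanning family with as many members as a basis is a basis: a surjective endomorphism of a
finitely generated module over a commutative ring is injective. -/
theorem bijective_sum_smul_of_card_eq {R M : Type*} [CommRing R] [AddCommGroup M] [Module R M]
    {s : ι → M} {s' : ι' → M} (hs : Function.Bijective fun c : ι → R => ∑ j, c j • s j)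
    (hcard : Fintype.card ι = Fintype.card ι')
    (h : ∀ j, s j ∈ Submodule.span R (Set.range s')) :
    Function.Bijective fun c : ι' → R => ∑ j, c j • s' j := by
  let L : (ι → R) ≃ₗ[R] M := LinearEquiv.ofBijective (Fintype.linearCombination R s) hs
  let e : (ι → R) ≃ₗ[R] (ι' → R) := LinearEquiv.funCongrLeft R R (Fintype.equivOfCardEq hcard).symm
  have hsurj : Function.Surjective (Fintype.linearCombination R s') := by
    rw [← LinearMap.range_eq_top, Fintype.range_linearCombination, eq_top_iff]
    intro m _
    obtain ⟨c, rfl⟩ := hs.2 m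
    exact Submodule.sum_mem _ fun j _ => Submodule.smul_mem _ _ (h j)
  refine ⟨?_, hsurj⟩
  let g : (ι' → R) →ₗ[R] (ι' → R) := e.toLinearMap ∘ₗ L.symm.toLinearMap ∘ₗ
    Fintype.linearCombination R s'
  have hg : Function.Surjective g :=
    e.surjective.comp (L.symm.surjective.comp hsurj)
  have hg' : Function.Injective g := OrzechProperty.injective_of_surjective_endomorphism g hg
  exact fun c d hcd => hg' (congrArg (fun m => e (L.symm m)) hcd)

/-- A spanning family with as many members as a frame is a frame. -/
theorem IsFrame.of_span {M : X.Modules} {s : ι → Sec M U} {s' : ι' → Sec M U} (hs : IsFrame M s)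
    (hcard : Fintype.card ι = Fintype.card ι')
    (h : ∀ j, s j ∈ Submodule.span Γ(X, U) (Set.range s')) : IsFrame M s' := by
  refine fun V hV => bijective_sum_smul_of_card_eq (hs V hV) hcard fun j => ?_
  have key : ∀ m ∈ Submodule.span Γ(X, U) (Set.range s'), rs (underlying M) hV m ∈
      Submodule.span Γ(X, V) (Set.range fun j => rs (underlying M) hV (s' j)) := by
    intro m hm
    induction hm using Submodule.span_induction with
    | mem x hx =>
      obtain ⟨i, rfl⟩ := hx
      exact Submodule.subset_span ⟨i, rfl⟩
    | zero => rw [map_zero]; exact zero_mem _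
    | add x y _ _ hx hy => rw [map_add]; exact add_mem hx hy
    | smul a x _ hx => rw [rs_smul]; exact Submodule.smul_mem _ _ hx
  exact key _ (h j)

theorem IsFrame.comp_equiv {M : X.Modules} {s : ι → Sec M U} (hs : IsFrame M s) (e : ι' ≃ ι) :
    IsFrame M (s ∘ e) :=
  hs.of_span (Fintype.card_congr e.symm) fun j =>
    Submodule.subset_span ⟨e.symm j, congrArg s (e.apply_symm_apply j)⟩

end FrameChange

/-! ### Free modules and vector bundles -/

section Free

variable {X : Scheme.{u}}

/-- The structure sheaf, as a module. -/
def unitMod (X : Scheme.{u}) : X.Modules := SheafOfModules.unit X.ringCatSheaf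

/-- The sections of the structure sheaf, as a module. -/
def unitEquiv (X : Scheme.{u}) (U : X.Opens) : Γ(X, U) ≃ₗ[Γ(X, U)] Sec (unitMod X) U :=
  LinearEquiv.refl _ _

theorem rs_unitEquiv {U V : X.Opens} (h : V ≤ U) (c : Γ(X, U)) :
    rs (underlying (unitMod X)) h (unitEquiv X U c) = unitEquiv X V (rr h c) := rfl

theorem unitEquiv_eq_smul {U : X.Opens} (c : Γ(X, U)) :
    unitEquiv X U c = c • unitEquiv X U 1 := by
  rw [← map_smul, smul_eq_mul, mul_one]

/-- The morphism `O_X ⟶ N` given by a global section. -/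
def unitHom {N : X.Modules} (n : Sec N ⊤) : unitMod X ⟶ N :=
  liftHom (mkHom
    (fun U => LinearMap.toSpanSingleton Γ(X, U) (Sec N U) (rs (underlying N) le_top n) ∘ₗ
      (unitEquiv X U).symm.toLinearMap)
    (fun {U V} h s => by
      obtain ⟨c, rfl⟩ := (unitEquiv X U).surjective s
      simp only [rs_unitEquiv, LinearMap.comp_apply, LinearEquiv.coe_coe,
        LinearEquiv.symm_apply_apply, LinearMap.toSpanSingleton_apply, rs_smul, rs_rs]))

theorem ap_unitHom {N : X.Modules} (n : Sec N ⊤) (U : X.Opens) (c : Γ(X, U)) :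
    ap (unitHom n) U (unitEquiv X U c) = c • rs (underlying N) le_top n := rfl

theorem unit_hom_ext {N : X.Modules} {φ ψ : unitMod X ⟶ N}
    (h : ap φ ⊤ (unitEquiv X ⊤ 1) = ap ψ ⊤ (unitEquiv X ⊤ 1)) : φ = ψ := by
  refine mod_hom_ext fun U s => ?_
  obtain ⟨c, rfl⟩ := (unitEquiv X U).surjective s
  have e : unitEquiv X U 1 = rs (underlying (unitMod X)) le_top (unitEquiv X ⊤ 1) := by
    rw [rs_unitEquiv, map_one (rr _)]
  rw [unitEquiv_eq_smul, map_smul, map_smul, e, ap_rs, ap_rs, h]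

variable (r : ℕ)

/-- The inclusion of a summand of the free module. -/
def freeι (j : Fin r) : unitMod X ⟶ freeModule X r :=
  SheafOfModules.ιFree (R := X.ringCatSheaf) (ULift.up j)

variable {r}

/-- The morphism from the free module given by a family of global sections. -/
def freeDesc {N : X.Modules} (n : Fin r → Sec N ⊤) : freeModule X r ⟶ N :=
  Limits.Cofan.IsColimit.desc (SheafOfModules.isColimitFreeCofan (R := X.ringCatSheaf)
    (ULift.{u} (Fin r))) (fun j => unitHom (n j.down))

theorem freeι_desc {N : X.Modules} (n : Fin r → Sec N ⊤) (j : Fin r) :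
    freeι r j ≫ freeDesc n = unitHom (n j) :=
  Limits.Cofan.IsColimit.fac (SheafOfModules.isColimitFreeCofan (R := X.ringCatSheaf)
    (ULift.{u} (Fin r))) _ _

theorem free_hom_ext {N : X.Modules} {φ ψ : freeModule X r ⟶ N}
    (h : ∀ j, freeι r j ≫ φ = freeι r j ≫ ψ) : φ = ψ :=
  Limits.Cofan.IsColimit.hom_ext (SheafOfModules.isColimitFreeCofan (R := X.ringCatSheaf)
    (ULift.{u} (Fin r))) _ _ fun j => h j.down

/-- The standard global sections of the free module. -/
def freeSec (X : Scheme.{u}) {r : ℕ} (j : Fin r) : Sec (freeModule X r) ⊤ :=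
  ap (freeι r j) ⊤ (unitEquiv X ⊤ 1)

theorem ap_freeDesc {N : X.Modules} (n : Fin r → Sec N ⊤) (j : Fin r) :
    ap (freeDesc n) ⊤ (freeSec X j) = n j := by
  rw [freeSec, ← ap_comp, freeι_desc, ap_unitHom, one_smul, rs_self]

/-- The coordinates of the free module. -/
def freeCoord (j : Fin r) : freeModule X r ⟶ unitMod X :=
  freeDesc (fun l => unitEquiv X ⊤ (if l = j then 1 else 0))

theorem sum_freeCoord : ∑ j : Fin r, freeCoord j ≫ freeι r j = 𝟙 (freeModule X r) := by
  refine free_hom_ext fun l => ?_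
  rw [Preadditive.comp_sum, Category.comp_id]
  refine (Finset.sum_eq_single l (fun j _ hj => ?_) (by simp)).trans ?_
  · rw [← Category.assoc, freeCoord, freeι_desc, if_neg hj.symm]
    refine unit_hom_ext ?_
    rw [ap_comp, ap_unitHom, rs_self, ap_zero, map_zero, smul_zero, map_zero]
  · rw [← Category.assoc, freeCoord, freeι_desc, if_pos rfl]
    refine unit_hom_ext ?_
    rw [ap_comp, ap_unitHom, rs_self, one_smul]

theorem freeSec_isFrame : IsFrame (U := ⊤) (freeModule X r) (fun j => freeSec X j) := by
  intro V hV
  have h1 : ∀ j, rs (underlying (freeModule X r)) hV (freeSec X j) =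
      ap (freeι r j) V (unitEquiv X V 1) := fun j => by
    rw [freeSec, ← ap_rs, rs_unitEquiv, map_one (rr hV)]
  have h2 : ∀ j l, ap (freeCoord l) V (rs (underlying (freeModule X r)) hV (freeSec X j)) =
      unitEquiv X V (if j = l then 1 else 0) := fun j l => by
    rw [ap_rs, freeCoord, ap_freeDesc, rs_unitEquiv]
    split_ifs
    · rw [map_one (rr hV)]
    · rw [map_zero (rr hV)]
  constructor
  · intro c d hcd
    funext l
    have h3 : ∀ c : Fin r → Γ(X, V), ap (freeCoord l) V
        (∑ j, c j • rs (underlying (freeModule X r)) hV (freeSec X j)) =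
          unitEquiv X V (c l) := by
      intro c
      rw [map_sum, unitEquiv_eq_smul]
      refine (Finset.sum_eq_single l (fun j _ hj => ?_)
        (fun h => (h (Finset.mem_univ _)).elim)).trans ?_
      · rw [map_smul, h2, if_neg hj, map_zero, smul_zero]
      · rw [map_smul, h2, if_pos rfl]
    exact (unitEquiv X V).injective
      ((h3 c).symm.trans ((congrArg (ap (freeCoord l) V) hcd).trans (h3 d)))
  · intro t
    refine ⟨fun j => (unitEquiv X V).symm (ap (freeCoord j) V t), ?_⟩
    have h4 : ∀ φ : Fin r → (freeModule X r ⟶ freeModule X r),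
        ap (∑ j, φ j) V t = ∑ j, ap (φ j) V t := by
      intro φ
      induction (Finset.univ : Finset (Fin r)) using Finset.induction_on with
      | empty => rfl
      | insert a s ha ih => rw [Finset.sum_insert ha, Finset.sum_insert ha, ap_add, ih]
    have h5 := h4 fun j => freeCoord j ≫ freeι r j
    rw [sum_freeCoord, ap_id] at h5
    refine Eq.trans ?_ h5.symm
    refine Finset.sum_congr rfl fun j _ => ?_
    rw [h1, ap_comp, ← map_smul, ← unitEquiv_eq_smul, LinearEquiv.apply_symm_apply]

theorem isIso_of_isFrame {M N : X.Modules} {ι : Type*} [Fintype ι] {s : ι → Sec M ⊤}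
    (hs : IsFrame M s) (φ : M ⟶ N) (h : IsFrame N (fun j => ap φ ⊤ (s j))) : IsIso φ := by
  have key : ∀ V, Function.Bijective (ap φ V) := by
    intro V
    have h1 := hs V le_top
    have h2 := h V le_top
    have h3 : (fun c : ι → Γ(X, V) => ∑ j, c j • rs (underlying N) le_top (ap φ ⊤ (s j))) =
        ap φ V ∘ fun c : ι → Γ(X, V) => ∑ j, c j • rs (underlying M) le_top (s j) := by
      funext c
      simp only [Function.comp, map_sum, map_smul, ap_rs]
    rw [h3] at h2
    exact (Function.Bijective.of_comp_iff _ h1).1 h2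
  have : Mono φ := mono_of_injective φ fun V => (key V).1
  have : Epi φ := epi_of_locally_surjective φ fun U s x hx =>
    ⟨U, le_rfl, hx, (key U).2 _⟩
  exact isIso_of_mono_of_epi φ

/-- A sheaf of modules with a frame on each open set of a cover is a vector bundle. -/
theorem isVectorBundle_of_isFrame {M : X.Modules} (h : ∀ x : X, ∃ U : X.Opens, x ∈ U ∧
    ∃ (ι : Type) (_ : Fintype ι) (s : ι → Sec M U), IsFrame M s) : IsVectorBundle M := by
  intro x
  obtain ⟨U, hx, ι, _, s, hs⟩ := h x
  refine ⟨U, hx, Fintype.card ι, ⟨?_⟩⟩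
  let N := M.restrict U.ι
  have hle : U.ι ''ᵁ ⊤ ≤ U := by simp
  let s' : Fin (Fintype.card ι) → Sec N ⊤ := fun j =>
    (rs (underlying M) hle (s ((Fintype.equivFin ι).symm j)) :)
  have hs' : IsFrame N s' := by
    intro V hV
    have h1 := (hs.comp_equiv (Fintype.equivFin ι).symm) (U.ι ''ᵁ V)
      ((Scheme.Hom.image_mono U.ι hV).trans hle)
    let e : Γ(U.toScheme, V) ≃+* Γ(X, U.ι ''ᵁ V) := (U.ι.appIso V).symm.commRingCatIsoToRingEquiv
    have h2 := h1.comp ((Equiv.arrowCongr (Equiv.refl (Fin (Fintype.card ι))) e.toEquiv).bijective)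
    have h3 : ∀ j, rs (underlying M) (Scheme.Hom.image_mono U.ι hV) (s' j) =
      rs (underlying M) ((Scheme.Hom.image_mono U.ι hV).trans hle)
        (s ((Fintype.equivFin ι).symm j)) := fun j => rs_rs _ _ _ _
    have h4 : ∀ c : Fin (Fintype.card ι) → Γ(U.toScheme, V),
        (∑ j, c j • rs (underlying N) hV (s' j) : Sec N V) =
        (∑ j, e (c j) • rs (underlying M) ((Scheme.Hom.image_mono U.ι hV).trans hle)
          (s ((Fintype.equivFin ι).symm j)) : Sec M (U.ι ''ᵁ V)) := fun c =>
      Finset.sum_congr (M := Sec M (U.ι ''ᵁ V)) rfl fun j _ =>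
        congrArg (fun m => e (c j) • m) (h3 j)
    exact (congrArg Function.Bijective (funext h4)).mpr h2
  have hiso : IsIso (freeDesc s') := isIso_of_isFrame freeSec_isFrame (freeDesc s') (by
    simpa only [ap_freeDesc] using hs')
  exact (asIso (freeDesc s')).symm

end Free

/-! ### Direct images along closed immersions -/

section Push

variable {X H : Scheme.{u}} (i : H ⟶ X)

/-- Sections of the direct image. -/
def pushEquiv (N : H.Modules) (U : X.Opens) :
    Sec N (i ⁻¹ᵁ U) ≃+ Sec ((Scheme.Modules.pushforward i).obj N) U :=
  AddEquiv.refl _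

theorem smul_pushEquiv (N : H.Modules) (U : X.Opens) (c : Γ(X, U)) (s : Sec N (i ⁻¹ᵁ U)) :
    c • pushEquiv i N U s = pushEquiv i N U ((i.app U).hom c • s) := rfl

theorem preimage_mono {U V : X.Opens} (h : V ≤ U) : i ⁻¹ᵁ V ≤ i ⁻¹ᵁ U :=
  fun _ hx => h hx

theorem app_rr {U V : X.Opens} (h : V ≤ U) (c : Γ(X, U)) :
    (i.app V).hom (rr h c) = rr (preimage_mono i h) ((i.app U).hom c) :=
  congr($(i.naturality (homOfLE h).op) c)

/-- The action of a morphism into a direct image on sections, as a semilinear map. -/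
def apush {F : X.Modules} {N : H.Modules} (φ : F ⟶ (Scheme.Modules.pushforward i).obj N)
    (U : X.Opens) : Sec F U →ₛₗ[(i.app U).hom] Sec N (i ⁻¹ᵁ U) where
  toFun s := (pushEquiv i N U).symm (ap φ U s)
  map_add' s t := by rw [map_add, map_add]
  map_smul' c s := by
    obtain ⟨t, ht⟩ := (pushEquiv i N U).surjective (ap φ U s)
    rw [map_smul, ← ht, smul_pushEquiv, AddEquiv.symm_apply_apply, AddEquiv.symm_apply_apply]

theorem apush_rs {F : X.Modules} {N : H.Modules} (φ : F ⟶ (Scheme.Modules.pushforward i).obj N)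
    {U V : X.Opens} (h : V ≤ U) (s : Sec F U) :
    apush i φ V (rs (underlying F) h s) =
      rs (underlying N) (preimage_mono i h) (apush i φ U s) :=
  ap_rs φ h s

theorem apush_comp {F : X.Modules} {M N : H.Modules}
    (φ : F ⟶ (Scheme.Modules.pushforward i).obj M) (ψ : M ⟶ N) (U : X.Opens) (s : Sec F U) :
    apush i (φ ≫ (Scheme.Modules.pushforward i).map ψ) U s =
      ap ψ (i ⁻¹ᵁ U) (apush i φ U s) := rfl

theorem apush_precomp {E F : X.Modules} {N : H.Modules} (χ : E ⟶ F)
    (φ : F ⟶ (Scheme.Modules.pushforward i).obj N) (U : X.Opens) (s : Sec E U) :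
    apush i (χ ≫ φ) U s = apush i φ U (ap χ U s) := rfl

theorem rs_bijective (P : PMod X.presheaf) {U V : X.Opens} (h : V ≤ U) (h' : U ≤ V) :
    Function.Bijective (rs P h) :=
  ⟨Function.LeftInverse.injective (g := rs P h') fun s => by rw [rs_rs, rs_self],
    Function.RightInverse.surjective (g := rs P h') fun s => by rw [rs_rs, rs_self]⟩

/-- The two properties of a closed immersion `i : H ⟶ X` on which the direct image depends: every
open set of `H` comes from `X`, and `O_X ⟶ i_* O_H` is an epimorphism. -/
structure SurjectiveOnFunctions : Prop where
  exists_preimage : ∀ W : H.Opens, ∃ U : X.Opens, i ⁻¹ᵁ U = W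
  exists_app : ∀ (U : X.Opens) (r : Γ(H, i ⁻¹ᵁ U)), ∀ x ∈ U, ∃ (V : X.Opens) (h : V ≤ U),
    x ∈ V ∧ ∃ r' : Γ(X, V), (i.app V).hom r' = rr (preimage_mono i h) r

variable {i} (hi : SurjectiveOnFunctions i)
include hi

/-- The direct image is faithful. -/
theorem SurjectiveOnFunctions.pushforward_map_injective {M N : H.Modules} {φ ψ : M ⟶ N}
    (h : (Scheme.Modules.pushforward i).map φ = (Scheme.Modules.pushforward i).map ψ) :
    φ = ψ := by
  refine mod_hom_ext fun W s => ?_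
  obtain ⟨U, rfl⟩ := hi.exists_preimage W
  exact congrArg (fun χ => ap χ U (pushEquiv i M U s)) h

/-- The direct image is full. -/
theorem SurjectiveOnFunctions.exists_pushforward_map_eq {M N : H.Modules}
    (φ : (Scheme.Modules.pushforward i).obj M ⟶ (Scheme.Modules.pushforward i).obj N) :
    ∃ ψ : M ⟶ N, (Scheme.Modules.pushforward i).map ψ = φ := by
  let β : ∀ U : X.Opens, Sec M (i ⁻¹ᵁ U) →+ Sec N (i ⁻¹ᵁ U) := fun U =>
    (apush i φ U).toAddMonoidHom.comp (pushEquiv i M U).toAddMonoidHom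
  have β_rs : ∀ {U V : X.Opens} (h : V ≤ U) (s), β V (rs (underlying M) (preimage_mono i h) s) =
      rs (underlying N) (preimage_mono i h) (β U s) := fun {U V} h s => ap_rs φ h _
  have β_smul : ∀ (U : X.Opens) (c : Γ(X, U)) s, β U ((i.app U).hom c • s) =
      (i.app U).hom c • β U s := fun U c s => by
    change apush i φ U (pushEquiv i M U _) = _
    rw [← smul_pushEquiv, map_smulₛₗ]
    rfl
  -- Every open set `W` of `H` is the inverse image of a chosen open set `o W` of `X`; the value on
  -- sections over `W` is that of `φ` over `o W`.
  choose o ho using hi.exists_preimage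
  let α : ∀ W : H.Opens, Sec M W → Sec N W := fun W s =>
    rs (underlying N) (ho W).ge (β (o W) (rs (underlying M) (ho W).le s))
  -- Independence of the choice: any `U` with inverse image in `W` can be used to compute `α W`.
  have α_β : ∀ (W : H.Opens) (s) (U : X.Opens) (h : i ⁻¹ᵁ U ≤ W),
      rs (underlying N) h (α W s) = β U (rs (underlying M) h s) := by
    intro W s U h
    have hle : i ⁻¹ᵁ U ≤ i ⁻¹ᵁ (U ⊓ o W) := fun x hx => ⟨hx, (ho W).ge (h hx)⟩
    refine (rs_bijective (underlying N)
      (preimage_mono i (inf_le_left : U ⊓ o W ≤ U)) hle).1 ?_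
    rw [← β_rs (inf_le_left : U ⊓ o W ≤ U), rs_rs, rs_rs, rs_rs,
      ← rs_rs (underlying M) (ho W).le (preimage_mono i (inf_le_right : U ⊓ o W ≤ o W)),
      β_rs inf_le_right]
  let α' : ∀ W : H.Opens, Sec M W →ₗ[Γ(H, W)] Sec N W := fun W =>
    { toFun := α W
      map_add' := fun s t => by simp only [α, map_add]
      map_smul' := fun c s => by
        obtain ⟨U, rfl⟩ := hi.exists_preimage W
        refine sec_ext N fun y hy => ?_
        -- `φ` is only linear over functions on `X`, so `c` is lifted around each point.
        obtain ⟨V, hV, hyV, c', hc'⟩ := hi.exists_app U c (i.base y) hy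
        refine ⟨i ⁻¹ᵁ V, preimage_mono i hV, hyV, ?_⟩
        rw [α_β, rs_smul, RingHom.id_apply, rs_smul, α_β, ← hc', β_smul] }
  refine ⟨liftHom (mkHom α' fun {W W'} h s => ?_), ?_⟩
  · obtain ⟨U, rfl⟩ := hi.exists_preimage W'
    refine (rs_self (underlying N) le_rfl _).symm.trans ((α_β _ _ U le_rfl).trans ?_)
    rw [rs_rs]
    exact (α_β W s U h).symm
  · refine mod_hom_ext fun U s => ?_
    obtain ⟨s, rfl⟩ := (pushEquiv i M U).surjective s
    have h := α_β (i ⁻¹ᵁ U) s U le_rfl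
    rw [rs_self, rs_self] at h
    exact h

end Push

/-! ### Frames of inverse images -/

section Extension

variable {X : Scheme.{u}} {U : X.Opens} {ι : Type*} [Fintype ι]

/-- A morphism into a sheaf whose sections are determined on `U` is determined by its values on a
frame over `U`. -/
theorem IsFrame.hom_ext {F K : X.Modules} {s : ι → Sec F U} (hs : IsFrame F s)
    (hK : ∀ V : X.Opens, Function.Injective (rs (underlying K) (inf_le_left : V ⊓ U ≤ V)))
    {φ ψ : F ⟶ K} (h : ∀ j, ap φ U (s j) = ap ψ U (s j)) : φ = ψ := by
  refine mod_hom_ext fun V t => hK V ?_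
  rw [← ap_rs, ← ap_rs]
  obtain ⟨c, hc⟩ := (hs (V ⊓ U) inf_le_right).2 (rs (underlying F) inf_le_left t)
  rw [← hc]
  simp only [map_sum, map_smul, ap_rs, h]

/-- A morphism into a sheaf that is extended from `U` can be prescribed on a frame over `U`. -/
theorem IsFrame.exists_hom {F K : X.Modules} {s : ι → Sec F U} (hs : IsFrame F s)
    (hK : ∀ V : X.Opens, Function.Bijective (rs (underlying K) (inf_le_left : V ⊓ U ≤ V)))
    (k : ι → Sec K U) : ∃ φ : F ⟶ K, ∀ j, ap φ U (s j) = k j := by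
  -- The coordinates `c` of `t` on `V ⊓ U` prescribe the value `v` of `t` there, and hence on `V`.
  have h1 : ∀ (V : X.Opens) (t : Sec F V), ∃ c : ι → Γ(X, V ⊓ U),
      ∑ j, c j • rs (underlying F) inf_le_right (s j) = rs (underlying F) inf_le_left t :=
    fun V t => (hs (V ⊓ U) inf_le_right).2 _
  choose c hc using h1
  have h2 : ∀ (V : X.Opens) (t : Sec F V), ∃ v : Sec K V, rs (underlying K) inf_le_left v =
      ∑ j, c V t j • rs (underlying K) inf_le_right (k j) := fun V t => (hK V).2 _
  choose v hv using h2
  have uniq : ∀ (V : X.Opens) (t : Sec F V) (d : ι → Γ(X, V ⊓ U)),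
      ∑ j, d j • rs (underlying F) inf_le_right (s j) = rs (underlying F) inf_le_left t →
      rs (underlying K) inf_le_left (v V t) =
        ∑ j, d j • rs (underlying K) inf_le_right (k j) := by
    intro V t d hd
    have : c V t = d := (hs (V ⊓ U) inf_le_right).1 ((hc V t).trans hd.symm)
    rw [hv, this]
  let α : ∀ V : X.Opens, Sec F V →ₗ[Γ(X, V)] Sec K V := fun V =>
    { toFun := v V
      map_add' := fun t t' => (hK V).1 (by
        rw [uniq V (t + t') (c V t + c V t') (by
          simp only [Pi.add_apply, add_smul, Finset.sum_add_distrib, hc, map_add]), map_add,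
          hv, hv]
        simp only [Pi.add_apply, add_smul, Finset.sum_add_distrib])
      map_smul' := fun a t => (hK V).1 (by
        rw [uniq V (a • t) (fun j => rr inf_le_left a * c V t j) (by
          simp only [mul_smul, ← Finset.smul_sum, hc, rs_smul]),
          RingHom.id_apply, rs_smul, hv]
        simp only [mul_smul, ← Finset.smul_sum]) }
  refine ⟨liftHom (mkHom α fun {V W} h t => (hK W).1 ?_), fun j => ?_⟩
  · have hVW : W ⊓ U ≤ V ⊓ U := inf_le_inf_right U h
    refine (uniq W (rs (underlying F) h t) (fun j => rr hVW (c V t j)) ?_).trans ?_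
    · rw [rs_rs, ← rs_rs (underlying F) (inf_le_left : V ⊓ U ≤ V) hVW, ← hc, rs_sum_smul]
    · rw [rs_rs, ← rs_rs (underlying K) (inf_le_left : V ⊓ U ≤ V) hVW]
      refine Eq.trans ?_ (congrArg (rs (underlying K) hVW) (hv V t)).symm
      rw [rs_sum_smul]
  · classical
    refine (hK U).1 ?_
    refine (uniq U (s j) (Pi.single j 1) ?_).trans ?_ <;>
    · rw [Finset.sum_eq_single j (fun l _ hl => by rw [Pi.single_eq_of_ne hl, zero_smul])
        (fun h => (h (Finset.mem_univ _)).elim), Pi.single_eq_same, one_smul]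

end Extension

section Extend

variable {X : Scheme.{u}} (U : X.Opens)

/-- The sheaf `V ↦ L (V ∩ U)`, the direct image of the restriction of `L` to `U`. -/
def extend (L : X.Modules) : X.Modules :=
  (Scheme.Modules.pushforward U.ι).obj (L.restrict U.ι)

/-- The open set `V ∩ U`, in the form in which it occurs in the direct image of the restriction
to `U`. -/
abbrev cut (V : X.Opens) : X.Opens := U.ι ''ᵁ (U.ι ⁻¹ᵁ V)

theorem cut_eq (V : X.Opens) : cut U V = V ⊓ U := by
  rw [cut, Scheme.Hom.image_preimage_eq_opensRange_inf, Scheme.Opens.opensRange_ι, inf_comm]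

theorem cut_le (V : X.Opens) : cut U V ≤ V := (cut_eq U V).le.trans inf_le_left

theorem cut_le' (V : X.Opens) : cut U V ≤ U := (cut_eq U V).le.trans inf_le_right

theorem cut_mono {V W : X.Opens} (h : W ≤ V) : cut U W ≤ cut U V := by
  rw [cut_eq, cut_eq]; exact inf_le_inf_right U h

/-- The sections of `extend U L`. -/
def extendEquiv (L : X.Modules) (V : X.Opens) : Sec L (cut U V) ≃+ Sec (extend U L) V :=
  AddEquiv.refl _

theorem rs_extendEquiv (L : X.Modules) {V W : X.Opens} (h : W ≤ V) (s : Sec L (cut U V)) :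
    rs (underlying (extend U L)) h (extendEquiv U L V s) =
      extendEquiv U L W (rs (underlying L) (cut_mono U h) s) := rfl

theorem smul_extendEquiv (L : X.Modules) (V : X.Opens) (c : Γ(X, V)) (s : Sec L (cut U V)) :
    c • extendEquiv U L V s = extendEquiv U L V (rr (cut_le U V) c • s) := by
  have h : (U.ι.appIso (U.ι ⁻¹ᵁ V)).inv.hom ((U.ι.app V).hom c) = rr (cut_le U V) c := by
    change (U.ι.app V ≫ (U.ι.appIso _).inv) c = _
    rw [Scheme.Hom.app_appIso_inv]
    rfl
  rw [← h]
  rfl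

theorem rs_extend_bijective (L : X.Modules) {V W : X.Opens} (h : W ≤ V) (h' : V ⊓ U ≤ W) :
    Function.Bijective (rs (underlying (extend U L)) h) := by
  have := rs_bijective (underlying L) (cut_mono U h) (by
    rw [cut_eq, cut_eq]; exact le_inf h' inf_le_right)
  exact ((extendEquiv U L W).bijective.comp this).comp (extendEquiv U L V).symm.bijective

end Extend

section Pullback

variable {X H : Scheme.{u}} (i : H ⟶ X) {U : X.Opens} {ι : Type*} [Fintype ι]

theorem apush_homEquiv {F : X.Modules} {K : H.Modules}
    (φ : (Scheme.Modules.pullback i).obj F ⟶ K) :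
    toRestriction i F ≫ (Scheme.Modules.pushforward i).map φ =
      (Scheme.Modules.pullbackPushforwardAdjunction i).homEquiv F K φ :=
  ((Scheme.Modules.pullbackPushforwardAdjunction i).homEquiv_unit _ _ _).symm

theorem toRestriction_restrictionHom {F : X.Modules} {K : H.Modules}
    (ψ : F ⟶ (Scheme.Modules.pushforward i).obj K) :
    toRestriction i F ≫ (Scheme.Modules.pushforward i).map (restrictionHom i ψ) = ψ := by
  rw [apush_homEquiv, restrictionHom, Equiv.apply_symm_apply]

theorem rs_push_extend_bijective (L : H.Modules) (V : X.Opens) :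
    Function.Bijective (rs (underlying ((Scheme.Modules.pushforward i).obj
      (extend (i ⁻¹ᵁ U) L))) (inf_le_left : V ⊓ U ≤ V)) :=
  ((pushEquiv i _ (V ⊓ U)).bijective.comp (rs_extend_bijective (i ⁻¹ᵁ U) L
    (preimage_mono i (inf_le_left : V ⊓ U ≤ V)) le_rfl)).comp (pushEquiv i _ V).symm.bijective

/-- A frame of `F` over `U` gives a frame of `i^* F` over the inverse image of `U`: both represent
the functor of families of sections, on sheaves that are extended from the inverse image of `U`. -/
theorem IsFrame.pullback {F : X.Modules} {s : ι → Sec F U} (hs : IsFrame F s) :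
    IsFrame ((Scheme.Modules.pullback i).obj F)
      (fun j => apush i (toRestriction i F) U (s j)) := by
  classical
  let G := (Scheme.Modules.pullback i).obj F
  let g : ι → Sec G (i ⁻¹ᵁ U) := fun j => apush i (toRestriction i F) U (s j)
  change IsFrame G g
  -- The universal property of the family `g`, obtained from that of `s` by adjunction.
  have ext : ∀ (L : H.Modules) (φ ψ : G ⟶ extend (i ⁻¹ᵁ U) L),
      (∀ j, ap φ _ (g j) = ap ψ _ (g j)) → φ = ψ := by
    intro L φ ψ h
    refine ((Scheme.Modules.pullbackPushforwardAdjunction i).homEquiv F _).injective ?_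
    rw [← apush_homEquiv, ← apush_homEquiv]
    refine hs.hom_ext (fun V => (rs_push_extend_bijective i L V).1) fun j => ?_
    exact h j
  have ex : ∀ (L : H.Modules) (k : ι → Sec (extend (i ⁻¹ᵁ U) L) (i ⁻¹ᵁ U)),
      ∃ φ : G ⟶ extend (i ⁻¹ᵁ U) L, ∀ j, ap φ _ (g j) = k j := by
    intro L k
    obtain ⟨φ, hφ⟩ := hs.exists_hom (rs_push_extend_bijective i L)
      (fun j => pushEquiv i _ U (k j))
    refine ⟨restrictionHom i φ, fun j => ?_⟩
    have e := apush_comp i (toRestriction i F) (restrictionHom i φ) U (s j)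
    rw [toRestriction_restrictionHom] at e
    exact e.symm.trans ((pushEquiv i _ U).symm_apply_eq.2 (hφ j))
  -- The coordinate functions on `G` with respect to `g`.
  choose ρ hρ using fun l => ex (unitMod H) (fun j => extendEquiv _ _ _
    (unitEquiv H _ (if j = l then 1 else 0)))
  let κ : ∀ (l : ι) (V : H.Opens), Sec G V → Γ(H, cut (i ⁻¹ᵁ U) V) := fun l V t =>
    (unitEquiv H _).symm ((extendEquiv _ _ _).symm (ap (ρ l) V t))
  have κ_add : ∀ l V t t', κ l V (t + t') = κ l V t + κ l V t' := fun l V t t' => by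
    simp only [κ, map_add]
  have κ_smul : ∀ l V (c : Γ(H, V)) t, κ l V (c • t) = rr (cut_le _ V) c * κ l V t :=
    fun l V c t => by
      obtain ⟨x, hx⟩ := (extendEquiv _ _ _).surjective (ap (ρ l) V t)
      obtain ⟨y, rfl⟩ := (unitEquiv H _).surjective x
      simp only [κ]
      rw [map_smul, ← hx, smul_extendEquiv, ← map_smul]
      simp only [AddEquiv.symm_apply_apply, LinearEquiv.symm_apply_apply, smul_eq_mul]
  have κ_rs : ∀ l {V W : H.Opens} (h : W ≤ V) t, κ l W (rs (underlying G) h t) =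
      rr (cut_mono _ h) (κ l V t) := fun l V W h t => by
    obtain ⟨x, hx⟩ := (extendEquiv _ _ _).surjective (ap (ρ l) V t)
    obtain ⟨y, rfl⟩ := (unitEquiv H _).surjective x
    simp only [κ]
    rw [ap_rs, ← hx, rs_extendEquiv, rs_unitEquiv]
    simp only [AddEquiv.symm_apply_apply, LinearEquiv.symm_apply_apply]
  have κ_g : ∀ l j, κ l _ (g j) = if j = l then 1 else 0 := fun l j => by
    simp only [κ, hρ, AddEquiv.symm_apply_apply, LinearEquiv.symm_apply_apply]
  have κ_g' : ∀ l j (V : H.Opens) (h : V ≤ i ⁻¹ᵁ U), κ l V (rs (underlying G) h (g j)) =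
      if j = l then 1 else 0 := fun l j V h => by
    rw [κ_rs, κ_g, apply_ite (rr _), map_one, map_zero]
  have κ_sum : ∀ l (V : H.Opens) (h : V ≤ i ⁻¹ᵁ U) (c : ι → Γ(H, V)),
      κ l V (∑ j, c j • rs (underlying G) h (g j)) = rr (cut_le _ V) (c l) := by
    intro l V h c
    have := map_sum (AddMonoidHom.mk' (κ l V) (κ_add l V))
      (fun j => c j • rs (underlying G) h (g j)) Finset.univ
    refine this.trans ((Finset.sum_eq_single l (fun j _ hj => ?_)
      (fun h => (h (Finset.mem_univ _)).elim)).trans ?_)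
    · simp only [AddMonoidHom.mk'_apply, κ_smul, κ_g', if_neg hj, mul_zero]
    · simp only [AddMonoidHom.mk'_apply, κ_smul, κ_g', if_true, mul_one]
  -- Recovering a section of `G` from its coordinates.
  let χ : G ⟶ extend (i ⁻¹ᵁ U) G := liftHom (mkHom (fun V =>
    { toFun := fun t => extendEquiv _ _ _
        (∑ l, κ l V t • rs (underlying G) (cut_le' _ V) (g l))
      map_add' := fun t t' => by
        simp only [κ_add, add_smul, Finset.sum_add_distrib, map_add]
      map_smul' := fun c t => by
        simp only [κ_smul, mul_smul, ← Finset.smul_sum, RingHom.id_apply, smul_extendEquiv] })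
    (fun {V W} h t => by
      change extendEquiv _ _ _ (∑ l, κ l W (rs (underlying G) h t) • _) =
        rs (underlying (extend _ G)) h (extendEquiv _ _ _ _)
      rw [rs_extendEquiv, rs_sum_smul]
      simp only [κ_rs]))
  -- Restriction of sections of `G` to `U`; it agrees with `χ` on `g`, hence everywhere.
  let η : G ⟶ extend (i ⁻¹ᵁ U) G := liftHom (mkHom (fun V =>
    { toFun := fun t => extendEquiv _ _ _ (rs (underlying G) (cut_le _ V) t)
      map_add' := fun t t' => by rw [map_add, map_add]
      map_smul' := fun c t => by rw [rs_smul, RingHom.id_apply, smul_extendEquiv] })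
    (fun {V W} h t => by
      change extendEquiv _ _ _ _ = rs (underlying (extend _ G)) h (extendEquiv _ _ _ _)
      rw [rs_extendEquiv, rs_rs, rs_rs]))
  have hχη : χ = η := ext G χ η fun j => by
    change extendEquiv _ _ _ (∑ l, κ l _ (g j) • _) = extendEquiv _ _ _ _
    congr 1
    refine (Finset.sum_eq_single j (fun l _ hl => ?_)
      (fun h => (h (Finset.mem_univ _)).elim)).trans ?_
    · rw [κ_g, if_neg (Ne.symm hl), zero_smul]
    · rw [κ_g, if_pos rfl, one_smul]
  intro V hV
  have hle : V ≤ cut (i ⁻¹ᵁ U) V := by rw [cut_eq]; exact le_inf le_rfl hV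
  constructor
  · intro c d hcd
    funext l
    have h1 := congrArg (κ l V) hcd
    simp only [κ_sum] at h1
    have h2 := congrArg (rr hle) h1
    rwa [rr_rr, rr_rr, rr_self, rr_self] at h2
  · intro t
    refine ⟨fun l => rr hle (κ l V t), ?_⟩
    have h1 : ∑ l, κ l V t • rs (underlying G) (cut_le' _ V) (g l) =
        rs (underlying G) (cut_le _ V) t :=
      (extendEquiv _ _ _).injective (congrArg (fun φ => ap φ V t) hχη)
    have h2 := congrArg (rs (underlying G) hle) h1
    rwa [rs_sum_smul, rs_rs, rs_self] at h2

end Pullback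

/-! ### Elementary transformations from adapted frames -/

section Adapted

variable {X H : Scheme.{u}} {i : H ⟶ X}

/-- Finitely many properties that hold on small neighbourhoods of a point hold on a common one. -/
theorem exists_common_open {U : X.Opens} {x : X} (hx : x ∈ U) {ι : Type*} [Fintype ι]
    (P : ι → ∀ V : X.Opens, V ≤ U → Prop)
    (mono : ∀ j (V W : X.Opens) (hV : V ≤ U) (h : W ≤ V), P j V hV → P j W (h.trans hV))
    (ex : ∀ j, ∃ (V : X.Opens) (hV : V ≤ U), x ∈ V ∧ P j V hV) :
    ∃ (V : X.Opens) (hV : V ≤ U), x ∈ V ∧ ∀ j, P j V hV := by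
  classical
  choose V hV hxV hP using ex
  suffices h : ∀ T : Finset ι, ∃ (W : X.Opens) (hW : W ≤ U), x ∈ W ∧ ∀ j ∈ T, P j W hW by
    obtain ⟨W, hW, hxW, h⟩ := h Finset.univ
    exact ⟨W, hW, hxW, fun j => h j (Finset.mem_univ j)⟩
  intro T
  induction T using Finset.induction_on with
  | empty => exact ⟨U, le_rfl, hx, fun j hj => (Finset.notMem_empty j hj).elim⟩
  | insert j T _ ih =>
    obtain ⟨W, hW, hxW, h⟩ := ih
    refine ⟨W ⊓ V j, inf_le_left.trans hW, ⟨hxW, hxV j⟩, fun l hl => ?_⟩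
    obtain rfl | hl := Finset.mem_insert.1 hl
    · exact mono l _ _ (hV l) inf_le_right (hP l)
    · exact mono l _ _ hW inf_le_left (h l hl)

theorem SurjectiveOnFunctions.exists_app_family (hi : SurjectiveOnFunctions i) {ι : Type*}
    [Fintype ι] {U : X.Opens} (r : ι → Γ(H, i ⁻¹ᵁ U)) {x : X} (hx : x ∈ U) :
    ∃ (V : X.Opens) (h : V ≤ U), x ∈ V ∧ ∃ r' : ι → Γ(X, V),
      ∀ j, (i.app V).hom (r' j) = rr (preimage_mono i h) (r j) := by
  obtain ⟨V, hV, hxV, h⟩ := exists_common_open hx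
    (fun j V hV => ∃ r' : Γ(X, V), (i.app V).hom r' = rr (preimage_mono i hV) (r j))
    (fun j V W hV h ⟨r', hr'⟩ => ⟨rr h r', by rw [app_rr, hr', rr_rr]⟩)
    (fun j => hi.exists_app U (r j) x hx)
  choose r' hr' using h
  exact ⟨V, hV, hxV, r', hr'⟩

theorem hom_ext_of_isFrame {M N : X.Modules} {φ ψ : M ⟶ N}
    (h : ∀ x : X, ∃ U : X.Opens, x ∈ U ∧ ∃ (ι : Type) (_ : Fintype ι) (s : ι → Sec M U),
      IsFrame M s ∧ ∀ j, ap φ U (s j) = ap ψ U (s j)) : φ = ψ := by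
  refine mod_hom_ext fun V t => sec_ext _ fun x hx => ?_
  obtain ⟨U, hxU, ι, _, s, hs, hφ⟩ := h x
  refine ⟨V ⊓ U, inf_le_left, ⟨hx, hxU⟩, ?_⟩
  obtain ⟨c, hc⟩ := (hs _ inf_le_right).2 (rs (underlying M) (inf_le_left : V ⊓ U ≤ V) t)
  rw [← ap_rs, ← ap_rs, ← hc]
  simp only [map_sum, map_smul, ap_rs, hφ]

section Sums

variable {U : X.Opens} {I J : Type*} [Fintype I] [Fintype J]

/-- The linear combinations of two families of sections. -/
def lin (M : X.Modules) (f : I → Sec M U) (f' : J → Sec M U) {V : X.Opens} (h : V ≤ U)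
    (c : I → Γ(X, V)) (c' : J → Γ(X, V)) : Sec M V :=
  ∑ j, c j • rs (underlying M) h (f j) + ∑ j, c' j • rs (underlying M) h (f' j)

theorem lin_eq {M : X.Modules} (f : I → Sec M U) (f' : J → Sec M U) {V : X.Opens} (h : V ≤ U)
    (c : I ⊕ J → Γ(X, V)) : ∑ j, c j • rs (underlying M) h (Sum.elim f f' j) =
      lin M f f' h (c ∘ Sum.inl) (c ∘ Sum.inr) := by
  rw [Fintype.sum_sum_type]
  rfl

theorem IsFrame.exists_lin {M : X.Modules} {f : I → Sec M U} {f' : J → Sec M U}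
    (hf : IsFrame M (Sum.elim f f')) {V : X.Opens} (h : V ≤ U) (s : Sec M V) :
    ∃ c c', lin M f f' h c c' = s := by
  obtain ⟨c, hc⟩ := (hf V h).2 s
  exact ⟨_, _, (lin_eq f f' h c).symm.trans hc⟩

theorem IsFrame.lin_eq_zero {M : X.Modules} {f : I → Sec M U} {f' : J → Sec M U}
    (hf : IsFrame M (Sum.elim f f')) {V : X.Opens} (h : V ≤ U) {c : I → Γ(X, V)}
    {c' : J → Γ(X, V)} (h0 : lin M f f' h c c' = 0) : c = 0 ∧ c' = 0 := by
  have h1 : (Sum.elim c c' : I ⊕ J → Γ(X, V)) = 0 := (hf V h).1 (by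
    refine (lin_eq f f' h _).trans (h0.trans ?_)
    simp only [Pi.zero_apply, zero_smul, Finset.sum_const_zero])
  exact ⟨funext fun j => congrFun h1 (Sum.inl j), funext fun j => congrFun h1 (Sum.inr j)⟩

theorem rs_lin {M : X.Modules} (f : I → Sec M U) (f' : J → Sec M U) {V W : X.Opens} (h : V ≤ U)
    (h' : W ≤ V) (c : I → Γ(X, V)) (c' : J → Γ(X, V)) :
    rs (underlying M) h' (lin M f f' h c c') =
      lin M f f' (h'.trans h) (fun j => rr h' (c j)) (fun j => rr h' (c' j)) := by
  rw [lin, map_add, rs_sum_smul, rs_sum_smul, lin]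

theorem ap_lin {M N : X.Modules} (φ : M ⟶ N) (f : I → Sec M U) (f' : J → Sec M U) {V : X.Opens}
    (h : V ≤ U) (c : I → Γ(X, V)) (c' : J → Γ(X, V)) :
    ap φ V (lin M f f' h c c') = lin N (fun j => ap φ U (f j)) (fun j => ap φ U (f' j)) h c c' := by
  simp only [lin, map_add, map_sum, map_smul, ap_rs]

theorem apush_lin {M : X.Modules} {N : H.Modules}
    (φ : M ⟶ (Scheme.Modules.pushforward i).obj N) (f : I → Sec M U) (f' : J → Sec M U)
    {V : X.Opens} (h : V ≤ U) (c : I → Γ(X, V)) (c' : J → Γ(X, V)) :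
    apush i φ V (lin M f f' h c c') =
      lin N (fun j => apush i φ U (f j)) (fun j => apush i φ U (f' j)) (preimage_mono i h)
        (fun j => (i.app V).hom (c j)) (fun j => (i.app V).hom (c' j)) := by
  simp only [lin, map_add, map_sum, map_smulₛₗ, apush_rs]

theorem lin_smul_left {M : X.Modules} (t : Γ(X, U)) (f : I → Sec M U) (f' : J → Sec M U)
    {V : X.Opens} (h : V ≤ U) (c : I → Γ(X, V)) (c' : J → Γ(X, V)) :
    lin M (fun j => t • f j) f' h c c' = lin M f f' h (fun j => rr h t * c j) c' := by
  simp only [lin, rs_smul, smul_smul, mul_comm]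

theorem lin_smul_right {M : X.Modules} (t : Γ(X, U)) (f : I → Sec M U) (f' : J → Sec M U)
    {V : X.Opens} (h : V ≤ U) (c : I → Γ(X, V)) (c' : J → Γ(X, V)) :
    lin M f (fun j => t • f' j) h c c' = lin M f f' h c (fun j => rr h t * c' j) := by
  simp only [lin, rs_smul, smul_smul, mul_comm]

theorem lin_zero_left {M : X.Modules} (f' : J → Sec M U)
    {V : X.Opens} (h : V ≤ U) (c : I → Γ(X, V)) (c' : J → Γ(X, V)) :
    lin M (fun _ => 0) f' h c c' = ∑ j, c' j • rs (underlying M) h (f' j) := by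
  simp only [lin, map_zero, smul_zero, Finset.sum_const_zero, zero_add]

theorem lin_zero_right {M : X.Modules} (f : I → Sec M U)
    {V : X.Opens} (h : V ≤ U) (c : I → Γ(X, V)) (c' : J → Γ(X, V)) :
    lin M f (fun _ => 0) h c c' = ∑ j, c j • rs (underlying M) h (f j) := by
  simp only [lin, map_zero, smul_zero, Finset.sum_const_zero, add_zero]

end Sums

theorem IsFrame.sum_eq_zero {M : X.Modules} {U : X.Opens} {ι : Type*} [Fintype ι]
    {s : ι → Sec M U} (hs : IsFrame M s) {V : X.Opens} (h : V ≤ U) {c : ι → Γ(X, V)}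
    (h0 : ∑ j, c j • rs (underlying M) h (s j) = 0) : c = 0 :=
  (hs V h).1 (h0.trans (by simp only [Pi.zero_apply, zero_smul, Finset.sum_const_zero]))

variable (i) in
/-- Frames of the five sheaves of an elementary transformation over an open set `U`, in which the
maps are diagonal. With `t` an equation of `H` in `U`, the frame of `F` consists of `f` and `f'`,
those of `F(-H)` and `E` consist of `g, g'` and `e, e'`, and the maps are `g ↦ t f`, `g' ↦ t f'`,
`e ↦ t f`, `e' ↦ f'`; the images of `f` form a frame of `F'`, those of `e'` a frame of `F''`. -/
structure AdaptedFrames {FH F E : X.Modules} {F' F'' : H.Modules} (m : FH ⟶ F)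
    (ψ : F ⟶ (Scheme.Modules.pushforward i).obj F') (a : E ⟶ F)
    (b : E ⟶ (Scheme.Modules.pushforward i).obj F'') (U : X.Opens) where
  (I J : Type)
  [fintypeI : Fintype I]
  [fintypeJ : Fintype J]
  t : Γ(X, U)
  t_injective : ∀ (V : X.Opens) (h : V ≤ U) (c : Γ(X, V)), rr h t * c = 0 → c = 0
  t_ker : ∀ (V : X.Opens) (h : V ≤ U) (c : Γ(X, V)), (i.app V).hom c = 0 → ∀ x ∈ V,
    ∃ (W : X.Opens) (h' : W ≤ V), x ∈ W ∧ ∃ d, rr h' c = rr (h'.trans h) t * d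
  t_zero : (i.app U).hom t = 0
  f : I → Sec F U
  f' : J → Sec F U
  g : I → Sec FH U
  g' : J → Sec FH U
  e : I → Sec E U
  e' : J → Sec E U
  frame_F : IsFrame F (Sum.elim f f')
  frame_FH : IsFrame FH (Sum.elim g g')
  frame_E : IsFrame E (Sum.elim e e')
  frame_F' : IsFrame F' (fun j => apush i ψ U (f j))
  frame_F'' : IsFrame F'' (fun j => apush i b U (e' j))
  m_g : ∀ j, ap m U (g j) = t • f j
  m_g' : ∀ j, ap m U (g' j) = t • f' j
  a_e : ∀ j, ap a U (e j) = t • f j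
  a_e' : ∀ j, ap a U (e' j) = f' j
  ψ_f' : ∀ j, apush i ψ U (f' j) = 0
  b_e : ∀ j, apush i b U (e j) = 0

attribute [instance] AdaptedFrames.fintypeI AdaptedFrames.fintypeJ

section

variable {FH F E : X.Modules} {F' F'' : H.Modules} {m : FH ⟶ F}
  {ψ : F ⟶ (Scheme.Modules.pushforward i).obj F'} {a : E ⟶ F}
  {b : E ⟶ (Scheme.Modules.pushforward i).obj F''} {U : X.Opens}

namespace AdaptedFrames

variable (A : AdaptedFrames i m ψ a b U)

theorem mul_eq_zero {V : X.Opens} (h : V ≤ U) {ι : Type*} {c : ι → Γ(X, V)}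
    (hc : (fun j => rr h A.t * c j) = 0) : c = 0 :=
  funext fun j => A.t_injective V h (c j) (congrFun hc j)

/-- Functions that vanish on `H` are multiples of `t`, locally and for finitely many at a time. -/
theorem exists_mul {V : X.Opens} (h : V ≤ U) {ι : Type*} [Fintype ι] {c : ι → Γ(X, V)}
    (hc : (fun j => (i.app V).hom (c j)) = 0) {x : X} (hx : x ∈ V) :
    ∃ (W : X.Opens) (h' : W ≤ V), x ∈ W ∧ ∃ d : ι → Γ(X, W),
      (fun j => rr h' (c j)) = fun j => rr (h'.trans h) A.t * d j := by
  obtain ⟨W, hW, hxW, h1⟩ := exists_common_open hx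
    (fun j W hW => ∃ d, rr hW (c j) = rr (hW.trans h) A.t * d)
    (fun j V' W hV' h' ⟨d, hd⟩ => ⟨rr h' d, by
      rw [← rr_rr hV' h', hd, map_mul (rr h'), rr_rr]⟩)
    (fun j => A.t_ker V h (c j) (congrFun hc j) x hx)
  choose d hd using h1
  exact ⟨W, hW, hxW, d, funext hd⟩

theorem ap_m {V : X.Opens} (h : V ≤ U) (c : A.I → Γ(X, V)) (c' : A.J → Γ(X, V)) :
    ap m V (lin FH A.g A.g' h c c') =
      lin F A.f A.f' h (fun j => rr h A.t * c j) (fun j => rr h A.t * c' j) := by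
  rw [ap_lin]
  simp only [A.m_g, A.m_g', lin_smul_left, lin_smul_right]

theorem ap_a {V : X.Opens} (h : V ≤ U) (c : A.I → Γ(X, V)) (c' : A.J → Γ(X, V)) :
    ap a V (lin E A.e A.e' h c c') = lin F A.f A.f' h (fun j => rr h A.t * c j) c' := by
  rw [ap_lin]
  simp only [A.a_e, A.a_e', lin_smul_left]

theorem apush_ψ {V : X.Opens} (h : V ≤ U) (c : A.I → Γ(X, V)) (c' : A.J → Γ(X, V)) :
    apush i ψ V (lin F A.f A.f' h c c') =
      ∑ j, (i.app V).hom (c j) • rs (underlying F') (preimage_mono i h) (apush i ψ U (A.f j)) := by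
  rw [apush_lin]
  simp only [A.ψ_f', lin_zero_right]

theorem apush_b {V : X.Opens} (h : V ≤ U) (c : A.I → Γ(X, V)) (c' : A.J → Γ(X, V)) :
    apush i b V (lin E A.e A.e' h c c') =
      ∑ j, (i.app V).hom (c' j) •
        rs (underlying F'') (preimage_mono i h) (apush i b U (A.e' j)) := by
  rw [apush_lin]
  simp only [A.b_e, lin_zero_left]

theorem frame_restriction : IsFrame ((Scheme.Modules.pullback i).obj F)
    (Sum.elim (fun j => apush i (toRestriction i F) U (A.f j))
      (fun j => apush i (toRestriction i F) U (A.f' j))) := by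
  have h := A.frame_F.pullback i
  convert h using 2 with j
  cases j <;> rfl

end AdaptedFrames

variable (hA : ∀ x : X, ∃ U : X.Opens, x ∈ U ∧ Nonempty (AdaptedFrames i m ψ a b U))
  (hi : SurjectiveOnFunctions i)

include hA

theorem adapted_mono_a : Mono a := by
  refine mono_of_injective a fun V => (injective_iff_map_eq_zero _).2 fun s hs => ?_
  refine sec_ext E fun x hx => ?_
  obtain ⟨U, hxU, ⟨A⟩⟩ := hA x
  refine ⟨V ⊓ U, inf_le_left, ⟨hx, hxU⟩, ?_⟩
  obtain ⟨c, c', hc⟩ := A.frame_E.exists_lin inf_le_right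
    (rs (underlying E) (inf_le_left : V ⊓ U ≤ V) s)
  have h0 := A.ap_a inf_le_right c c'
  rw [hc, ap_rs, hs, map_zero] at h0
  obtain ⟨h1, rfl⟩ := A.frame_F.lin_eq_zero _ h0.symm
  obtain rfl := A.mul_eq_zero _ h1
  rw [← hc, map_zero]
  simp only [lin, Pi.zero_apply, zero_smul, Finset.sum_const_zero, add_zero]

theorem adapted_mono_m : Mono m := by
  refine mono_of_injective m fun V => (injective_iff_map_eq_zero _).2 fun s hs => ?_
  refine sec_ext FH fun x hx => ?_
  obtain ⟨U, hxU, ⟨A⟩⟩ := hA x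
  refine ⟨V ⊓ U, inf_le_left, ⟨hx, hxU⟩, ?_⟩
  obtain ⟨c, c', hc⟩ := A.frame_FH.exists_lin inf_le_right
    (rs (underlying FH) (inf_le_left : V ⊓ U ≤ V) s)
  have h0 := A.ap_m inf_le_right c c'
  rw [hc, ap_rs, hs, map_zero] at h0
  obtain ⟨h1, h2⟩ := A.frame_F.lin_eq_zero _ h0.symm
  obtain rfl := A.mul_eq_zero _ h1
  obtain rfl := A.mul_eq_zero _ h2
  rw [← hc, map_zero]
  simp only [lin, Pi.zero_apply, zero_smul, Finset.sum_const_zero, add_zero]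

theorem adapted_a_ψ : a ≫ ψ = 0 := by
  refine hom_ext_of_isFrame fun x => ?_
  obtain ⟨U, hxU, ⟨A⟩⟩ := hA x
  refine ⟨U, hxU, _, inferInstance, _, A.frame_E, ?_⟩
  rintro (j | j)
  · refine (pushEquiv i F' U).symm.injective ?_
    change apush i ψ U (ap a U (A.e j)) = (pushEquiv i F' U).symm 0
    rw [A.a_e, map_smulₛₗ, A.t_zero, zero_smul, map_zero]
  · refine (pushEquiv i F' U).symm.injective ?_
    change apush i ψ U (ap a U (A.e' j)) = (pushEquiv i F' U).symm 0
    rw [A.a_e', A.ψ_f', map_zero]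

theorem adapted_m_res : m ≫ toRestriction i F = 0 := by
  refine hom_ext_of_isFrame fun x => ?_
  obtain ⟨U, hxU, ⟨A⟩⟩ := hA x
  refine ⟨U, hxU, _, inferInstance, _, A.frame_FH, ?_⟩
  rintro (j | j)
  · refine (pushEquiv i _ U).symm.injective ?_
    change apush i (toRestriction i F) U (ap m U (A.g j)) = (pushEquiv i _ U).symm 0
    rw [A.m_g, map_smulₛₗ, A.t_zero, zero_smul, map_zero]
  · refine (pushEquiv i _ U).symm.injective ?_
    change apush i (toRestriction i F) U (ap m U (A.g' j)) = (pushEquiv i _ U).symm 0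
    rw [A.m_g', map_smulₛₗ, A.t_zero, zero_smul, map_zero]

theorem adapted_exact_middleRow : (ShortComplex.mk a ψ (adapted_a_ψ hA)).Exact := by
  refine exact_of_locally_exact a ψ _ fun V s hs x hx => ?_
  obtain ⟨U, hxU, ⟨A⟩⟩ := hA x
  obtain ⟨c, c', hc⟩ := A.frame_F.exists_lin inf_le_right
    (rs (underlying F) (inf_le_left : V ⊓ U ≤ V) s)
  have h0 := A.apush_ψ inf_le_right c c'
  rw [hc, apush_rs, show apush i ψ V s = 0 from hs, map_zero] at h0
  obtain ⟨W, hW, hxW, d, hd⟩ := A.exists_mul inf_le_right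
    (A.frame_F'.sum_eq_zero _ h0.symm) (x := x) ⟨hx, hxU⟩
  refine ⟨W, hW.trans inf_le_left, hxW,
    lin E A.e A.e' (hW.trans inf_le_right) d (fun j => rr hW (c' j)), ?_⟩
  rw [A.ap_a, ← hd, ← rs_rs (underlying F) inf_le_left hW, ← hc, rs_lin]

theorem adapted_exact_middleColumn :
    (ShortComplex.mk m (toRestriction i F) (adapted_m_res hA)).Exact := by
  refine exact_of_locally_exact m (toRestriction i F) _ fun V s hs x hx => ?_
  obtain ⟨U, hxU, ⟨A⟩⟩ := hA x
  obtain ⟨c, c', hc⟩ := A.frame_F.exists_lin inf_le_right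
    (rs (underlying F) (inf_le_left : V ⊓ U ≤ V) s)
  have h0 := apush_lin (toRestriction i F) A.f A.f' inf_le_right c c'
  rw [hc, apush_rs, show apush i (toRestriction i F) V s = 0 from hs, map_zero] at h0
  obtain ⟨h1, h2⟩ := A.frame_restriction.lin_eq_zero _ h0.symm
  obtain ⟨W, hW, hxW, d, hd⟩ := A.exists_mul inf_le_right h1 (x := x) ⟨hx, hxU⟩
  have h3 : (fun j => (i.app W).hom (rr hW (c' j))) = 0 := funext fun j => by
    rw [app_rr, congrFun h2 j]
    exact map_zero _
  -- The coordinates with respect to `f` are divided by `t` on `W`, those with respect to `f'` on a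
  -- smaller open set `W'`.
  obtain ⟨W', hW', hxW', d', hd'⟩ := A.exists_mul (hW.trans inf_le_right) h3 hxW
  refine ⟨W', (hW'.trans hW).trans inf_le_left, hxW', lin FH A.g A.g'
    ((hW'.trans hW).trans inf_le_right) (fun j => rr hW' (d j)) d', ?_⟩
  rw [A.ap_m, ← hd', ← rs_rs (underlying F) inf_le_left (hW'.trans hW), ← hc, rs_lin]
  simp only [← rr_rr hW hW', congrFun hd, map_mul (rr hW')]
  simp only [rr_rr]

include hi

theorem adapted_epi_ψ : Epi ψ := by
  refine epi_of_locally_surjective ψ fun V s x hx => ?_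
  obtain ⟨U, hxU, ⟨A⟩⟩ := hA x
  obtain ⟨c, hc⟩ := (A.frame_F' (i ⁻¹ᵁ (V ⊓ U)) (preimage_mono i inf_le_right)).2
    (rs (underlying F') (preimage_mono i (inf_le_left : V ⊓ U ≤ V)) ((pushEquiv i F' V).symm s))
  obtain ⟨W, hW, hxW, d, hd⟩ := hi.exists_app_family c (x := x) ⟨hx, hxU⟩
  refine ⟨W, hW.trans inf_le_left, hxW,
    lin F A.f A.f' (hW.trans inf_le_right) d (fun _ => 0), ?_⟩
  refine (pushEquiv i F' W).symm.injective ((A.apush_ψ _ _ _).trans ?_)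
  have h := congrArg (rs (underlying F') (preimage_mono i hW)) hc
  rw [rs_sum_smul, rs_rs] at h
  simp only [hd]
  exact h

theorem adapted_epi_b : Epi b := by
  refine epi_of_locally_surjective b fun V s x hx => ?_
  obtain ⟨U, hxU, ⟨A⟩⟩ := hA x
  obtain ⟨c, hc⟩ := (A.frame_F'' (i ⁻¹ᵁ (V ⊓ U)) (preimage_mono i inf_le_right)).2
    (rs (underlying F'') (preimage_mono i (inf_le_left : V ⊓ U ≤ V))
      ((pushEquiv i F'' V).symm s))
  obtain ⟨W, hW, hxW, d, hd⟩ := hi.exists_app_family c (x := x) ⟨hx, hxU⟩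
  refine ⟨W, hW.trans inf_le_left, hxW,
    lin E A.e A.e' (hW.trans inf_le_right) (fun _ => 0) d, ?_⟩
  refine (pushEquiv i F'' W).symm.injective ((A.apush_b _ _ _).trans ?_)
  have h := congrArg (rs (underlying F'') (preimage_mono i hW)) hc
  rw [rs_sum_smul, rs_rs] at h
  simp only [hd]
  exact h

theorem adapted_epi_toRestriction : Epi (toRestriction i F) := by
  refine epi_of_locally_surjective _ fun V s x hx => ?_
  obtain ⟨U, hxU, ⟨A⟩⟩ := hA x
  obtain ⟨c, c', hc⟩ := A.frame_restriction.exists_lin (preimage_mono i inf_le_right)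
    (rs (underlying _) (preimage_mono i (inf_le_left : V ⊓ U ≤ V)) ((pushEquiv i _ V).symm s))
  obtain ⟨W, hW, hxW, d, hd⟩ := hi.exists_app_family (Sum.elim c c') (x := x) ⟨hx, hxU⟩
  refine ⟨W, hW.trans inf_le_left, hxW,
    lin F A.f A.f' (hW.trans inf_le_right) (d ∘ Sum.inl) (d ∘ Sum.inr), ?_⟩
  refine (pushEquiv i _ W).symm.injective ((apush_lin _ _ _ _ _ _).trans ?_)
  have h := congrArg (rs (underlying _) (preimage_mono i hW)) hc
  rw [rs_lin, rs_rs] at h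
  simp only [Function.comp_apply, hd]
  exact h

end

end Adapted

section Display

variable {X H : Scheme.{u}} {i : H ⟶ X} {FH F E : X.Modules} {F' F'' : H.Modules} {m : FH ⟶ F}
  {ψ : F ⟶ (Scheme.Modules.pushforward i).obj F'} {a : E ⟶ F}
  {b : E ⟶ (Scheme.Modules.pushforward i).obj F''}
  (hA : ∀ x : X, ∃ U : X.Opens, x ∈ U ∧ Nonempty (AdaptedFrames i m ψ a b U))
  (hi : SurjectiveOnFunctions i)

include hA

theorem adapted_m_ψ : m ≫ ψ = 0 := by
  refine hom_ext_of_isFrame fun x => ?_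
  obtain ⟨U, hxU, ⟨A⟩⟩ := hA x
  refine ⟨U, hxU, _, inferInstance, _, A.frame_FH, ?_⟩
  rintro (j | j)
  · refine (pushEquiv i _ U).symm.injective ?_
    change apush i ψ U (ap m U (A.g j)) = (pushEquiv i _ U).symm 0
    rw [A.m_g, map_smulₛₗ, A.t_zero, zero_smul, map_zero]
  · refine (pushEquiv i _ U).symm.injective ?_
    change apush i ψ U (ap m U (A.g' j)) = (pushEquiv i _ U).symm 0
    rw [A.m_g', map_smulₛₗ, A.t_zero, zero_smul, map_zero]

theorem adapted_j_b {j : FH ⟶ E} (hj : j ≫ a = m) : j ≫ b = 0 := by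
  have := adapted_mono_a hA
  refine hom_ext_of_isFrame fun x => ?_
  obtain ⟨U, hxU, ⟨A⟩⟩ := hA x
  refine ⟨U, hxU, _, inferInstance, _, A.frame_FH, ?_⟩
  rintro (l | l)
  · have h : ap j U (A.g l) = A.e l := injective_of_mono a U (by
      rw [← ap_comp, hj, A.m_g, A.a_e])
    refine (pushEquiv i _ U).symm.injective ?_
    change apush i b U (ap j U (A.g l)) = (pushEquiv i _ U).symm 0
    rw [h, A.b_e, map_zero]
  · have h : ap j U (A.g' l) = A.t • A.e' l := injective_of_mono a U (by
      rw [← ap_comp, hj, A.m_g', map_smul, A.a_e'])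
    refine (pushEquiv i _ U).symm.injective ?_
    change apush i b U (ap j U (A.g' l)) = (pushEquiv i _ U).symm 0
    rw [h, map_smulₛₗ, A.t_zero, zero_smul, map_zero]

theorem adapted_exact_leftColumn {j : FH ⟶ E} (hj : j ≫ a = m) :
    (ShortComplex.mk j b (adapted_j_b hA hj)).Exact := by
  have := adapted_mono_a hA
  refine exact_of_locally_exact j b _ fun V s hs x hx => ?_
  obtain ⟨U, hxU, ⟨A⟩⟩ := hA x
  obtain ⟨c, c', hc⟩ := A.frame_E.exists_lin inf_le_right
    (rs (underlying E) (inf_le_left : V ⊓ U ≤ V) s)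
  have h0 := A.apush_b inf_le_right c c'
  rw [hc, apush_rs, show apush i b V s = 0 from hs, map_zero] at h0
  obtain ⟨W, hW, hxW, d, hd⟩ := A.exists_mul inf_le_right
    (A.frame_F''.sum_eq_zero _ h0.symm) (x := x) ⟨hx, hxU⟩
  refine ⟨W, hW.trans inf_le_left, hxW,
    lin FH A.g A.g' (hW.trans inf_le_right) (fun j => rr hW (c j)) d,
    injective_of_mono a W ?_⟩
  rw [← ap_comp, hj, A.ap_m, ← hd, ← rs_rs (underlying E) inf_le_left hW, ← hc, rs_lin, A.ap_a]

theorem adapted_mono_c {c : F'' ⟶ (Scheme.Modules.pullback i).obj F}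
    (hc : a ≫ toRestriction i F = b ≫ (Scheme.Modules.pushforward i).map c) : Mono c := by
  refine mono_of_injective c fun V => (injective_iff_map_eq_zero _).2 fun s hs => ?_
  refine sec_ext F'' fun x hx => ?_
  obtain ⟨U, hxU, ⟨A⟩⟩ := hA (i.base x)
  have hce : ∀ l, ap c _ (apush i b U (A.e' l)) = apush i (toRestriction i F) U (A.f' l) :=
    fun l => by rw [← apush_comp, ← hc, apush_precomp, A.a_e']
  refine ⟨V ⊓ i ⁻¹ᵁ U, inf_le_left, ⟨hx, hxU⟩, ?_⟩
  obtain ⟨d, hd⟩ := (A.frame_F'' _ inf_le_right).2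
    (rs (underlying F'') (inf_le_left : V ⊓ i ⁻¹ᵁ U ≤ V) s)
  have h1 := congrArg (ap c _) hd
  rw [ap_rs, hs, map_zero] at h1
  simp only [map_sum, map_smul, ap_rs, hce] at h1
  obtain ⟨-, h2⟩ := A.frame_restriction.lin_eq_zero (c := 0) (c' := d) inf_le_right (by
    rw [← h1]
    simp only [lin, Pi.zero_apply, zero_smul, Finset.sum_const_zero, zero_add])
  obtain rfl := h2
  rw [← hd, map_zero]
  simp only [Pi.zero_apply, zero_smul, Finset.sum_const_zero]

theorem adapted_epi_restrictionHom : Epi (restrictionHom i ψ) := by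
  refine epi_of_locally_surjective _ fun V s x hx => ?_
  obtain ⟨U, hxU, ⟨A⟩⟩ := hA (i.base x)
  obtain ⟨d, hd⟩ := (A.frame_F' _ inf_le_right).2
    (rs (underlying F') (inf_le_left : V ⊓ i ⁻¹ᵁ U ≤ V) s)
  refine ⟨V ⊓ i ⁻¹ᵁ U, inf_le_left, ⟨hx, hxU⟩,
    ∑ j, d j • rs (underlying _) inf_le_right (apush i (toRestriction i F) U (A.f j)), ?_⟩
  rw [← hd]
  simp only [map_sum, map_smul, ap_rs, ← apush_comp, toRestriction_restrictionHom]

theorem adapted_exact_bottomRow {c : F'' ⟶ (Scheme.Modules.pullback i).obj F}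
    (hc : a ≫ toRestriction i F = b ≫ (Scheme.Modules.pushforward i).map c)
    (w : c ≫ restrictionHom i ψ = 0) : (ShortComplex.mk c (restrictionHom i ψ) w).Exact := by
  refine exact_of_locally_exact _ _ _ fun V s hs x hx => ?_
  obtain ⟨U, hxU, ⟨A⟩⟩ := hA (i.base x)
  have hce : ∀ l, ap c _ (apush i b U (A.e' l)) = apush i (toRestriction i F) U (A.f' l) :=
    fun l => by rw [← apush_comp, ← hc, apush_precomp, A.a_e']
  obtain ⟨d, d', hd⟩ := A.frame_restriction.exists_lin inf_le_right
    (rs (underlying _) (inf_le_left : V ⊓ i ⁻¹ᵁ U ≤ V) s)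
  have h1 := congrArg (ap (restrictionHom i ψ) _) hd
  rw [ap_rs, hs, map_zero, ap_lin] at h1
  simp only [← apush_comp, toRestriction_restrictionHom, A.ψ_f', lin_zero_right] at h1
  have h2 := A.frame_F'.sum_eq_zero inf_le_right h1
  refine ⟨V ⊓ i ⁻¹ᵁ U, inf_le_left, ⟨hx, hxU⟩,
    ∑ j, d' j • rs (underlying _) inf_le_right (apush i b U (A.e' j)), ?_⟩
  rw [← hd, h2]
  simp only [lin, map_sum, map_smul, ap_rs, hce, Pi.zero_apply, zero_smul, Finset.sum_const_zero,
    zero_add]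

include hi

/-- Adapted frames around every point give the display of an elementary transformation: `j` is
`m` lifted through the kernel `a` of `ψ`, and `c` is the map induced by `a` on cokernels, a
morphism of direct images and hence the direct image of a morphism. -/
theorem nonempty_elementaryTransformation (hF' : IsVectorBundle F') (hF'' : IsVectorBundle F'') :
    Nonempty (ElementaryTransformation i m ψ E F'') := by
  have := adapted_mono_a hA
  have := adapted_mono_m hA
  have := adapted_epi_ψ hA hi
  have := adapted_epi_b hA hi
  have := adapted_epi_toRestriction hA hi
  have := adapted_epi_restrictionHom hA
  let j : FH ⟶ E := (adapted_exact_middleRow hA).lift m (adapted_m_ψ hA)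
  have hj : j ≫ a = m := (adapted_exact_middleRow hA).lift_f m (adapted_m_ψ hA)
  have : Mono j := mono_of_mono_fac hj
  have hw : j ≫ a ≫ toRestriction i F = 0 := by
    rw [← Category.assoc, hj, adapted_m_res hA]
  obtain ⟨c, hc⟩ := hi.exists_pushforward_map_eq
    ((adapted_exact_leftColumn hA hj).desc (a ≫ toRestriction i F) hw)
  have hc' : a ≫ toRestriction i F = b ≫ (Scheme.Modules.pushforward i).map c := by
    rw [hc]
    exact ((adapted_exact_leftColumn hA hj).g_desc _ hw).symm
  have := adapted_mono_c hA hc'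
  have hcψ : c ≫ restrictionHom i ψ = 0 := hi.pushforward_map_injective (by
    rw [← cancel_epi b, Functor.map_comp, ← Category.assoc, ← hc', Category.assoc,
      toRestriction_restrictionHom, adapted_a_ψ hA, Functor.map_zero, Limits.comp_zero])
  exact ⟨{
    a := a
    b := b
    c := c
    j := j
    isVectorBundle_F := isVectorBundle_of_isFrame fun x => by
      obtain ⟨U, hxU, ⟨A⟩⟩ := hA x
      exact ⟨U, hxU, _, inferInstance, _, A.frame_F⟩
    isVectorBundle_F' := hF'
    isVectorBundle_E := isVectorBundle_of_isFrame fun x => by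
      obtain ⟨U, hxU, ⟨A⟩⟩ := hA x
      exact ⟨U, hxU, _, inferInstance, _, A.frame_E⟩
    isVectorBundle_F'' := hF''
    isVectorBundle_FH := isVectorBundle_of_isFrame fun x => by
      obtain ⟨U, hxU, ⟨A⟩⟩ := hA x
      exact ⟨U, hxU, _, inferInstance, _, A.frame_FH⟩
    comm_top := hj
    comm_left := hc'
    comm_right := toRestriction_restrictionHom i ψ
    a_ψ := adapted_a_ψ hA
    c_ψ := hcψ
    j_b := adapted_j_b hA hj
    m_res := adapted_m_res hA
    middleRow := { exact := adapted_exact_middleRow hA }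
    bottomRow := { exact := adapted_exact_bottomRow hA hc' hcψ }
    leftColumn := { exact := adapted_exact_leftColumn hA hj }
    middleColumn := { exact := adapted_exact_middleColumn hA } }⟩

end Display

/-! ### Contraction of exterior products with the Euler field -/

section EulerContraction

variable {R M : Type*} [CommRing R] [AddCommGroup M] [Module R M]

/-- Alternating maps that agree on tuples of vectors from a spanning set are equal. -/
theorem alternatingMap_ext_of_span {W N : Type*} [AddCommGroup W] [Module R W] [AddCommGroup N]
    [Module R N] {n : ℕ} {f g : W [⋀^Fin n]→ₗ[R] N} {s : Set W} (hs : Submodule.span R s = ⊤)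
    (h : ∀ m : Fin n → W, (∀ j, m j ∈ s) → f m = g m) : f = g := by
  refine exteriorPower.alternatingMapLinearEquiv.injective (LinearMap.ext_on
    (s := exteriorPower.ιMulti R n '' {m | Set.range m ⊆ s}) ?_ ?_)
  · apply LinearMap.map_injective (Submodule.ker_subtype (⋀[R]^n W))
    rw [LinearMap.map_span, Set.image_image]
    simpa using exteriorPower.ιMulti_span_fixedDegree_of_span_eq_top R n W hs
  · rintro _ ⟨m, hm, rfl⟩
    rw [exteriorPower.alternatingMapLinearEquiv_apply_ιMulti,
      exteriorPower.alternatingMapLinearEquiv_apply_ιMulti, h m fun j => hm ⟨j, rfl⟩]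

/-- For pairs `mₗ = (yₗ, ωₗ)`, the form `∑ₗ (-1)ˡ yₗ ω₀ ∧ ⋯ ∧ ω̂ₗ ∧ ⋯ ∧ ω_q`, as an alternating map.
If `yₗ` are homogeneous coordinates divided by one of them and `ωₗ = dyₗ`, this is the contraction
of `dx₀ ∧ ⋯ ∧ dx_q` with the Euler vector field, dehomogenized. -/
def eulerForm (R M : Type*) [CommRing R] [AddCommGroup M] [Module R M] (q : ℕ) :
    (R × M) [⋀^Fin (q + 1)]→ₗ[R] ⋀[R]^q M :=
  AlternatingMap.alternatizeUncurryFin ((LinearMap.fst R R M).smulRight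
    ((exteriorPower.ιMulti R q).compLinearMap (LinearMap.snd R R M)))

theorem eulerForm_apply {q : ℕ} (m : Fin (q + 1) → R × M) :
    eulerForm R M q m = ∑ l : Fin (q + 1), (-1) ^ (l : ℕ) •
      ((m l).1 • exteriorPower.ιMulti R q (fun j => (m (l.succAbove j)).2)) := by
  rw [eulerForm, AlternatingMap.alternatizeUncurryFin_apply]
  rfl

theorem eulerForm_smul {q : ℕ} (u : R) (m : Fin (q + 1) → R × M) :
    eulerForm R M q (fun l => u • m l) = u ^ (q + 1) • eulerForm R M q m := by
  rw [(eulerForm R M q).map_smul_univ (fun _ => u) m]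
  simp

/-- If only the first `y₀` is nonzero, the Euler form is `y₀ ω₁ ∧ ⋯ ∧ ω_q`. -/
theorem eulerForm_cons {q : ℕ} (y : R × M) (ω : Fin q → M) :
    eulerForm R M q (Fin.cons y fun l => (0, ω l)) = y.1 • exteriorPower.ιMulti R q ω := by
  rw [eulerForm_apply, Fin.sum_univ_succ]
  simp

/-- The Euler form is unchanged by the shears `(y, ω) ↦ (y, ω + y η)`. -/
theorem eulerForm_shear {q : ℕ} (η : M) (m : Fin (q + 1) → R × M) :
    eulerForm R M q (fun l => m l + (0, (m l).1 • η)) = eulerForm R M q m := by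
  have hspan : Submodule.span R ({((1 : R), (0 : M))} ∪ Set.range fun ω : M => ((0 : R), ω)) = ⊤ := by
    refine eq_top_iff.2 fun w _ => ?_
    have hw : w = w.1 • ((1 : R), (0 : M)) + (0, w.2) := by ext <;> simp
    rw [hw]
    exact add_mem (Submodule.smul_mem _ _ (Submodule.subset_span (Or.inl rfl)))
      (Submodule.subset_span (Or.inr ⟨_, rfl⟩))
  let σ : R × M →ₗ[R] R × M :=
    LinearMap.id + (LinearMap.inr R R M ∘ₗ (LinearMap.fst R R M).smulRight η)
  suffices h : (eulerForm R M q).compLinearMap σ = eulerForm R M q from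
    congrArg (fun f => f m) h
  refine alternatingMap_ext_of_span hspan fun m hm => ?_
  -- All entries of `m` are `(1, 0)` or `(0, ω)`. If `(1, 0)` occurs twice, both sides vanish.
  -- Otherwise the shear changes at most one entry, and that one only contributes through its first
  -- component.
  by_cases h2 : ∃ l l', l ≠ l' ∧ m l = (1, 0) ∧ m l' = (1, 0)
  · obtain ⟨l, l', hl, h, h'⟩ := h2
    rw [AlternatingMap.map_eq_zero_of_eq _ m (h.trans h'.symm) hl,
      AlternatingMap.map_eq_zero_of_eq _ m (h.trans h'.symm) hl]
  rw [AlternatingMap.compLinearMap_apply, eulerForm_apply, eulerForm_apply]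
  refine Finset.sum_congr rfl fun l _ => ?_
  have h1 : ∀ l, (σ (m l)).1 = (m l).1 := fun l => by simp [σ]
  have h0 : ∀ l, m l ≠ (1, 0) → (m l).1 = 0 := fun l hl => by
    obtain h | ⟨ω, h⟩ := hm l
    · exact (hl h).elim
    · rw [← h]
  rw [h1]
  by_cases hl : m l = (1, 0)
  · congr 3
    funext j
    have hj : m (l.succAbove j) ≠ (1, 0) := fun h =>
      h2 ⟨_, _, Fin.succAbove_ne l j, h, hl⟩
    simp [σ, h0 _ hj]
  · rw [h0 l hl, zero_smul, zero_smul]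

theorem exteriorPowerMap_eulerForm {S N : Type*} [CommRing S] [AddCommGroup N] [Module S N]
    {σ : R →+* S} (f : M →ₛₗ[σ] N) {q : ℕ} (m : Fin (q + 1) → R × M) :
    exteriorPowerMap f q (eulerForm R M q m) =
      eulerForm S N q (fun l => (σ (m l).1, f (m l).2)) := by
  rw [eulerForm_apply, eulerForm_apply, map_sum]
  refine Finset.sum_congr rfl fun l _ => ?_
  refine (map_zsmul (exteriorPowerMap f q) _ _).trans (congrArg _ ?_)
  rw [map_smulₛₗ (exteriorPowerMap f q), exteriorPowerMap_ιMulti]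

end EulerContraction

section SplitSpan

variable {R M J : Type*} [CommRing R] [AddCommGroup M] [Module R M] [LinearOrder J]

/-- If the vectors `b j` and `c` span a module, its exterior power is spanned by the products
of the `b j` and the products of `c` with the `b j`. -/
theorem span_ιMulti_split {b : J → M} {c : M}
    (h : Submodule.span R (insert c (Set.range b)) = ⊤) (q : ℕ) :
    Submodule.span R (Set.range (Sum.elim
      (fun S : Set.powersetCard J (q + 1) => exteriorPower.ιMulti_family R (q + 1) b S)
      (fun T : Set.powersetCard J q => exteriorPower.ιMulti R (q + 1)
        (Fin.cons c (b ∘ Set.powersetCard.ofFinEmbEquiv.symm T))))) = ⊤ := by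
  let v : WithBot J → M := fun j => WithBot.recBotCoe c b j
  have hv : Submodule.span R (Set.range v) = ⊤ := by
    rw [eq_top_iff, ← h, Submodule.span_le, Set.insert_subset_iff, Set.range_subset_iff]
    exact ⟨Submodule.subset_span ⟨⊥, rfl⟩, fun j => Submodule.subset_span ⟨(j : WithBot J), rfl⟩⟩
  rw [eq_top_iff, ← exteriorPower.ιMulti_family_span_of_span R (n := q + 1) hv, Submodule.span_le,
    Set.range_subset_iff]
  intro S
  obtain ⟨f, rfl⟩ := Set.powersetCard.ofFinEmbEquiv.surjective S
  rw [exteriorPower.ιMulti_family, Equiv.symm_apply_apply]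
  refine Submodule.subset_span ?_
  have hlift : ∀ {r : ℕ} (g : Fin r → WithBot J), StrictMono g → (∀ l, g l ≠ ⊥) →
      ∃ g' : Fin r ↪o J, ∀ l, g l = g' l := by
    intro r g hg hne
    choose g' hg' using fun l => WithBot.ne_bot_iff_exists.1 (hne l)
    exact ⟨OrderEmbedding.ofStrictMono g' fun l l' hl => WithBot.coe_lt_coe.1 (by
      rw [hg', hg']; exact hg hl), fun l => (hg' l).symm⟩
  by_cases h0 : f 0 = ⊥
  · obtain ⟨g, hg⟩ := hlift (fun l => f l.succ) (fun l l' hl => f.strictMono (Fin.succ_lt_succ_iff.2 hl))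
      (fun l hl => (Fin.succ_ne_zero l) (f.injective (hl.trans h0.symm)))
    refine ⟨Sum.inr (Set.powersetCard.ofFinEmbEquiv g), ?_⟩
    rw [Sum.elim_inr, Equiv.symm_apply_apply]
    congr 1
    funext l
    refine Fin.cases ?_ (fun l => ?_) l
    · simp [v, h0]
    · simp [v, hg]
  · obtain ⟨g, hg⟩ := hlift f f.strictMono (fun l hl => h0 (by
      rw [← le_bot_iff, ← hl]; exact f.monotone (Fin.zero_le l)))
    refine ⟨Sum.inl (Set.powersetCard.ofFinEmbEquiv g), ?_⟩
    rw [Sum.elim_inl, exteriorPower.ιMulti_family, Equiv.symm_apply_apply]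
    congr 1
    funext l
    simp [v, hg]

end SplitSpan

/-! ### Frames of sheaves of twisted forms -/

section Bases

variable {R M : Type*} [CommRing R] [AddCommGroup M] [Module R M] {ι : Type*} [Fintype ι]

theorem bijective_sum_smul_iff {v : ι → M} :
    (Function.Bijective fun c : ι → R => ∑ j, c j • v j) ↔
      ∃ b : Module.Basis ι R M, ∀ j, b j = v j := by
  classical
  constructor
  · intro h
    let b := Module.Basis.ofEquivFun (LinearEquiv.ofBijective (Fintype.linearCombination R v) h).symm
    refine ⟨b, fun j => ?_⟩
    rw [Module.Basis.coe_ofEquivFun]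
    exact (Fintype.linearCombination_apply_single R v j 1).trans (one_smul _ _)
  · rintro ⟨b, hb⟩
    simp only [← hb]
    convert b.equivFun.symm.bijective using 1
    funext c
    rw [Module.Basis.equivFun_symm_apply]

theorem bijective_tmul {N : Type*} [AddCommGroup N] [Module R N] {g : N}
    (hg : Function.Bijective fun c : R => c • g) :
    Function.Bijective fun m : M => TensorProduct.tmul R m g := by
  let e : R ≃ₗ[R] N := LinearEquiv.ofBijective (LinearMap.toSpanSingleton R N g) hg
  convert ((TensorProduct.rid R M).symm.trans (TensorProduct.congr (LinearEquiv.refl R M) e)).bijective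
    using 1
  funext m
  have he : e 1 = g := one_smul R g
  simp [he]

end Bases

section Presheaves

variable {X Y : Scheme.{u}} {U : X.Opens} {ι : Type*} [Fintype ι]

/-- The exterior product of sections of a presheaf of modules. -/
def wedge (P : PMod X.presheaf) (q : ℕ) (U : X.Opens) :
    (P.obj (op U)) [⋀^Fin q]→ₗ[Γ(X, U)] ((exteriorPresheaf P q).obj (op U)) :=
  exteriorPower.ιMulti Γ(X, U) q

theorem rs_wedge (P : PMod X.presheaf) {q : ℕ} {V : X.Opens} (h : V ≤ U)
    (m : Fin q → P.obj (op U)) :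
    rs (exteriorPresheaf P q) h (wedge P q U m) = wedge P q V (fun l => rs P h (m l)) :=
  exteriorPowerMap_ιMulti _ _ _

theorem IsLocalBasis.wedge [LinearOrder ι] {P : PMod X.presheaf} {s : ι → P.obj (op U)}
    (hs : IsLocalBasis P s) (q : ℕ) [Fintype (Set.powersetCard ι q)] :
    IsLocalBasis (exteriorPresheaf P q)
      (fun T : Set.powersetCard ι q => wedge P q U (s ∘ Set.powersetCard.ofFinEmbEquiv.symm T)) := by
  intro V hV x hx
  obtain ⟨W, h, hWV, hxW, hb⟩ := hs V hV x hx
  refine ⟨W, h, hWV, hxW, ?_⟩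
  obtain ⟨b, hb⟩ := bijective_sum_smul_iff.1 hb
  refine bijective_sum_smul_iff.2 ⟨b.exteriorPower q, fun T => ?_⟩
  refine (exteriorPower.basis_apply _ _ b T).trans (Eq.trans ?_ (rs_wedge P h _).symm)
  exact congrArg (ElementaryTransformations.wedge P q W) (funext fun l => hb _)

/-- The tensor product of sections of presheaves of modules. -/
def tensorSec (P Q : PMod X.presheaf) (U : X.Opens) :
    P.obj (op U) →ₗ[Γ(X, U)] Q.obj (op U) →ₗ[Γ(X, U)]
      (PresheafOfModules.Monoidal.tensorObj P Q).obj (op U) :=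
  TensorProduct.mk Γ(X, U) (P.obj (op U)) (Q.obj (op U))

theorem rs_tensorSec (P Q : PMod X.presheaf) {V : X.Opens} (h : V ≤ U) (p : P.obj (op U))
    (r : Q.obj (op U)) :
    rs (PresheafOfModules.Monoidal.tensorObj P Q) h (tensorSec P Q U p r) =
      tensorSec P Q V (rs P h p) (rs Q h r) := rfl

theorem IsFrame.tensorSec {M : X.Modules} {s : ι → Sec M U} (hs : IsFrame M s)
    {Q : PMod X.presheaf} {g : Q.obj (op U)}
    (hg : ∀ (V : X.Opens) (h : V ≤ U), Function.Bijective fun c : Γ(X, V) => c • rs Q h g) :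
    IsLocalBasis (PresheafOfModules.Monoidal.tensorObj (underlying M) Q)
      (fun j => tensorSec (underlying M) Q U (s j) g) := by
  intro V hV x hx
  refine ⟨V, hV, le_rfl, hx, ?_⟩
  have h1 : Function.Bijective fun m : Sec M V =>
    ElementaryTransformations.tensorSec (underlying M) Q V m (rs Q hV g) := bijective_tmul (hg V hV)
  convert h1.comp (hs V hV) using 1
  funext c
  simp only [Function.comp_apply, map_sum, map_smul, LinearMap.sum_apply, LinearMap.smul_apply,
    rs_tensorSec]

variable (f : Y ⟶ X)

theorem pap_toAssocSheaf_lift {P : PMod X.presheaf} {M : X.Modules} (α : P ⟶ underlying M)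
    (U : X.Opens) (x : P.obj (op U)) :
    ap (assocSheafLift α) U (pap (toAssocSheaf P) U x) = pap α U x := by
  have h : toAssocSheaf P ≫ (Scheme.Modules.toPresheafOfModules X).map (assocSheafLift α) = α :=
    ((PresheafOfModules.sheafificationAdjunction (R := X.ringCatSheaf)
      (𝟙 X.ringCatSheaf.obj)).homEquiv_unit P M _).symm.trans
        (((PresheafOfModules.sheafificationAdjunction
          (R := X.ringCatSheaf) (𝟙 X.ringCatSheaf.obj)).homEquiv P M).apply_symm_apply α)
  exact congrArg (fun β => pap β U x) h

theorem apush_assocSheafPush {P : PMod X.presheaf} {Q : PMod Y.presheaf} (α : P ⟶ push f Q)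
    (U : X.Opens) (x : P.obj (op U)) :
    apush f (assocSheafPush f α) U (pap (toAssocSheaf P) U x) =
      pap (toAssocSheaf Q) (f ⁻¹ᵁ U) (pmodHomApp f.c α (op U) x) :=
  pap_toAssocSheaf_lift (M := (Scheme.Modules.pushforward f).obj (assocSheaf Q)) _ U x

end Presheaves

/-! ### Functions and sections of twisting sheaves on `Proj` -/

section ProjSections

variable {A σ : Type u} [CommRing A] [SetLike σ A] [AddSubgroupClass σ A]
  {𝒜 : ℕ → σ} [GradedRing 𝒜] {U : (Proj 𝒜).Opens}

/-- The value of a function at a point, in the localization of `A`. -/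
def valHom {x : ProjectiveSpectrum 𝒜} (hx : x ∈ U) : Γ(Proj 𝒜, U) →+* LocalAt 𝒜 x where
  toFun r := sectionVal 𝒜 r ⟨x, hx⟩
  map_one' := HomogeneousLocalization.val_one
  map_zero' := HomogeneousLocalization.val_zero
  map_mul' _ _ := HomogeneousLocalization.val_mul _ _
  map_add' _ _ := HomogeneousLocalization.val_add _ _

theorem valHom_ext {r r' : Γ(Proj 𝒜, U)}
    (h : ∀ (x : ProjectiveSpectrum 𝒜) (hx : x ∈ U), valHom hx r = valHom hx r') : r = r' :=
  Subtype.ext (funext fun x => HomogeneousLocalization.val_injective _ (h x.1 x.2))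

theorem valHom_rr {V : (Proj 𝒜).Opens} (h : V ≤ U) {x : ProjectiveSpectrum 𝒜} (hx : x ∈ V)
    (r : Γ(Proj 𝒜, U)) : valHom hx (rr h r) = valHom (h hx) r := rfl

theorem isUnit_algebraMap {x : ProjectiveSpectrum 𝒜} {b : A}
    (h : x ∈ ProjectiveSpectrum.basicOpen 𝒜 b) : IsUnit (algebraMap A (LocalAt 𝒜 x) b) :=
  IsLocalization.map_units (M := x.asHomogeneousIdeal.toIdeal.primeCompl) _ ⟨b, h⟩

/-- A family of elements of the localizations that is locally a quotient of homogeneous elements of the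
same degree is a function on `Proj`. -/
theorem exists_function {s : LocalFamily 𝒜 U} (hs : IsLocallyQuotient 0 s) :
    ∃ r : Γ(Proj 𝒜, U), ∀ (x : ProjectiveSpectrum 𝒜) (hx : x ∈ U), valHom hx r = s ⟨x, hx⟩ := by
  have h1 : ∀ {x : ProjectiveSpectrum 𝒜} {a b : A} {t : LocalAt 𝒜 x}
      (hb : b ∉ x.asHomogeneousIdeal.toIdeal),
      algebraMap A (LocalAt 𝒜 x) b * t = algebraMap A (LocalAt 𝒜 x) a →
      Localization.mk a ⟨b, hb⟩ = t := fun {x a b t} hb h =>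
    (isUnit_algebraMap (𝒜 := 𝒜) (x := x) hb).mul_left_cancel (by
      rw [h]; exact algebraMap_mul_mk 𝒜 a b hb)
  have h2 : ∀ x : {x : ProjectiveSpectrum 𝒜 // x ∈ U},
      ∃ r : HomogeneousLocalization.AtPrime 𝒜 x.1.asHomogeneousIdeal.toIdeal, r.val = s x := by
    rintro ⟨x, hx⟩
    obtain ⟨V, hV, j, a, b, ha, hb, h⟩ := hs x hx
    exact ⟨HomogeneousLocalization.mk ⟨j, ⟨a, ha⟩, ⟨b, hb⟩, (h x hx hV).1⟩,
      h1 (h x hx hV).1 (h x hx hV).2⟩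
  choose r hr using h2
  refine ⟨⟨r, ?_⟩, fun x hx => hr ⟨x, hx⟩⟩
  rintro ⟨x, hx⟩
  obtain ⟨V, hV, j, a, b, ha, hb, h⟩ := hs x hx
  refine ⟨V ⊓ U, ⟨hV, hx⟩, homOfLE inf_le_right, j, ⟨a, ha⟩, ⟨b, hb⟩,
    fun y => (h y.1 y.2.2 y.2.1).1, fun y => HomogeneousLocalization.val_injective _ ?_⟩
  exact (hr ⟨y.1, y.2.2⟩).trans (h1 (h y.1 y.2.2 y.2.1).1 (h y.1 y.2.2 y.2.1).2).symm

theorem exists_quotient {e : ℕ} {a b : A} (ha : a ∈ 𝒜 e) (hb : b ∈ 𝒜 e)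
    (hU : U ≤ Proj.basicOpen 𝒜 b) :
    ∃ r : Γ(Proj 𝒜, U), ∀ (x : ProjectiveSpectrum 𝒜) (hx : x ∈ U),
      valHom hx r = Localization.mk a ⟨b, hU hx⟩ :=
  exists_function (s := fun x => Localization.mk a ⟨b, hU x.2⟩) fun _ _ => ⟨⊤, trivial, e, a, b, ha,
    hb, fun _ hy _ => ⟨hU hy, algebraMap_mul_mk 𝒜 _ _ _⟩⟩

/-- The function `a / b` on an open set on which `b` does not vanish, chosen by its values; it is
characterized by `valHom_quotient`. -/
def quotient {e : ℕ} {a b : A} (ha : a ∈ 𝒜 e) (hb : b ∈ 𝒜 e) (hU : U ≤ Proj.basicOpen 𝒜 b) :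
    Γ(Proj 𝒜, U) := (exists_quotient ha hb hU).choose

theorem valHom_quotient {e : ℕ} {a b : A} (ha : a ∈ 𝒜 e) (hb : b ∈ 𝒜 e)
    (hU : U ≤ Proj.basicOpen 𝒜 b) {x : ProjectiveSpectrum 𝒜} (hx : x ∈ U) :
    algebraMap A (LocalAt 𝒜 x) b * valHom hx (quotient ha hb hU) =
      algebraMap A (LocalAt 𝒜 x) a := by
  rw [quotient, (exists_quotient ha hb hU).choose_spec]
  exact algebraMap_mul_mk 𝒜 _ _ _

theorem quotient_ext {b : A} (hU : U ≤ Proj.basicOpen 𝒜 b) {r r' : Γ(Proj 𝒜, U)}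
    (h : ∀ (x : ProjectiveSpectrum 𝒜) (hx : x ∈ U), algebraMap A (LocalAt 𝒜 x) b * valHom hx r =
      algebraMap A (LocalAt 𝒜 x) b * valHom hx r') : r = r' :=
  valHom_ext fun x hx => (isUnit_algebraMap (hU hx)).mul_left_cancel (h x hx)

theorem rr_quotient {e : ℕ} {a b : A} (ha : a ∈ 𝒜 e) (hb : b ∈ 𝒜 e)
    (hU : U ≤ Proj.basicOpen 𝒜 b) {V : (Proj 𝒜).Opens} (h : V ≤ U) :
    rr h (quotient ha hb hU) = quotient ha hb (h.trans hU) :=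
  quotient_ext (h.trans hU) fun x hx => by
    rw [valHom_rr, valHom_quotient, valHom_quotient]

theorem quotient_self {e : ℕ} {b : A} (hb : b ∈ 𝒜 e) (hU : U ≤ Proj.basicOpen 𝒜 b) :
    quotient hb hb hU = 1 :=
  quotient_ext hU fun x hx => by rw [valHom_quotient, map_one, mul_one]

theorem quotient_mul_quotient {e : ℕ} {a b c : A} (ha : a ∈ 𝒜 e) (hb : b ∈ 𝒜 e) (hc : c ∈ 𝒜 e)
    (hU : U ≤ Proj.basicOpen 𝒜 b) (hU' : U ≤ Proj.basicOpen 𝒜 c) :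
    quotient hb hc hU' * quotient ha hb hU = quotient ha hc hU' :=
  quotient_ext hU' fun x hx => by
    rw [map_mul, ← mul_assoc, valHom_quotient, valHom_quotient, valHom_quotient]

/-- A homogeneous element `a ∈ A_d`, as a section of `O(d)`. -/
def homogSec {d : ℕ} {a : A} (ha : a ∈ 𝒜 d) (U : (Proj 𝒜).Opens) :
    (twistingSheaf 𝒜 d).obj (op U) :=
  (⟨fun x => algebraMap A (LocalAt 𝒜 x.1) a, IsLocallyQuotient.algebraMap U ha⟩ :
    twistSections 𝒜 d U)

theorem rs_homogSec {d : ℕ} {a : A} (ha : a ∈ 𝒜 d) {V : (Proj 𝒜).Opens} (h : V ≤ U) :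
    rs (twistingSheaf 𝒜 d) h (homogSec ha U) = homogSec ha V := rfl

/-- The value of a section of `O(d)` at a point. -/
def twistVal {d : ℕ} (s : (twistingSheaf 𝒜 d).obj (op U)) (x : ProjectiveSpectrum 𝒜) (hx : x ∈ U) :
    LocalAt 𝒜 x :=
  (show twistSections 𝒜 d U from s).1 ⟨x, hx⟩

theorem twistVal_ext {d : ℕ} {s t : (twistingSheaf 𝒜 d).obj (op U)}
    (h : ∀ x hx, twistVal s x hx = twistVal t x hx) : s = t :=
  Subtype.ext (funext fun x => h x.1 x.2)

theorem twistVal_smul {d : ℕ} (r : Γ(Proj 𝒜, U)) (s : (twistingSheaf 𝒜 d).obj (op U))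
    (x : ProjectiveSpectrum 𝒜) (hx : x ∈ U) :
    twistVal (r • s) x hx = valHom hx r * twistVal s x hx := rfl

theorem twistVal_homogSec {d : ℕ} {a : A} (ha : a ∈ 𝒜 d) (x : ProjectiveSpectrum 𝒜) (hx : x ∈ U) :
    twistVal (homogSec ha U) x hx = algebraMap A (LocalAt 𝒜 x) a := rfl

/-- A homogeneous element of degree `d` generates `O(d)` where it does not vanish. -/
theorem bijective_smul_homogSec {d : ℕ} {a : A} (ha : a ∈ 𝒜 d) (hU : U ≤ Proj.basicOpen 𝒜 a) :
    Function.Bijective fun c : Γ(Proj 𝒜, U) => c • homogSec ha U := by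
  constructor
  · intro c c' h
    refine quotient_ext hU fun x hx => ?_
    have := congrArg (fun s => twistVal s x hx) h
    simp only [twistVal_smul, twistVal_homogSec] at this
    rwa [mul_comm, mul_comm (algebraMap _ _ a)]
  · intro s
    have hs : IsLocallyQuotient (U := U) 0
        (fun x => (isUnit_algebraMap (hU x.2)).unit⁻¹ * twistVal s x.1 x.2) := by
      intro x hx
      obtain ⟨V, hV, j, a', b, ha', hb, h⟩ := s.2 x hx
      refine ⟨V, hV, j + d, a', b * a, ha', SetLike.mul_mem_graded hb ha, fun y hy hyV =>
        ⟨fun hba => (y.isPrime.mem_or_mem hba).elim (h y hy hyV).1 (hU hy), ?_⟩⟩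
      rw [← (h y hy hyV).2, map_mul, mul_assoc, ← mul_assoc (algebraMap _ _ a),
        IsUnit.mul_val_inv, one_mul]
      rfl
    obtain ⟨r, hr⟩ := exists_function hs
    refine ⟨r, twistVal_ext fun x hx => ?_⟩
    rw [twistVal_smul, hr, twistVal_homogSec, mul_right_comm, IsUnit.val_inv_mul, one_mul]

theorem quotient_smul_homogSec {e d : ℕ} {a b : A} (ha : a ∈ 𝒜 e) (hb : b ∈ 𝒜 e)
    (hU : U ≤ Proj.basicOpen 𝒜 b) {c c' : A} (hc : c ∈ 𝒜 d) (hc' : c' ∈ 𝒜 d)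
    (h : b * c' = a * c) :
    quotient ha hb hU • homogSec hc U = homogSec hc' U :=
  twistVal_ext fun x hx => (isUnit_algebraMap (hU hx)).mul_left_cancel (by
    rw [twistVal_smul, ← mul_assoc, valHom_quotient, twistVal_homogSec, twistVal_homogSec,
      ← map_mul, ← map_mul, h])

section Map

variable {B τ : Type u} [CommRing B] [SetLike τ B] [AddSubgroupClass τ B] {ℬ : ℕ → τ}
  [GradedRing ℬ] (f : 𝒜 →+*ᵍ ℬ)
  (hf : HomogeneousIdeal.irrelevant ℬ ≤ (HomogeneousIdeal.irrelevant 𝒜).map f)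

/-- The homomorphism of local rings at a point `y` induced by `f`. -/
def localMap (y : ProjectiveSpectrum ℬ) :
    LocalAt 𝒜 (ProjectiveSpectrum.comapFun f hf y) →+* LocalAt ℬ y :=
  Localization.localRingHom _ _ f.toRingHom rfl

theorem localMap_algebraMap (y : ProjectiveSpectrum ℬ) (a : A) :
    localMap f hf y (algebraMap A _ a) = algebraMap B _ (f a) :=
  Localization.localRingHom_to_map _ _ _ rfl a

theorem valHom_app (r : Γ(Proj 𝒜, U)) {y : ProjectiveSpectrum ℬ}
    (hy : y ∈ (Proj.map f hf) ⁻¹ᵁ U) :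
    valHom hy (((Proj.map f hf).app U).hom r) =
      localMap f hf y (valHom (x := ProjectiveSpectrum.comapFun f hf y) hy r) :=
  HomogeneousLocalization.val_localRingHom _

theorem app_quotient {e : ℕ} {a b : A} (ha : a ∈ 𝒜 e) (hb : b ∈ 𝒜 e)
    (hU : U ≤ Proj.basicOpen 𝒜 b)
    (hU' : (Proj.map f hf) ⁻¹ᵁ U ≤ Proj.basicOpen ℬ (f b)) :
    ((Proj.map f hf).app U).hom (quotient ha hb hU) =
      quotient (f.map_mem ha) (f.map_mem hb) hU' :=
  quotient_ext hU' fun y hy => by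
    refine Eq.trans ?_ (valHom_quotient (f.map_mem ha) (f.map_mem hb) hU' hy).symm
    refine Eq.trans ?_ (localMap_algebraMap f hf y a)
    rw [valHom_app, ← localMap_algebraMap f hf y b, ← map_mul]
    exact congrArg (localMap f hf y)
      (valHom_quotient ha hb hU (x := ProjectiveSpectrum.comapFun f hf y) hy)

theorem pmodHomApp_twistingPullback {d : ℕ} {a : A} (ha : a ∈ 𝒜 d) :
    pmodHomApp (Proj.map f hf).c (twistingPullback f hf d) (op U) (homogSec ha U) =
      homogSec (f.map_mem ha) ((Proj.map f hf) ⁻¹ᵁ U) :=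
  twistVal_ext (U := (Proj.map f hf) ⁻¹ᵁ U) fun y _ => localMap_algebraMap f hf y a

end Map

end ProjSections

/-! ### Sections of twisted sheaves -/

section TwistSec

variable {A σ : Type u} [CommRing A] [SetLike σ A] [AddSubgroupClass σ A]
  {𝒜 : ℕ → σ} [GradedRing 𝒜] {U : (Proj 𝒜).Opens} {M : (Proj 𝒜).Modules}

/-- The section `m ⊗ s` of `M(d)`, for sections `m` of `M` and `s` of `O(d)`. -/
def twistSec (M : (Proj 𝒜).Modules) (d : ℕ) (U : (Proj 𝒜).Opens) :
    Sec M U →ₗ[Γ(Proj 𝒜, U)] (twistingSheaf 𝒜 d).obj (op U) →ₗ[Γ(Proj 𝒜, U)]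
      Sec (twist 𝒜 M d) U :=
  (tensorSec (underlying M) (twistingSheaf 𝒜 d) U).compr₂ (pap (toAssocSheaf _) U)

theorem rs_twistSec {d : ℕ} {V : (Proj 𝒜).Opens} (h : V ≤ U) (m : Sec M U)
    (s : (twistingSheaf 𝒜 d).obj (op U)) :
    rs (underlying (twist 𝒜 M d)) h (twistSec M d U m s) =
      twistSec M d V (rs (underlying M) h m) (rs (twistingSheaf 𝒜 d) h s) :=
  (pap_rs (toAssocSheaf _) h _).symm

theorem IsFrame.twistSec {ι : Type*} [Fintype ι] {s : ι → Sec M U} (hs : IsFrame M s) {d : ℕ}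
    {a : A} (ha : a ∈ 𝒜 d) (hU : U ≤ Proj.basicOpen 𝒜 a) :
    IsFrame (twist 𝒜 M d) (fun j => twistSec M d U (s j) (homogSec ha U)) :=
  (hs.tensorSec (g := homogSec ha U) fun _ h => bijective_smul_homogSec ha (h.trans hU)).assocSheaf

theorem ap_twistMul {e : ℕ} {a : A} (ha : a ∈ 𝒜 e) {d : ℕ} (m : Sec M U)
    (s : (twistingSheaf 𝒜 d).obj (op U)) :
    ap (twistMul 𝒜 M ha d) U (twistSec M d U m s) =
      twistSec M (d + e) U m (pap (twistingMul 𝒜 ha d) U s) := by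
  have h := (PresheafOfModules.sheafificationAdjunction (R := (Proj 𝒜).ringCatSheaf)
    (𝟙 (Proj 𝒜).ringCatSheaf.obj)).unit.naturality
      (PresheafOfModules.Monoidal.tensorHom (𝟙 (underlying M)) (twistingMul 𝒜 ha d))
  exact (congrArg (fun α => pap α U (tensorSec _ _ U m s)) h).symm

theorem pap_twistingMul {e : ℕ} {a : A} (ha : a ∈ 𝒜 e) {d : ℕ} {c : A} (hc : c ∈ 𝒜 d) :
    pap (twistingMul 𝒜 ha d) U (homogSec hc U) = homogSec (SetLike.mul_mem_graded hc ha) U :=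
  twistVal_ext fun _ _ => (map_mul (algebraMap A _) c a).symm

variable {B τ : Type u} [CommRing B] [SetLike τ B] [AddSubgroupClass τ B] {ℬ : ℕ → τ}
  [GradedRing ℬ] (f : 𝒜 →+*ᵍ ℬ)
  (hf : HomogeneousIdeal.irrelevant ℬ ≤ (HomogeneousIdeal.irrelevant 𝒜).map f)

theorem apush_twistPush {N : (Proj ℬ).Modules}
    (φ : M ⟶ (Scheme.Modules.pushforward (Proj.map f hf)).obj N) {d : ℕ} {c : A} (hc : c ∈ 𝒜 d)
    (m : Sec M U) :
    apush (Proj.map f hf) (twistPush f hf φ d) U (twistSec M d U m (homogSec hc U)) =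
      twistSec N d ((Proj.map f hf) ⁻¹ᵁ U) (apush (Proj.map f hf) φ U m)
        (homogSec (f.map_mem hc) _) := by
  refine (apush_assocSheafPush (Proj.map f hf) _ U _).trans ?_
  exact congrArg (twistSec N d ((Proj.map f hf) ⁻¹ᵁ U) (apush (Proj.map f hf) φ U m))
    (pmodHomApp_twistingPullback f hf hc)

end TwistSec

section FormSec

variable {X Y : Scheme.{u}} {k : Type u} [CommRing k] (s : X ⟶ Spec (.of k))

/-- A form over `Γ(X, U)`, as a section of the sheaf of forms. -/
def formSec (q : ℕ) (U : X.Opens) :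
    (exteriorPresheaf (kaehlerPresheaf s) q).obj (op U) →ₗ[Γ(X, U)] Sec (forms s q) U :=
  pap (toAssocSheaf _) U

theorem rs_formSec {q : ℕ} {U V : X.Opens} (h : V ≤ U)
    (ω : (exteriorPresheaf (kaehlerPresheaf s) q).obj (op U)) :
    rs (underlying (forms s q)) h (formSec s q U ω) =
      formSec s q V (rs (exteriorPresheaf (kaehlerPresheaf s) q) h ω) :=
  (pap_rs (toAssocSheaf _) h _).symm

/-- The differential of a function. -/
def dSec {U : X.Opens} (r : Γ(X, U)) : (kaehlerPresheaf s).obj (op U) :=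
  CommRingCat.KaehlerDifferential.d (f := (baseMap s).app (op U)) r

theorem rs_dSec {U V : X.Opens} (h : V ≤ U) (r : Γ(X, U)) :
    rs (kaehlerPresheaf s) h (dSec s r) = dSec s (rr h r) :=
  kaehlerMap_d ((baseMap s).naturality (homOfLE h).op) r

theorem dSec_add {U : X.Opens} (r r' : Γ(X, U)) : dSec s (r + r') = dSec s r + dSec s r' :=
  (CommRingCat.KaehlerDifferential.D ((baseMap s).app (op U))).d_add r r'

theorem dSec_mul {U : X.Opens} (r r' : Γ(X, U)) :
    dSec s (r * r') = r • dSec s r' + r' • dSec s r :=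
  (CommRingCat.KaehlerDifferential.D ((baseMap s).app (op U))).d_mul r r'

theorem dSec_one {U : X.Opens} : dSec s (1 : Γ(X, U)) = 0 := by
  have h := dSec_mul s (1 : Γ(X, U)) 1
  rw [mul_one, one_smul] at h
  exact left_eq_add.1 h

theorem dSec_zero {U : X.Opens} : dSec s (0 : Γ(X, U)) = 0 := by
  have h := dSec_add s (0 : Γ(X, U)) 0
  rw [add_zero] at h
  exact left_eq_add.1 h

theorem IsLocalBasis.formSec {U : X.Opens} {ι : Type*} [Fintype ι] [LinearOrder ι]
    {ω : ι → (kaehlerPresheaf s).obj (op U)} (hω : IsLocalBasis (kaehlerPresheaf s) ω) (q : ℕ)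
    [Fintype (Set.powersetCard ι q)] : IsFrame (forms s q) (fun T : Set.powersetCard ι q =>
      formSec s q U (ElementaryTransformations.wedge (kaehlerPresheaf s) q U
        (ω ∘ Set.powersetCard.ofFinEmbEquiv.symm T))) :=
  (hω.wedge q).assocSheaf

variable {sX : X ⟶ Spec (.of k)} {sY : Y ⟶ Spec (.of k)} (f : Y ⟶ X) (hf : f ≫ sX = sY)

/-- The pullback of differentials on sections. -/
def pullD (U : X.Opens) :
    (kaehlerPresheaf sX).obj (op U) →ₛₗ[(f.app U).hom] (kaehlerPresheaf sY).obj (op (f ⁻¹ᵁ U)) :=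
  pmodHomApp f.c (kaehlerPullback f hf) (op U)

theorem pullD_dSec {U : X.Opens} (r : Γ(X, U)) :
    pullD f hf U (dSec sX r) = dSec sY ((f.app U).hom r) :=
  kaehlerMap_d (baseMap_comp f hf U) r

theorem apush_formsPullback {q : ℕ} {U : X.Opens}
    (ω : Fin q → (kaehlerPresheaf sX).obj (op U)) :
    apush f (formsPullback f hf q) U (formSec sX q U (wedge _ q U ω)) =
      formSec sY q (f ⁻¹ᵁ U) (wedge _ q (f ⁻¹ᵁ U) (fun l => pullD f hf U (ω l))) := by
  refine (apush_assocSheafPush f _ U _).trans ?_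
  exact congrArg (formSec sY q (f ⁻¹ᵁ U)) (exteriorPowerMap_ιMulti _ _ _)

end FormSec

/-! ### Differentials on affine charts -/

section KaehlerBasis

/-- If `C` is a localization of a polynomial ring, its Kähler differentials are free on the
differentials of the variables. -/
theorem bijective_sum_smul_D {k C J : Type*} [CommRing k] [CommRing C] [Algebra k C] [Fintype J]
    (y : J → C) (S : Submonoid (MvPolynomial J k))
    (h : letI := (MvPolynomial.aeval (R := k) y).toRingHom.toAlgebra; IsLocalization S C) :
    Function.Bijective fun c : J → C => ∑ j, c j • KaehlerDifferential.D k C (y j) := by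
  let := (MvPolynomial.aeval (R := k) y).toRingHom.toAlgebra
  have : IsScalarTower k (MvPolynomial J k) C := IsScalarTower.of_algebraMap_eq fun a =>
    ((MvPolynomial.aeval (R := k) y).commutes a).symm
  have : IsLocalization S C := h
  refine bijective_sum_smul_iff.2 ⟨(KaehlerDifferential.mvPolynomialBasis k J).ofIsLocalizedModule C S
    (KaehlerDifferential.map k k (MvPolynomial J k) C), fun j => ?_⟩
  rw [Module.Basis.ofIsLocalizedModule_apply, KaehlerDifferential.mvPolynomialBasis_apply,
    KaehlerDifferential.map_D]
  exact congrArg _ (MvPolynomial.aeval_X y j)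

variable {X : Scheme.{u}} {k : Type u} [CommRing k] (s : X ⟶ Spec (.of k))

/-- On an affine open set with coordinate functions `y`, the differentials `dy` are a local
basis of the Kähler differentials. -/
theorem isLocalBasis_dSec {U : X.Opens} (hU : IsAffineOpen U) {J : Type} [Fintype J]
    (y : J → Γ(X, U))
    (hy : Function.Bijective (MvPolynomial.eval₂Hom ((baseMap s).app (op U)).hom y)) :
    IsLocalBasis (kaehlerPresheaf s) (fun j => dSec s (y j)) := by
  intro V hV x hx
  obtain ⟨f, hfV, hxf⟩ := hU.exists_basicOpen_le (⟨x, hx⟩ : V) (hV hx)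
  have hW : X.basicOpen f ≤ U := X.basicOpen_le f
  refine ⟨X.basicOpen f, hW, hfV, hxf, ?_⟩
  simp only [rs_dSec]
  let e : MvPolynomial J k ≃+* Γ(X, U) := RingEquiv.ofBijective _ hy
  let : Algebra k Γ(X, X.basicOpen f) := ((baseMap s).app (op (X.basicOpen f))).hom.toAlgebra
  refine bijective_sum_smul_D (k := k) (C := Γ(X, X.basicOpen f)) (fun j => rr hW (y j))
    ((Submonoid.powers f).map e.symm) ?_
  have h1 := hU.isLocalization_basicOpen f
  have h2 := IsLocalization.isLocalization_of_base_ringEquiv (Submonoid.powers f)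
    Γ(X, X.basicOpen f) e.symm
  convert h2 using 1
  refine Algebra.algebra_ext _ _ fun p => ?_
  change MvPolynomial.aeval (R := k) (fun j => rr hW (y j)) p = rr hW (e p)
  change _ = (rr hW).comp (MvPolynomial.eval₂Hom ((baseMap s).app (op U)).hom y) p
  rw [MvPolynomial.aeval_def, ← MvPolynomial.coe_eval₂Hom]
  congr 1
  refine MvPolynomial.ringHom_ext (fun a => ?_) fun j => ?_
  · rw [MvPolynomial.eval₂Hom_C, RingHom.comp_apply, MvPolynomial.eval₂Hom_C]
    exact congr($((baseMap s).naturality (homOfLE hW).op) a)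
  · rw [MvPolynomial.eval₂Hom_X', RingHom.comp_apply, MvPolynomial.eval₂Hom_X']

end KaehlerBasis

/-! ### The standard charts of projective space -/

section BaseMap

/-- The structure map `k → Γ(X, U)` can be read off from any factorization of `U ⟶ Spec k` through the
affinization of `U`. -/
theorem baseMap_eq {X : Scheme.{u}} {k : Type u} [CommRing k] (s : X ⟶ Spec (.of k)) {U : X.Opens}
    (φ : CommRingCat.of k ⟶ Γ(X, U)) (h : U.ι ≫ s = U.toSpecΓ ≫ Spec.map φ) :
    (baseMap s).app (op U) = φ := by
  have h1 := congrArg (fun f => f.appTop) h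
  simp only [Scheme.Hom.comp_appTop, Scheme.Opens.toSpecΓ_appTop] at h1
  rw [← Category.assoc, Scheme.ΓSpecIso_naturality] at h1
  have h2 := congrArg (fun f => (Scheme.ΓSpecIso (.of k)).inv ≫ f ≫ U.topIso.hom) h1
  simp only [Category.assoc, Iso.inv_hom_id, Iso.inv_hom_id_assoc, Category.comp_id] at h2
  rw [← h2, baseMap]
  refine congrArg (fun f => _ ≫ s.appTop ≫ f) ?_
  rw [Scheme.Opens.ι_appTop, Scheme.Opens.topIso_hom]
  exact X.presheaf.map_comp _ _

end BaseMap

section Homogeneous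

/-- Two homomorphisms that differ by the factor `u` on the variables differ by `u ^ d` on homogeneous
polynomials of degree `d`. -/
theorem isHomogeneous_map_eq_pow_mul {σ k L : Type*} [CommRing k] [CommRing L]
    {d : ℕ} {a : MvPolynomial σ k} (ha : a.IsHomogeneous d) (φ ψ : MvPolynomial σ k →+* L) (u : L)
    (hC : ∀ c, φ (MvPolynomial.C c) = ψ (MvPolynomial.C c))
    (hX : ∀ j, φ (MvPolynomial.X j) = u * ψ (MvPolynomial.X j)) : φ a = u ^ d * ψ a := by
  rw [a.as_sum, map_sum, map_sum, Finset.mul_sum]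
  refine Finset.sum_congr rfl fun m hm => ?_
  have hd : m.degree = d := by
    rw [← ha (MvPolynomial.mem_support_iff.1 hm), Finsupp.degree_eq_weight_one]
    rfl
  rw [MvPolynomial.monomial_eq, map_mul, map_mul, hC, Finsupp.prod, map_prod, map_prod]
  simp only [map_pow, hX, mul_pow, Finset.prod_mul_distrib, Finset.prod_pow_eq_pow_sum]
  rw [← hd, Finsupp.degree_apply]
  ring

end Homogeneous

section Chart

variable (k : Type u) [Field k] (n : ℕ)

theorem baseMap_toSpec {d : ℕ} {f : MvPolynomial (Fin (n + 1)) k} (hf : f ∈ grading k n d)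
    (hd : 0 < d) :
    (baseMap (ProjectiveSpace.toSpec k n)).app (op (Proj.basicOpen (grading k n) f)) =
      CommRingCat.ofHom (algebraMap k (grading k n 0)) ≫
        CommRingCat.ofHom (HomogeneousLocalization.fromZeroRingHom (grading k n) _) ≫
          Proj.awayToSection (grading k n) f := by
  refine baseMap_eq _ _ ?_
  rw [Spec.map_comp, Spec.map_comp, ← Proj.awayι_toSpecZero (grading k n) f hf hd,
    ProjectiveSpace.toSpec, ← Proj.basicOpenIsoSpec_inv_ι]
  have h : (Proj.basicOpen (grading k n) f).toSpecΓ ≫ Spec.map (Proj.awayToSection (grading k n) f) =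
    (Proj.basicOpenIsoSpec (grading k n) f hf hd).hom := rfl
  rw [Category.assoc, Category.assoc, reassoc_of% h, Category.assoc, Iso.hom_inv_id_assoc]

variable {k n}

theorem X_mem (j : Fin (n + 1)) : (MvPolynomial.X j : MvPolynomial (Fin (n + 1)) k) ∈ grading k n 1 :=
  MvPolynomial.isHomogeneous_X _ _

variable (k n)

/-- The open set on which the coordinate `xᵢ` does not vanish. -/
abbrev chart (i : Fin (n + 1)) : (ProjectiveSpace k n).Opens :=
  Proj.basicOpen (grading k n) (MvPolynomial.X i)

variable {k n} (i : Fin (n + 1))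

/-- The affine coordinate `xⱼ / xᵢ`. -/
def coord {U : (ProjectiveSpace k n).Opens} (hU : U ≤ chart k n i) (j : Fin (n + 1)) :
    Γ(ProjectiveSpace k n, U) :=
  quotient (X_mem j) (X_mem i) hU

/-- The homomorphism `k[yⱼ : j ≠ i] → (k[x]_{xᵢ})₀`, `yⱼ ↦ xⱼ / xᵢ`. -/
def polyToAway : MvPolynomial (Fin n) k →+*
    HomogeneousLocalization.Away (grading k n) (MvPolynomial.X i) :=
  MvPolynomial.eval₂Hom ((HomogeneousLocalization.fromZeroRingHom (grading k n) _).comp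
    (algebraMap k (grading k n 0))) fun j => HomogeneousLocalization.Away.mk (grading k n)
      (X_mem i) 1 (MvPolynomial.X (i.succAbove j)) (X_mem _)

/-- The dehomogenization `k[x] → k[yⱼ : j ≠ i]`, `xᵢ ↦ 1`. -/
def dehomogenize : MvPolynomial (Fin (n + 1)) k →+* MvPolynomial (Fin n) k :=
  (MvPolynomial.aeval (R := k) (i.insertNth (α := fun _ => MvPolynomial (Fin n) k) 1
    MvPolynomial.X)).toRingHom

theorem dehomogenize_C (c : k) : dehomogenize i (MvPolynomial.C c) = MvPolynomial.C c :=
  MvPolynomial.aeval_C _ c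

theorem dehomogenize_X_self : dehomogenize (k := k) i (MvPolynomial.X i) = 1 :=
  (MvPolynomial.aeval_X _ _).trans (Fin.insertNth_apply_same _ _ _)

theorem dehomogenize_X (j : Fin n) :
    dehomogenize (k := k) i (MvPolynomial.X (i.succAbove j)) = MvPolynomial.X j :=
  (MvPolynomial.aeval_X _ _).trans (Fin.insertNth_apply_succAbove _ _ _ _)

variable (k) in
/-- The homomorphism from `k[x]` to its localization at `xᵢ`. -/
def toLocal : MvPolynomial (Fin (n + 1)) k →+*
    Localization.Away (MvPolynomial.X i : MvPolynomial (Fin (n + 1)) k) :=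
  algebraMap _ _

/-- The value of a homogeneous fraction with denominator a power of `xᵢ`. -/
def awayVal : HomogeneousLocalization.Away (grading k n) (MvPolynomial.X i) →+*
    Localization.Away (MvPolynomial.X i : MvPolynomial (Fin (n + 1)) k) :=
  algebraMap _ _

theorem awayVal_injective : Function.Injective (awayVal (k := k) i) :=
  HomogeneousLocalization.val_injective _

theorem awayVal_mk (d : ℕ) {a : MvPolynomial (Fin (n + 1)) k} (ha : a ∈ grading k n (d • 1)) :
    toLocal k i (MvPolynomial.X i) ^ d *
      awayVal i (HomogeneousLocalization.Away.mk _ (X_mem i) d a ha) = toLocal k i a := by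
  rw [← map_pow]
  change algebraMap _ _ _ * Localization.mk a _ = _
  rw [Localization.mk_eq_mk']
  exact IsLocalization.mk'_spec' (M := Submonoid.powers _) _ a ⟨_, ⟨d, rfl⟩⟩

theorem awayVal_C (c : k) : awayVal i (polyToAway i (MvPolynomial.C c)) =
    toLocal k i (MvPolynomial.C c) := by
  rw [polyToAway, MvPolynomial.eval₂Hom_C]
  exact Localization.mk_one_eq_algebraMap _

theorem awayVal_X (j : Fin n) :
    toLocal k i (MvPolynomial.X i) * awayVal i (polyToAway i (MvPolynomial.X j)) =
      toLocal k i (MvPolynomial.X (i.succAbove j)) := by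
  rw [polyToAway, MvPolynomial.eval₂Hom_X']
  have h := awayVal_mk (k := k) i 1 (X_mem (i.succAbove j))
  rwa [pow_one] at h

theorem polyToAway_bijective : Function.Bijective (polyToAway (k := k) i) := by
  have hu : IsUnit (toLocal k i (MvPolynomial.X i)) := IsLocalization.Away.algebraMap_isUnit _
  constructor
  · have h1 : IsUnit (dehomogenize (k := k) i (MvPolynomial.X i)) := by
      rw [dehomogenize_X_self]; exact isUnit_one
    -- Setting `xᵢ = 1` extends to the localization and gives a left inverse.
    let ρ := IsLocalization.Away.lift
      (S := Localization.Away (MvPolynomial.X i : MvPolynomial (Fin (n + 1)) k)) (MvPolynomial.X i) h1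
    have hρ : ∀ a, ρ (toLocal k i a) = dehomogenize i a := fun a =>
      IsLocalization.Away.lift_eq _ h1 a
    have h2 : (ρ.comp (awayVal i)).comp (polyToAway i) = RingHom.id _ := by
      refine MvPolynomial.ringHom_ext (fun c => ?_) fun j => ?_
      · simp only [RingHom.comp_apply, awayVal_C, hρ, dehomogenize_C, RingHom.id_apply]
      · have h3 := congrArg ρ (awayVal_X (k := k) i j)
        rw [map_mul, hρ, hρ, dehomogenize_X_self, one_mul, dehomogenize_X] at h3
        exact h3
    exact Function.LeftInverse.injective (g := ρ.comp (awayVal i)) fun p => congr($h2 p)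
  · intro z
    obtain ⟨d, a, ha, rfl⟩ := HomogeneousLocalization.Away.mk_surjective _ (X_mem i) z
    -- The fraction `a / xᵢᵈ` is the image of `a` with `xᵢ` set to `1`.
    refine ⟨dehomogenize i a, awayVal_injective i ((hu.pow d).mul_left_cancel ?_)⟩
    rw [awayVal_mk]
    have ha' : a.IsHomogeneous d := by simpa using ha
    refine (isHomogeneous_map_eq_pow_mul ha' (toLocal k i)
      (((awayVal i).comp (polyToAway i)).comp (dehomogenize i)) _ (fun c => ?_) fun j => ?_).symm
    · simp only [RingHom.comp_apply, dehomogenize_C, awayVal_C]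
    · obtain rfl | ⟨j, rfl⟩ := Fin.eq_self_or_eq_succAbove i j
      · simp only [RingHom.comp_apply, dehomogenize_X_self, map_one, mul_one]
      · simp only [RingHom.comp_apply, dehomogenize_X, awayVal_X]

theorem awayToSection_mk (d : ℕ) {a : MvPolynomial (Fin (n + 1)) k} (ha : a ∈ grading k n (d • 1))
    {x : ProjectiveSpectrum (grading k n)} (hx : x ∈ chart k n i) :
    algebraMap (MvPolynomial (Fin (n + 1)) k) (LocalAt (grading k n) x) (MvPolynomial.X i) ^ d *
      valHom hx ((Proj.awayToSection (grading k n) (MvPolynomial.X i)).hom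
        (HomogeneousLocalization.Away.mk _ (X_mem i) d a ha)) = algebraMap _ _ a := by
  rw [← map_pow]
  exact algebraMap_mul_mk _ a _ _

/-- The functions on the chart `xᵢ ≠ 0` are the polynomials in the `xⱼ / xᵢ`. -/
theorem chart_bijective : Function.Bijective
    (MvPolynomial.eval₂Hom ((baseMap (ProjectiveSpace.toSpec k n)).app (op (chart k n i))).hom
      (fun j => coord i le_rfl (i.succAbove j))) := by
  have h : MvPolynomial.eval₂Hom
      ((baseMap (ProjectiveSpace.toSpec k n)).app (op (chart k n i))).hom
      (fun j => coord i le_rfl (i.succAbove j)) =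
      (Proj.awayToSection (grading k n) (MvPolynomial.X i)).hom.comp (polyToAway i) := by
    refine MvPolynomial.ringHom_ext (fun c => ?_) fun j => ?_
    · rw [MvPolynomial.eval₂Hom_C, RingHom.comp_apply, polyToAway, MvPolynomial.eval₂Hom_C,
        baseMap_toSpec k n (X_mem i) one_pos]
      rfl
    · rw [MvPolynomial.eval₂Hom_X', RingHom.comp_apply, polyToAway, MvPolynomial.eval₂Hom_X']
      refine quotient_ext le_rfl fun x hx => ?_
      have h := awayToSection_mk (k := k) i 1 (X_mem (i.succAbove j)) hx
      rw [pow_one] at h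
      rw [h]
      exact valHom_quotient _ _ _ hx
  rw [h]
  have h2 : Function.Bijective (Proj.awayToSection (grading k n) (MvPolynomial.X i)).hom :=
    (Proj.basicOpenIsoAway (grading k n) _ (X_mem i) one_pos).commRingCatIsoToRingEquiv.bijective
  exact h2.comp (polyToAway_bijective i)

theorem isAffineOpen_chart : IsAffineOpen (chart k n i) :=
  Proj.isAffineOpen_basicOpen _ _ (X_mem i) one_pos

end Chart

/-! ### The hyperplane at the last coordinate -/

section ProjSections

variable {A σ : Type u} [CommRing A] [SetLike σ A] [AddSubgroupClass σ A]
  {𝒜 : ℕ → σ} [GradedRing 𝒜] {U : (Proj 𝒜).Opens}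
  {B τ : Type u} [CommRing B] [SetLike τ B] [AddSubgroupClass τ B] {ℬ : ℕ → τ}
  [GradedRing ℬ] (f : 𝒜 →+*ᵍ ℬ)
  (hf : HomogeneousIdeal.irrelevant ℬ ≤ (HomogeneousIdeal.irrelevant 𝒜).map f)

theorem quotient_congr {e : ℕ} {a b a' b' : A} (ha : a ∈ 𝒜 e) (hb : b ∈ 𝒜 e)
    (hU : U ≤ Proj.basicOpen 𝒜 b) (ha' : a' ∈ 𝒜 e) (hb' : b' ∈ 𝒜 e)
    (hU' : U ≤ Proj.basicOpen 𝒜 b') (h : a = a') (h' : b = b') :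
    quotient ha hb hU = quotient ha' hb' hU' := by
  subst h h'
  rfl

theorem quotient_eq_zero {e : ℕ} {a b : A} (ha : a ∈ 𝒜 e) (hb : b ∈ 𝒜 e)
    (hU : U ≤ Proj.basicOpen 𝒜 b) (h : a = 0) : quotient ha hb hU = 0 :=
  quotient_ext hU fun x hx => by rw [valHom_quotient, h, map_zero, map_zero, mul_zero]

theorem algebraMap_mul_valHom_app {r : Γ(Proj 𝒜, U)} {y : ProjectiveSpectrum ℬ}
    (hy : y ∈ (Proj.map f hf) ⁻¹ᵁ U) {a b : A}
    (h : algebraMap A (LocalAt 𝒜 (ProjectiveSpectrum.comapFun f hf y)) b *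
      valHom (x := ProjectiveSpectrum.comapFun f hf y) hy r = algebraMap A _ a) :
    algebraMap B (LocalAt ℬ y) (f b) * valHom hy (((Proj.map f hf).app U).hom r) =
      algebraMap B _ (f a) := by
  rw [valHom_app, ← localMap_algebraMap f hf, ← localMap_algebraMap f hf, ← map_mul]
  exact congrArg _ h

end ProjSections

section Hyperplane

variable {k : Type u} [Field k] {n : ℕ}

/-- The coordinates generate the irrelevant ideal, so they do not all vanish at a point. -/
theorem exists_mem_chart (x : ProjectiveSpace k n) : ∃ i, x ∈ chart k n i := by
  by_contra! h
  refine ProjectiveSpectrum.not_irrelevant_le (𝒜 := grading k n) x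
    ((HomogeneousIdeal.irrelevant_le _).2 fun d hd q hq => ?_)
  have h1 : Ideal.span (MvPolynomial.X '' Set.univ) ≤
      (ProjectiveSpectrum.asHomogeneousIdeal (𝒜 := grading k n) x).toIdeal := by
    rw [Ideal.span_le]
    rintro _ ⟨i, -, rfl⟩
    exact not_not.1 (h i)
  refine h1 (MvPolynomial.mem_ideal_span_X_image.2 fun m hm => ?_)
  by_contra! h2
  have h3 : m = 0 := Finsupp.ext fun i => h2 i trivial
  have h4 := hq (MvPolynomial.mem_support_iff.1 hm)
  rw [h3, map_zero] at h4
  exact hd.ne h4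

theorem coord_self {i : Fin (n + 1)} {U : (ProjectiveSpace k n).Opens} (hU : U ≤ chart k n i) :
    coord i hU i = 1 := quotient_self _ _

theorem rr_coord {i : Fin (n + 1)} {U V : (ProjectiveSpace k n).Opens} (hU : U ≤ chart k n i)
    (h : V ≤ U) (j : Fin (n + 1)) : rr h (coord i hU j) = coord i (h.trans hU) j :=
  rr_quotient _ _ hU h

theorem coord_mul_coord {i l : Fin (n + 1)} {U : (ProjectiveSpace k n).Opens}
    (hU : U ≤ chart k n i) (hU' : U ≤ chart k n l) (j : Fin (n + 1)) :
    coord l hU' i * coord i hU j = coord l hU' j := quotient_mul_quotient _ _ _ hU hU'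

theorem valHom_coord {i : Fin (n + 1)} {U : (ProjectiveSpace k n).Opens} (hU : U ≤ chart k n i)
    (j : Fin (n + 1)) {x : ProjectiveSpectrum (grading k n)} (hx : x ∈ U) :
    algebraMap (MvPolynomial (Fin (n + 1)) k) (LocalAt (grading k n) x) (MvPolynomial.X i) *
      valHom hx (coord i hU j) =
    algebraMap (MvPolynomial (Fin (n + 1)) k) (LocalAt (grading k n) x) (MvPolynomial.X j) :=
  valHom_quotient _ _ hU hx

theorem localAt_injective (x : ProjectiveSpectrum (grading k n)) :
    Function.Injective (algebraMap (MvPolynomial (Fin (n + 1)) k) (LocalAt (grading k n) x)) :=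
  IsLocalization.injective _ (Ideal.primeCompl_le_nonZeroDivisors x.asHomogeneousIdeal.toIdeal)

theorem coord_mul_eq_zero {i : Fin (n + 1)} {U : (ProjectiveSpace k n).Opens}
    (hU : U ≤ chart k n i) (j : Fin (n + 1)) {c : Γ(ProjectiveSpace k n, U)}
    (hc : coord i hU j * c = 0) : c = 0 := by
  refine valHom_ext fun x hx => ?_
  have h := congrArg (fun c => algebraMap (MvPolynomial (Fin (n + 1)) k) (LocalAt (grading k n) x)
    (MvPolynomial.X i) * valHom hx c) hc
  simp only [map_mul, map_zero, mul_zero, ← mul_assoc, valHom_coord] at h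
  rw [map_zero]
  refine (mul_eq_zero.1 h).resolve_left fun h0 => ?_
  exact MvPolynomial.X_ne_zero j (localAt_injective x (h0.trans (map_zero _).symm))

variable (k n) in
/-- The section `k[x₀, …, xₙ] → k[x₀, …, xₙ₊₁]` of `killLast`. -/
def renameCast : grading k n →+*ᵍ grading k (n + 1) where
  toRingHom := (MvPolynomial.rename (R := k) Fin.castSucc).toRingHom
  map_mem hp := MvPolynomial.IsHomogeneous.rename_isHomogeneous hp

theorem killLast_X_castSucc (j : Fin (n + 1)) :
    killLast k n (MvPolynomial.X j.castSucc) = MvPolynomial.X j :=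
  (MvPolynomial.aeval_X _ _).trans (Fin.snoc_castSucc _ _ _)

theorem killLast_X_last : killLast k n (MvPolynomial.X (Fin.last (n + 1))) = 0 :=
  (MvPolynomial.aeval_X _ _).trans (Fin.snoc_last _ _)

theorem killLast_C (c : k) : killLast k n (MvPolynomial.C c) = MvPolynomial.C c :=
  MvPolynomial.aeval_C _ c

theorem renameCast_X (j : Fin (n + 1)) :
    renameCast k n (MvPolynomial.X j) = MvPolynomial.X j.castSucc := MvPolynomial.rename_X _ _

theorem renameCast_C (c : k) : renameCast k n (MvPolynomial.C c) = MvPolynomial.C c :=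
  MvPolynomial.rename_C _ _

theorem killLast_renameCast (p : MvPolynomial (Fin (n + 1)) k) :
    killLast k n (renameCast k n p) = p := by
  have h : (killLast k n).toRingHom.comp (renameCast k n).toRingHom = RingHom.id _ :=
    MvPolynomial.ringHom_ext
      (fun c => (congrArg (killLast k n) (renameCast_C c)).trans (killLast_C c))
      (fun j => (congrArg (killLast k n) (renameCast_X j)).trans (killLast_X_castSucc j))
  exact congr($h p)

/-- Setting `xₙ₊₁ = 0` changes a polynomial by a multiple of `xₙ₊₁`. -/
theorem X_last_dvd (a : MvPolynomial (Fin (n + 1 + 1)) k) :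
    MvPolynomial.X (Fin.last (n + 1)) ∣ a - renameCast k n (killLast k n a) := by
  rw [← Ideal.mem_span_singleton, ← Ideal.Quotient.mk_eq_mk_iff_sub_mem]
  let π := Ideal.Quotient.mk (Ideal.span {(MvPolynomial.X (Fin.last (n + 1)) :
    MvPolynomial (Fin (n + 1 + 1)) k)})
  have h : π = π.comp ((renameCast k n).toRingHom.comp (killLast k n).toRingHom) := by
    refine MvPolynomial.ringHom_ext (fun c => ?_) fun j => ?_
    · exact congrArg π (((congrArg (renameCast k n) (killLast_C c)).trans (renameCast_C c)).symm)
    · refine Fin.lastCases ?_ (fun j => ?_) j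
      · refine Eq.trans ?_ (congrArg π ((congrArg (renameCast k n) killLast_X_last).trans
          (map_zero (renameCast k n)))).symm
        rw [map_zero]
        exact Ideal.Quotient.eq_zero_iff_mem.2 (Ideal.mem_span_singleton_self _)
      · exact congrArg π (((congrArg (renameCast k n) (killLast_X_castSucc j)).trans
          (renameCast_X j)).symm)
  exact congr($h a)

/-- The quotient of a homogeneous polynomial by a variable is homogeneous. The zero polynomial is
excepted, as it is homogeneous of every degree, including degree `0`. -/
theorem isHomogeneous_of_X_mul {σ : Type*} {j : σ} {e : ℕ} {a : MvPolynomial σ k}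
    (h : (MvPolynomial.X j * a).IsHomogeneous e) :
    a = 0 ∨ ∃ e', e = e' + 1 ∧ a.IsHomogeneous e' := by
  have key : ∀ m, MvPolynomial.coeff m a ≠ 0 → Finsupp.weight 1 m + 1 = e := fun m hm => by
    have h1 : MvPolynomial.coeff (Finsupp.single j 1 + m) (MvPolynomial.X j * a) ≠ 0 := by
      rwa [MvPolynomial.coeff_X_mul]
    have h2 := h h1
    rw [map_add, Finsupp.weight_single] at h2
    rw [← h2, add_comm]
    rfl
  by_cases ha : a = 0
  · exact Or.inl ha
  obtain ⟨m, hm⟩ := MvPolynomial.ne_zero_iff.1 ha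
  exact Or.inr ⟨Finsupp.weight 1 m, (key m hm).symm, fun m' hm' =>
    Nat.succ_injective ((key m' hm').trans (key m hm).symm)⟩

theorem mem_of_killLast_mem {I : Ideal (MvPolynomial (Fin (n + 1 + 1)) k)}
    (hI : MvPolynomial.X (Fin.last (n + 1)) ∈ I) (a : MvPolynomial (Fin (n + 1 + 1)) k) :
    renameCast k n (killLast k n a) ∈ I ↔ a ∈ I := by
  have h := Ideal.mem_of_dvd _ (X_last_dvd a) hI
  exact ⟨fun h' => by simpa using I.add_mem h h', fun h' => by simpa using I.sub_mem h' h⟩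

/-- A point at which `xₙ₊₁` vanishes lies on the hyperplane: its ideal is the preimage under
`killLast` of its intersection with `k[x₀, …, xₙ]`. -/
theorem exists_hyperplane_eq {x : ProjectiveSpace k (n + 1)}
    (hx : x ∉ chart k (n + 1) (Fin.last (n + 1))) : ∃ y, hyperplane k n y = x := by
  let x' : ProjectiveSpectrum (grading k (n + 1)) := x
  have hI : MvPolynomial.X (Fin.last (n + 1)) ∈ x'.asHomogeneousIdeal.toIdeal := not_not.1 hx
  let y : ProjectiveSpectrum (grading k n) :=
    { asHomogeneousIdeal := x'.asHomogeneousIdeal.comap (renameCast k n)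
      isPrime := x'.isPrime.comap (renameCast k n)
      not_irrelevant_le := fun h => by
        obtain ⟨i, hi⟩ := exists_mem_chart x
        refine Fin.lastCases hx (fun i hi => hi ?_) i hi
        have h1 : renameCast k n (MvPolynomial.X i) ∈ x'.asHomogeneousIdeal.toIdeal :=
          h (HomogeneousIdeal.mem_irrelevant_of_mem _ one_pos (X_mem i))
        rwa [renameCast_X] at h1 }
  refine ⟨y, ProjectiveSpectrum.ext (HomogeneousIdeal.ext (Ideal.ext fun a => ?_))⟩
  exact mem_of_killLast_mem hI a

theorem hyperplane_preimage_chart_last :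
    hyperplane k n ⁻¹ᵁ chart k (n + 1) (Fin.last (n + 1)) = ⊥ := by
  refine (Proj.map_preimage_basicOpen (killLast k n) (killLast_irrelevant k n) _).trans ?_
  rw [killLast_X_last]
  exact ProjectiveSpectrum.basicOpen_zero _

theorem hyperplane_preimage_chart (i : Fin (n + 1)) :
    hyperplane k n ⁻¹ᵁ chart k (n + 1) i.castSucc = chart k n i := by
  refine (Proj.map_preimage_basicOpen (killLast k n) (killLast_irrelevant k n) _).trans ?_
  rw [killLast_X_castSucc]

theorem hyperplane_preimage_le_chart {i : Fin (n + 1)} {U : (ProjectiveSpace k (n + 1)).Opens}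
    (hU : U ≤ chart k (n + 1) i.castSucc) : hyperplane k n ⁻¹ᵁ U ≤ chart k n i :=
  (preimage_mono (hyperplane k n) hU).trans (hyperplane_preimage_chart i).le

theorem app_coord_castSucc {i : Fin (n + 1)} {U : (ProjectiveSpace k (n + 1)).Opens}
    (hU : U ≤ chart k (n + 1) i.castSucc) (j : Fin (n + 1)) :
    ((hyperplane k n).app U).hom (coord i.castSucc hU j.castSucc) =
      coord i (hyperplane_preimage_le_chart hU) j := by
  have hU' := hyperplane_preimage_le_chart hU
  refine (app_quotient (killLast k n) (killLast_irrelevant k n) _ _ hU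
    (by rw [killLast_X_castSucc]; exact hU')).trans ?_
  exact quotient_congr _ _ _ _ _ hU' (killLast_X_castSucc j) (killLast_X_castSucc i)

theorem app_coord_last {i : Fin (n + 1)} {U : (ProjectiveSpace k (n + 1)).Opens}
    (hU : U ≤ chart k (n + 1) i.castSucc) :
    ((hyperplane k n).app U).hom (coord i.castSucc hU (Fin.last (n + 1))) = 0 := by
  have hU' := hyperplane_preimage_le_chart hU
  refine (app_quotient (killLast k n) (killLast_irrelevant k n) _ _ hU
    (by rw [killLast_X_castSucc]; exact hU')).trans ?_
  exact quotient_eq_zero _ _ _ killLast_X_last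

/-- The functions vanishing on the hyperplane are the multiples of `xₙ₊₁ / xᵢ`. -/
theorem exists_eq_coord_mul {i : Fin (n + 1)} {V : (ProjectiveSpace k (n + 1)).Opens}
    (hV : V ≤ chart k (n + 1) i.castSucc) {c : Γ(ProjectiveSpace k (n + 1), V)}
    (hc : ((hyperplane k n).app V).hom c = 0) {x : ProjectiveSpace k (n + 1)} (hx : x ∈ V) :
    ∃ (W : (ProjectiveSpace k (n + 1)).Opens) (h : W ≤ V), x ∈ W ∧
      ∃ d, rr h c = coord i.castSucc (h.trans hV) (Fin.last (n + 1)) * d := by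
  -- Off the hyperplane `xₙ₊₁ / xᵢ` is a unit, with inverse `xᵢ / xₙ₊₁`.
  by_cases hx' : x ∈ chart k (n + 1) (Fin.last (n + 1))
  · refine ⟨V ⊓ chart k (n + 1) (Fin.last (n + 1)), inf_le_left, ⟨hx, hx'⟩,
      coord (Fin.last (n + 1)) inf_le_right i.castSucc * rr inf_le_left c, ?_⟩
    rw [← mul_assoc, coord_mul_coord, coord_self, one_mul]
  obtain ⟨y, rfl⟩ := exists_hyperplane_eq hx'
  -- At a point of the hyperplane `c = a / b` with `a = xₙ₊₁ a'`, so that `d = a' xᵢ / b`.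
  obtain ⟨W, hW, e, a, b, ha, hb, h⟩ := sectionVal_isLocallyQuotient _ c _ hx
  have h1 := algebraMap_mul_valHom_app (killLast k n) (killLast_irrelevant k n) (y := y) hx
    (h _ hx hW).2
  have h0 : valHom (x := y) hx (((hyperplane k n).app V).hom c) = 0 := by
    rw [hc]
    exact map_zero (valHom (x := y) hx)
  have h2 : killLast k n a = 0 := by
    refine localAt_injective y (h1.symm.trans ?_)
    refine Eq.trans (congrArg (_ * ·) h0) ?_
    rw [mul_zero]
    exact (map_zero (algebraMap (MvPolynomial (Fin (n + 1)) k) (LocalAt (grading k n) y))).symm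
  have h3 := X_last_dvd a
  rw [h2, map_zero, sub_zero] at h3
  obtain ⟨a', rfl⟩ := h3
  have hWb : V ⊓ W ≤ Proj.basicOpen (grading k (n + 1)) b := fun z hz => (h z hz.1 hz.2).1
  refine ⟨V ⊓ W, inf_le_left, ⟨hx, hW⟩, ?_⟩
  obtain rfl | ⟨e', rfl, ha'⟩ := isHomogeneous_of_X_mul ha
  · refine ⟨0, quotient_ext hWb fun z hz => ?_⟩
    refine (h z hz.1 hz.2).2.trans ?_
    rw [mul_zero, mul_zero, map_zero, map_zero, mul_zero]
  · have hX : a' * MvPolynomial.X i.castSucc ∈ grading k (n + 1) (e' + 1) :=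
      SetLike.mul_mem_graded ha' (X_mem _)
    refine ⟨quotient hX hb hWb, quotient_ext hWb fun z hz =>
      (isUnit_algebraMap (hV hz.1)).mul_left_cancel ?_⟩
    have h4 : algebraMap (MvPolynomial (Fin (n + 1 + 1)) k) (LocalAt (grading k (n + 1)) z) b *
      valHom hz (rr (inf_le_left : V ⊓ W ≤ V) c) = _ := (h z hz.1 hz.2).2
    have h5 := valHom_coord (inf_le_left.trans hV) (Fin.last (n + 1)) hz
    have h6 := valHom_quotient hX hb hWb hz
    rw [map_mul] at h4 h6
    rw [map_mul]
    linear_combination (algebraMap (MvPolynomial (Fin (n + 1 + 1)) k)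
      (LocalAt (grading k (n + 1)) z) (MvPolynomial.X i.castSucc)) * h4 -
      (algebraMap (MvPolynomial (Fin (n + 1 + 1)) k) (LocalAt (grading k (n + 1)) z) b *
        valHom hz (quotient hX hb hWb)) * h5 -
      (algebraMap (MvPolynomial (Fin (n + 1 + 1)) k) (LocalAt (grading k (n + 1)) z)
        (MvPolynomial.X (Fin.last (n + 1)))) * h6

theorem exists_hyperplane_preimage_eq (W : (ProjectiveSpace k n).Opens) :
    ∃ U, hyperplane k n ⁻¹ᵁ U = W := by
  obtain ⟨s, hs⟩ := (ProjectiveSpectrum.isOpen_iff (grading k n) _).1 W.2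
  refine ⟨⟨(ProjectiveSpectrum.zeroLocus (grading k (n + 1)) (renameCast k n '' s))ᶜ,
    (ProjectiveSpectrum.isClosed_zeroLocus _ _).isOpen_compl⟩, Opens.ext ?_⟩
  rw [← compl_compl (W : Set (ProjectiveSpace k n))]
  refine congrArg compl (Eq.trans (Set.ext fun y => ?_) hs.symm)
  refine Set.image_subset_iff.trans (forall₂_congr fun a _ => ?_)
  change killLast k n (renameCast k n a) ∈
    ProjectiveSpectrum.asHomogeneousIdeal (𝒜 := grading k n) y ↔ _
  rw [killLast_renameCast]
  rfl

theorem hyperplane_surjectiveOnFunctions : SurjectiveOnFunctions (hyperplane k n) where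
  exists_preimage := exists_hyperplane_preimage_eq
  exists_app U r x hx := by
    -- Off the hyperplane the inverse image is empty; on it, `r = a / b` lifts to a quotient of
    -- polynomials that do not involve `xₙ₊₁`.
    by_cases hx' : x ∈ chart k (n + 1) (Fin.last (n + 1))
    · refine ⟨U ⊓ chart k (n + 1) (Fin.last (n + 1)), inf_le_left, ⟨hx, hx'⟩, 0,
        valHom_ext fun y hy => ?_⟩
      have h := hyperplane_preimage_chart_last.le (show y ∈ _ from hy.2)
      exact h.elim
    obtain ⟨y, rfl⟩ := exists_hyperplane_eq hx'
    obtain ⟨W, hW, e, a, b, ha, hb, h⟩ := sectionVal_isLocallyQuotient _ r y hx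
    obtain ⟨U', rfl⟩ := exists_hyperplane_preimage_eq W
    have hxb : hyperplane k n y ∈ Proj.basicOpen (grading k (n + 1)) (renameCast k n b) := by
      change y ∈ Proj.basicOpen (grading k n) (killLast k n (renameCast k n b))
      rw [killLast_renameCast]
      exact (h y hx hW).1
    refine ⟨U ⊓ U' ⊓ Proj.basicOpen (grading k (n + 1)) (renameCast k n b),
      inf_le_left.trans inf_le_left, ⟨⟨hx, hW⟩, hxb⟩, quotient ((renameCast k n).map_mem ha)
        ((renameCast k n).map_mem hb) inf_le_right, ?_⟩
    have hW' : hyperplane k n ⁻¹ᵁ (U ⊓ U' ⊓ Proj.basicOpen (grading k (n + 1)) (renameCast k n b)) ≤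
      Proj.basicOpen (grading k n) b := fun z hz => (h z hz.1.1 hz.1.2).1
    refine quotient_ext hW' fun z hz => ?_
    have h1 := algebraMap_mul_valHom_app (killLast k n) (killLast_irrelevant k n) (y := z) hz
      (valHom_quotient ((renameCast k n).map_mem ha) ((renameCast k n).map_mem hb) inf_le_right hz)
    refine Eq.trans (congrArg (fun b => algebraMap (MvPolynomial (Fin (n + 1)) k)
      (LocalAt (grading k n) z) b * _) (killLast_renameCast b).symm) (h1.trans ?_)
    refine (congrArg _ (killLast_renameCast a)).trans ?_
    exact (h z hz.1.1 hz.1.2).2.symm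

end Hyperplane

/-! ### Frames given by products of vectors -/

section ProductFrames

variable {R S M N E Q W : Type*} [CommRing R] [CommRing S] {σ : R →+* S} [AddCommGroup M] [Module R M]
  [AddCommGroup E] [Module R E] [AddCommGroup Q] [Module S Q] [AddCommGroup W] [Module S W]

theorem eulerForm_cons_one {q : ℕ} (m : Fin q → R × M) :
    eulerForm R M q (Fin.cons (1, 0) m) = exteriorPower.ιMulti R q (fun l => (m l).2) := by
  rw [eulerForm_apply, Fin.sum_univ_succ, Finset.sum_eq_zero fun l _ => ?_]
  · simp
  · cases q with
    | zero => exact l.elim0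
    | succ q =>
      rw [(exteriorPower.ιMulti R (q + 1)).map_coord_zero 0 (by simp), smul_zero, smul_zero]

theorem eulerForm_cons_cons_one {q : ℕ} (x : R × M) (m : Fin q → R × M) :
    eulerForm R M (q + 1) (Fin.cons x (Fin.cons (1, 0) m)) =
      exteriorPower.ιMulti R (q + 1) (Fin.cons (-x.2) fun l => (m l).2) := by
  have h1 : (Fin.cons x (Fin.cons (1, 0) m) : Fin (q + 2) → R × M) =
      (Fin.cons (1, 0) (Fin.cons x m) : Fin (q + 2) → R × M) ∘ Equiv.swap 0 1 := by
    funext l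
    refine Fin.cases ?_ (Fin.cases ?_ fun l => ?_) l
    · rw [Function.comp_apply, Equiv.swap_apply_left]; rfl
    · rw [Function.comp_apply]
      refine Eq.trans ?_ (congrArg _ (Equiv.swap_apply_right 0 1).symm)
      rfl
    · refine Eq.trans ?_ (congrArg (Fin.cons (α := fun _ => R × M) (1, 0) (Fin.cons x m))
        (Equiv.swap_apply_of_ne_of_ne (a := (0 : Fin (q + 2))) (b := 1) (x := l.succ.succ)
          (Fin.succ_ne_zero _) (fun h => Fin.succ_ne_zero l (Fin.succ_injective _ h)))).symm
      rfl
  rw [h1, AlternatingMap.map_swap _ _ (by simp), eulerForm_cons_one]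
  have h2 := (exteriorPower.ιMulti R (q + 1)).map_vecCons_smul (fun l => (m l).2) (-1 : R) x.2
  rw [neg_one_smul, neg_one_smul] at h2
  refine Eq.trans (congrArg _ (congrArg _ (funext fun l => ?_))) h2.symm
  exact Fin.cases rfl (fun l => rfl) l

/-- Alternating maps on `Rᴶ` compared along semilinear maps: it suffices to test on products of
distinct standard basis vectors. -/
theorem alternatingMap_semilinear_ext {J : Type*} [LinearOrder J] [Fintype J] {q : ℕ}
    (Φ : (J → R) [⋀^Fin q]→ₗ[R] E) (φ : E →ₛₗ[σ] Q) (v : J → W) (g : W [⋀^Fin q]→ₗ[S] Q)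
    (h : ∀ T : Set.powersetCard J q,
      φ (Φ ((fun j => Pi.single j 1) ∘ Set.powersetCard.ofFinEmbEquiv.symm T)) =
        g (v ∘ Set.powersetCard.ofFinEmbEquiv.symm T)) (m : Fin q → J → R) :
    φ (Φ m) = g (fun l => ∑ j, σ (m l j) • v j) := by
  let f : (J → R) →ₛₗ[σ] W :=
    { toFun := fun c => ∑ j, σ (c j) • v j
      map_add' := fun c d => by
        simp only [Pi.add_apply, map_add, add_smul, Finset.sum_add_distrib]
      map_smul' := fun c d => by
        simp only [Pi.smul_apply, smul_eq_mul, map_mul, mul_smul, Finset.smul_sum] }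
  have hf : ∀ j, f (Pi.single j 1) = v j := fun j => by
    refine (Finset.sum_eq_single j (fun l _ hl => ?_) (fun h => (h (Finset.mem_univ j)).elim)).trans
      ?_
    · rw [Pi.single_eq_of_ne hl, map_zero, zero_smul]
    · rw [Pi.single_eq_same, map_one, one_smul]
  let φ' : ⋀[R]^q (J → R) →ₛₗ[σ] Q := φ.comp (exteriorPower.alternatingMapLinearEquiv Φ)
  let g' : ⋀[R]^q (J → R) →ₛₗ[σ] Q :=
    (exteriorPower.alternatingMapLinearEquiv g).comp (exteriorPowerMap f q)
  have key : φ' = g' := by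
    refine ((Pi.basisFun R J).exteriorPower q).ext fun T => ?_
    rw [exteriorPower.basis_apply]
    refine (congrArg φ (exteriorPower.alternatingMapLinearEquiv_apply_ιMulti _ _)).trans
      (Eq.trans ?_ (congrArg (exteriorPower.alternatingMapLinearEquiv g)
        (exteriorPowerMap_ιMulti _ _ _)).symm)
    rw [exteriorPower.alternatingMapLinearEquiv_apply_ιMulti]
    refine Eq.trans ?_ ((h T).trans (congrArg g (funext fun l => ?_)))
    · refine congrArg (fun m => φ (Φ m)) (funext fun l => ?_)
      exact Pi.basisFun_apply R J _
    · exact ((congrArg f (Pi.basisFun_apply R J _)).trans (hf _)).symm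
  have h1 := LinearMap.congr_fun key (exteriorPower.ιMulti R q m)
  refine (congrArg φ (exteriorPower.alternatingMapLinearEquiv_apply_ιMulti _ _)).symm.trans
    (h1.trans ?_)
  refine (congrArg (exteriorPower.alternatingMapLinearEquiv g)
        (exteriorPowerMap_ιMulti _ _ _)).trans ?_
  exact exteriorPower.alternatingMapLinearEquiv_apply_ιMulti _ _

theorem span_eq_top_of_single_mem {J : Type*} [Fintype J] [DecidableEq J] {s : Set (J → R)}
    (h : ∀ j, Pi.single j 1 ∈ Submodule.span R s) : Submodule.span R s = ⊤ := by
  refine eq_top_iff.2 ((Pi.basisFun R J).span_eq.ge.trans (Submodule.span_le.2 ?_))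
  rintro _ ⟨j, rfl⟩
  rw [Pi.basisFun_apply]
  exact h j

/-- Let the products of standard basis vectors form a frame, and let `b`, `c` be another basis of the
free module (it is enough that they span). Then the products of the `b j` without and with the factor `c` form a frame. -/
theorem IsFrame.split {X : Scheme.{u}} {U : X.Opens} {M : X.Modules} {n q : ℕ}
    {Φ : (Fin (n + 1) → Γ(X, U)) [⋀^Fin (q + 1)]→ₗ[Γ(X, U)] Sec M U}
    (hΦ : IsFrame M (fun T : Set.powersetCard (Fin (n + 1)) (q + 1) =>
      Φ ((fun j => Pi.single j 1) ∘ Set.powersetCard.ofFinEmbEquiv.symm T)))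
    {b : Fin n → Fin (n + 1) → Γ(X, U)} {c : Fin (n + 1) → Γ(X, U)}
    (h : Submodule.span Γ(X, U) (insert c (Set.range b)) = ⊤) :
    IsFrame M (Sum.elim
      (fun T : Set.powersetCard (Fin n) (q + 1) =>
        Φ (b ∘ Set.powersetCard.ofFinEmbEquiv.symm T))
      (fun T : Set.powersetCard (Fin n) q =>
        Φ (Fin.cons c (b ∘ Set.powersetCard.ofFinEmbEquiv.symm T)))) := by
  refine hΦ.of_span ?_ fun T => ?_
  · have h1 : ∀ n r, Fintype.card (Set.powersetCard (Fin n) r) = n.choose r := fun n r => by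
      rw [← Nat.card_eq_fintype_card, Set.powersetCard.card, Nat.card_eq_fintype_card,
        Fintype.card_fin]
    rw [Fintype.card_sum, h1, h1, h1, Nat.choose_succ_succ', add_comm]
  · let Φ' := exteriorPower.alternatingMapLinearEquiv Φ
    have hΦ' : ∀ m, Φ' (exteriorPower.ιMulti _ _ m) = Φ m :=
      exteriorPower.alternatingMapLinearEquiv_apply_ιMulti Φ
    rw [← hΦ']
    have h2 := Submodule.mem_map_of_mem (f := Φ') ((span_ιMulti_split h q).ge
      (Submodule.mem_top (x := exteriorPower.ιMulti Γ(X, U) (q + 1)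
        ((fun j => Pi.single j 1) ∘ Set.powersetCard.ofFinEmbEquiv.symm T))))
    rw [Submodule.map_span, ← Set.range_comp] at h2
    convert h2 using 3
    funext j
    cases j with
    | inl T => exact (hΦ' _).symm
    | inr T => exact (hΦ' _).symm

theorem IsFrame.sumElim_of_isEmpty {X : Scheme.{u}} {U : X.Opens} {M : X.Modules} {I J : Type*}
    [Fintype I] [Fintype J] [IsEmpty J] {s : I → Sec M U} (hs : IsFrame M s) (s' : J → Sec M U) :
    IsFrame M (Sum.elim s s') := by
  convert hs.comp_equiv (Equiv.sumEmpty I J) using 1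
  funext j
  cases j with
  | inl j => rfl
  | inr j => exact isEmptyElim j

end ProductFrames

/-! ### Twisted forms on the standard charts -/

section TwistedForms

variable {k : Type u} [Field k] {n : ℕ}

theorem X_pow_mem (d : ℕ) (i : Fin (n + 1)) :
    (MvPolynomial.X i ^ d : MvPolynomial (Fin (n + 1)) k) ∈ grading k n d :=
  MvPolynomial.isHomogeneous_X_pow i d

theorem chart_le_basicOpen_pow (d : ℕ) (i : Fin (n + 1)) :
    chart k n i ≤ Proj.basicOpen (grading k n) (MvPolynomial.X i ^ d) :=
  fun x hx h => hx (Ideal.IsPrime.mem_of_pow_mem (ProjectiveSpectrum.isPrime (𝒜 := grading k n) x) d h)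

/-- The twisted form `ω ⊗ xᵢᵈ`. -/
def twForm (q d : ℕ) (i : Fin (n + 1)) (U : (ProjectiveSpace k n).Opens) :
    (exteriorPresheaf (kaehlerPresheaf (ProjectiveSpace.toSpec k n)) q).obj (op U)
      →ₗ[Γ(ProjectiveSpace k n, U)] Sec (twistedForms k n q d) U :=
  ((twistSec (forms (ProjectiveSpace.toSpec k n) q) d U).flip (homogSec (X_pow_mem d i) U)).comp
    (formSec (ProjectiveSpace.toSpec k n) q U)

theorem rs_twForm {q d : ℕ} (i : Fin (n + 1)) {U V : (ProjectiveSpace k n).Opens} (h : V ≤ U)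
    (ω : (exteriorPresheaf (kaehlerPresheaf (ProjectiveSpace.toSpec k n)) q).obj (op U)) :
    rs (underlying (twistedForms k n q d)) h (twForm q d i U ω) =
      twForm q d i V (rs (exteriorPresheaf _ q) h ω) := by
  refine (rs_twistSec h _ _).trans ?_
  rw [rs_formSec, rs_homogSec]
  rfl

theorem twForm_eq_smul {q d : ℕ} {i l : Fin (n + 1)} {U : (ProjectiveSpace k n).Opens}
    (hU : U ≤ chart k n l)
    (ω : (exteriorPresheaf (kaehlerPresheaf (ProjectiveSpace.toSpec k n)) q).obj (op U)) :
    twForm q d i U ω = coord l hU i ^ d • twForm q d l U ω := by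
  have h : coord l hU i ^ d • homogSec (𝒜 := grading k n) (X_pow_mem d l) U =
      homogSec (X_pow_mem d i) U := twistVal_ext fun x hx => by
    rw [twistVal_smul, twistVal_homogSec, twistVal_homogSec, map_pow, map_pow, map_pow, ← mul_pow,
      mul_comm, valHom_coord]
  refine (congrArg (twistSec _ d U (formSec _ q U ω)) h.symm).trans ?_
  exact map_smul _ _ _

theorem ap_mulLast {q d : ℕ} {i : Fin (n + 1)} {U : (ProjectiveSpace k n).Opens}
    (hU : U ≤ chart k n i)
    (ω : (exteriorPresheaf (kaehlerPresheaf (ProjectiveSpace.toSpec k n)) q).obj (op U)) :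
    ap (mulLast k n q d) U (twForm q d i U ω) =
      coord i hU (Fin.last n) • twForm q (d + 1) i U ω := by
  refine (ap_twistMul (𝒜 := grading k n) _ _ _).trans ?_
  refine Eq.trans ?_ (map_smul (twistSec _ (d + 1) U (formSec _ q U ω)) _ _)
  refine congrArg (twistSec _ (d + 1) U (formSec _ q U ω)) ?_
  rw [pap_twistingMul]
  refine (quotient_smul_homogSec _ _ hU _ _ ?_).symm
  ring

theorem isFrame_twForm (q d : ℕ) {i : Fin (n + 1)} {U : (ProjectiveSpace k n).Opens}
    (hU : U ≤ chart k n i) :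
    IsFrame (twistedForms k n q d) (fun T : Set.powersetCard (Fin n) q => twForm q d i U
      (wedge _ q U ((fun j => dSec (ProjectiveSpace.toSpec k n) (coord i hU (i.succAbove j))) ∘
        Set.powersetCard.ofFinEmbEquiv.symm T))) := by
  have h := (((isLocalBasis_dSec _ (isAffineOpen_chart i) _ (chart_bijective (k := k) i)).formSec _
    q).twistSec (X_pow_mem d i) (chart_le_basicOpen_pow d i)).restrict hU
  refine Eq.mp (congrArg (IsFrame (twistedForms k n q d)) (funext fun T => ?_)) h
  refine (rs_twForm i hU _).trans ?_
  rw [rs_wedge]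
  refine congrArg (fun ω => twForm q d i U (wedge _ q U ω)) (funext fun l => ?_)
  rw [Function.comp_apply, Function.comp_apply, rs_dSec, rr_coord]

theorem twistedForms_isVectorBundle (q d : ℕ) : IsVectorBundle (twistedForms k n q d) :=
  isVectorBundle_of_isFrame fun x => by
    obtain ⟨i, hi⟩ := exists_mem_chart x
    exact ⟨_, hi, _, inferInstance, _, isFrame_twForm q d le_rfl⟩

theorem apush_restrictForms {q d : ℕ} {i : Fin (n + 1)} {U : (ProjectiveSpace k (n + 1)).Opens}
    (ω : Fin q → (kaehlerPresheaf (ProjectiveSpace.toSpec k (n + 1))).obj (op U)) :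
    apush (hyperplane k n) (restrictForms k n q d) U
      (twForm q d i.castSucc U (wedge _ q U ω)) =
    twForm q d i (hyperplane k n ⁻¹ᵁ U) (wedge _ q (hyperplane k n ⁻¹ᵁ U)
      (fun l => pullD (hyperplane k n) (hyperplane_toSpec k n) U (ω l))) := by
  refine (apush_twistPush (killLast k n) (killLast_irrelevant k n) _ _ _).trans ?_
  refine Eq.trans (congrArg (fun η => twistSec _ d (hyperplane k n ⁻¹ᵁ U) η _)
    (apush_formsPullback (hyperplane k n) (hyperplane_toSpec k n) ω)) ?_
  refine congrArg (twistSec _ d (hyperplane k n ⁻¹ᵁ U) _) ?_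
  refine twistVal_ext fun x hx => ?_
  refine (twistVal_homogSec _ x hx).trans (Eq.trans ?_ (twistVal_homogSec _ x hx).symm)
  refine congrArg _ ((map_pow (killLast k n) _ _).trans ?_)
  rw [killLast_X_castSucc]

end TwistedForms

/-! ### Contractions of forms with the Euler vector field -/

section EulerSections

variable {X : Scheme.{u}} {P : PMod X.presheaf} {U : X.Opens}

/-- `eulerForm` with values in sections of the presheaf of exterior powers. -/
def eulerWedge (P : PMod X.presheaf) (q : ℕ) (U : X.Opens) :
    (Γ(X, U) × P.obj (op U)) [⋀^Fin (q + 1)]→ₗ[Γ(X, U)] (exteriorPresheaf P q).obj (op U) :=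
  eulerForm Γ(X, U) (P.obj (op U)) q

theorem rs_eulerWedge (P : PMod X.presheaf) {q : ℕ} {V : X.Opens} (h : V ≤ U)
    (m : Fin (q + 1) → Γ(X, U) × P.obj (op U)) :
    rs (exteriorPresheaf P q) h (eulerWedge P q U m) =
      eulerWedge P q V (fun l => (rr h (m l).1, rs P h (m l).2)) :=
  exteriorPowerMap_eulerForm _ _

variable {k : Type u} [Field k] {n : ℕ}

/-- The pair `(yⱼ, dyⱼ)` for the affine coordinate `yⱼ = xⱼ / xᵢ`. -/
def coordPair (i : Fin (n + 1)) {U : (ProjectiveSpace k n).Opens} (hU : U ≤ chart k n i)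
    (j : Fin (n + 1)) : Γ(ProjectiveSpace k n, U) ×
      (kaehlerPresheaf (ProjectiveSpace.toSpec k n)).obj (op U) :=
  (coord i hU j, dSec _ (coord i hU j))

theorem coordPair_self (i : Fin (n + 1)) {U : (ProjectiveSpace k n).Opens} (hU : U ≤ chart k n i) :
    coordPair i hU i = (1, 0) := by
  rw [coordPair, coord_self, dSec_one]

/-- The change of chart: since `yⱼ' = u yⱼ` with `u = xᵢ / xₗ`, `dyⱼ' = u dyⱼ + yⱼ du`, which is a shear
followed by multiplication by `u`. -/
theorem coordPair_change {i l : Fin (n + 1)} {U : (ProjectiveSpace k n).Opens}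
    (hU : U ≤ chart k n i) (hU' : U ≤ chart k n l) (j : Fin (n + 1)) :
    coordPair l hU' j = coord l hU' i • (coordPair i hU j +
      (0, (coordPair i hU j).1 • (coord i hU l • dSec _ (coord l hU' i)))) := by
  have h : coord l hU' i * coord i hU l = 1 := by rw [coord_mul_coord, coord_self]
  refine Prod.ext ?_ ?_
  · change coord l hU' j = coord l hU' i * (coord i hU j + 0)
    rw [add_zero, coord_mul_coord]
  · change dSec _ (coord l hU' j) = coord l hU' i • (dSec _ (coord i hU j) +
      coord i hU j • (coord i hU l • dSec _ (coord l hU' i)))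
    rw [← coord_mul_coord hU hU', dSec_mul, smul_add, smul_comm (coord i hU j), smul_smul, h,
      one_smul]

/-- On the chart `xᵢ ≠ 0`, the contraction of `dx_{T 0} ∧ ⋯ ∧ dx_{T q}` with the Euler vector
field `∑ⱼ xⱼ ∂/∂xⱼ`, as a section of `Ω^q(q + 1)`. -/
def contractionOn (q : ℕ) (i : Fin (n + 1)) {U : (ProjectiveSpace k n).Opens}
    (hU : U ≤ chart k n i) (T : Fin (q + 1) → Fin (n + 1)) :
    Sec (twistedForms k n q (q + 1)) U :=
  twForm q (q + 1) i U (eulerWedge _ q U (fun l => coordPair i hU (T l)))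

theorem rs_contractionOn {q : ℕ} {i : Fin (n + 1)} {U V : (ProjectiveSpace k n).Opens}
    (hU : U ≤ chart k n i) (h : V ≤ U) (T : Fin (q + 1) → Fin (n + 1)) :
    rs (underlying (twistedForms k n q (q + 1))) h (contractionOn q i hU T) =
      contractionOn q i (h.trans hU) T := by
  rw [contractionOn, rs_twForm, rs_eulerWedge]
  simp only [coordPair, rs_dSec, rr_coord]
  rfl

/-- The contraction does not depend on the chart: it changes by `u ^ (q + 1)`, which is the factor of
the twist `O(q + 1)`. -/
theorem contractionOn_eq {q : ℕ} {i l : Fin (n + 1)} {U : (ProjectiveSpace k n).Opens}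
    (hU : U ≤ chart k n i) (hU' : U ≤ chart k n l) (T : Fin (q + 1) → Fin (n + 1)) :
    contractionOn q i hU T = contractionOn q l hU' T := by
  rw [contractionOn, contractionOn, twForm_eq_smul hU', ← map_smul]
  refine congrArg (twForm q (q + 1) l U) ?_
  simp only [coordPair_change hU hU']
  refine Eq.trans ?_ (eulerForm_smul _ _).symm
  exact congrArg (coord l hU' i ^ (q + 1) • ·) (eulerForm_shear _ _).symm

theorem exists_contraction (q : ℕ) (T : Fin (q + 1) → Fin (n + 1)) :
    ∃ s : Sec (twistedForms k n q (q + 1)) ⊤, ∀ i,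
      rs (underlying _) le_top s = contractionOn q i (le_refl (chart k n i)) T :=
  sec_glue _ (chart k n) (fun _ => le_top)
    (fun x _ => Opens.mem_iSup.2 (exists_mem_chart x)) (fun i => contractionOn q i le_rfl T)
    fun i l => by
      rw [rs_contractionOn, rs_contractionOn]
      exact contractionOn_eq inf_le_left inf_le_right T

/-- The contraction of `dx_{T 0} ∧ ⋯ ∧ dx_{T q}` with the Euler vector field `∑ⱼ xⱼ ∂/∂xⱼ`, as a
global section of `Ω^q(q + 1)`. -/
def contraction (q : ℕ) (T : Fin (q + 1) → Fin (n + 1)) : Sec (twistedForms k n q (q + 1)) ⊤ :=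
  (exists_contraction q T).choose

theorem rs_contraction {q : ℕ} {i : Fin (n + 1)} {U : (ProjectiveSpace k n).Opens}
    (hU : U ≤ chart k n i) (T : Fin (q + 1) → Fin (n + 1)) :
    rs (underlying (twistedForms k n q (q + 1))) le_top (contraction q T) =
      contractionOn q i hU T := by
  rw [← rs_rs _ le_top hU, contraction, (exists_contraction q T).choose_spec i, rs_contractionOn]

end EulerSections

/-! ### The elementary transformation -/

section FreeProducts

variable {X : Scheme.{u}} {n q : ℕ}

/-- An enumeration of the subsets with `q` elements of a set with `n` elements. -/
def subsetEquiv (n q : ℕ) : Set.powersetCard (Fin n) q ≃ Fin (n.choose q) :=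
  Fintype.equivFinOfCardEq (by
    rw [← Nat.card_eq_fintype_card, Set.powersetCard.card, Nat.card_eq_fintype_card,
      Fintype.card_fin])

/-- The sections of the free module of rank `n.choose q` as the `q`-th exterior power of the
sections of the free module of rank `n`. -/
def freeWedge (n q : ℕ) (U : X.Opens) :
    (Fin n → Γ(X, U)) [⋀^Fin q]→ₗ[Γ(X, U)] Sec (freeModule X (n.choose q)) U :=
  (((Pi.basisFun Γ(X, U) (Fin n)).exteriorPower q).constr Γ(X, U) fun T =>
    rs (underlying (freeModule X _)) le_top (freeSec X (subsetEquiv n q T))).compAlternatingMap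
      (exteriorPower.ιMulti Γ(X, U) q)

theorem freeWedge_single (U : X.Opens) (T : Set.powersetCard (Fin n) q) :
    freeWedge n q U ((fun j => Pi.single j 1) ∘ Set.powersetCard.ofFinEmbEquiv.symm T) =
      rs (underlying (freeModule X _)) le_top (freeSec X (subsetEquiv n q T)) := by
  refine Eq.trans ?_ (Module.Basis.constr_basis ((Pi.basisFun Γ(X, U) (Fin n)).exteriorPower q)
    Γ(X, U) (fun T => rs (underlying (freeModule X _)) le_top
      (freeSec X (subsetEquiv n q T))) T)
  refine congrArg (Module.Basis.constr _ Γ(X, U) _) ?_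
  refine Eq.trans ?_ (exteriorPower.basis_apply _ _ _ _).symm
  exact congrArg _ (funext fun l => (Pi.basisFun_apply Γ(X, U) (Fin n) _).symm)

theorem isFrame_freeWedge (U : X.Opens) :
    IsFrame (freeModule X (n.choose q)) (fun T : Set.powersetCard (Fin n) q =>
      freeWedge n q U ((fun j => Pi.single j 1) ∘ Set.powersetCard.ofFinEmbEquiv.symm T)) := by
  simp only [freeWedge_single]
  exact (freeSec_isFrame.comp_equiv (subsetEquiv n q)).restrict le_top

theorem ap_freeDesc_freeWedge {N : X.Modules} (s : Set.powersetCard (Fin n) q → Sec N ⊤)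
    (U : X.Opens) (T : Set.powersetCard (Fin n) q) :
    ap (freeDesc (s ∘ (subsetEquiv n q).symm)) U
      (freeWedge n q U ((fun j => Pi.single j 1) ∘ Set.powersetCard.ofFinEmbEquiv.symm T)) =
        rs (underlying N) le_top (s T) := by
  rw [freeWedge_single, ap_rs, ap_freeDesc, Function.comp_apply, Equiv.symm_apply_apply]

end FreeProducts

section Maps

variable (k : Type u) [Field k] (n p : ℕ)

/-- The map `O^(n+1 choose p+1) → Ω^{p+1}(p+2)` on `ℙⁿ⁺¹`. The standard basis vector indexed by `T`
goes to the contraction of `dxₙ₊₁ ∧ dx_T` with the Euler vector field. -/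
def lastContraction : freeModule (ProjectiveSpace k (n + 1)) ((n + 1).choose (p + 1)) ⟶
    twistedForms k (n + 1) (p + 1) (p + 2) :=
  freeDesc ((fun T : Set.powersetCard (Fin (n + 1)) (p + 1) => contraction (p + 1)
    (Fin.cons (Fin.last (n + 1)) (Fin.castSucc ∘ Set.powersetCard.ofFinEmbEquiv.symm T))) ∘
      (subsetEquiv (n + 1) (p + 1)).symm)

/-- The map `O^(n+1 choose p+1) → Ω^p(p+1)` from the free module on `ℙⁿ⁺¹` to the forms on the
hyperplane. The standard basis vector indexed by `T` goes to the contraction of `dx_T` with the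
Euler vector field. -/
def hyperplaneContraction : freeModule (ProjectiveSpace k (n + 1)) ((n + 1).choose (p + 1)) ⟶
    (Scheme.Modules.pushforward (hyperplane k n)).obj (twistedForms k n p (p + 1)) :=
  freeDesc ((fun T : Set.powersetCard (Fin (n + 1)) (p + 1) => pushEquiv (hyperplane k n) _ ⊤
    (contraction p (Set.powersetCard.ofFinEmbEquiv.symm T))) ∘ (subsetEquiv (n + 1) (p + 1)).symm)

variable {k n p}

theorem ap_lastContraction {i : Fin (n + 1 + 1)} {U : (ProjectiveSpace k (n + 1)).Opens}
    (hU : U ≤ chart k (n + 1) i) (m : Fin (p + 1) → Fin (n + 1) → Γ(ProjectiveSpace k (n + 1), U)) :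
    ap (lastContraction k n p) U (freeWedge (n + 1) (p + 1) U m) =
      twForm (p + 1) (p + 2) i U (eulerWedge _ (p + 1) U (Fin.cons (coordPair i hU (Fin.last (n + 1)))
        fun l => ∑ j, m l j • coordPair i hU j.castSucc)) := by
  refine alternatingMap_semilinear_ext (freeWedge (n + 1) (p + 1) U)
    (ap (lastContraction k n p) U) (fun j : Fin (n + 1) => coordPair i hU j.castSucc)
    ((twForm (p + 1) (p + 2) i U).compAlternatingMap
      ((eulerWedge _ (p + 1) U).curryLeft (coordPair i hU (Fin.last (n + 1))))) (fun T => ?_) m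
  refine (ap_freeDesc_freeWedge _ U T).trans ((rs_contraction hU _).trans ?_)
  refine congrArg (fun m => twForm (p + 1) (p + 2) i U (eulerWedge _ (p + 1) U m))
    (funext fun l => ?_)
  exact Fin.cases rfl (fun l => rfl) l

theorem apush_hyperplaneContraction {i : Fin (n + 1)} {U : (ProjectiveSpace k (n + 1)).Opens}
    (hU : U ≤ chart k (n + 1) i.castSucc)
    (m : Fin (p + 1) → Fin (n + 1) → Γ(ProjectiveSpace k (n + 1), U)) :
    apush (hyperplane k n) (hyperplaneContraction k n p) U (freeWedge (n + 1) (p + 1) U m) =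
      twForm p (p + 1) i (hyperplane k n ⁻¹ᵁ U) (eulerWedge _ p (hyperplane k n ⁻¹ᵁ U)
        fun l => ∑ j, ((hyperplane k n).app U).hom (m l j) •
          coordPair i (hyperplane_preimage_le_chart hU) j) := by
  refine alternatingMap_semilinear_ext (freeWedge (n + 1) (p + 1) U)
    (apush (hyperplane k n) (hyperplaneContraction k n p) U)
    (fun j : Fin (n + 1) => coordPair i (hyperplane_preimage_le_chart hU) j)
    ((twForm p (p + 1) i (hyperplane k n ⁻¹ᵁ U)).compAlternatingMap (eulerWedge _ p _))
    (fun T => ?_) m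
  refine (congrArg (pushEquiv (hyperplane k n) _ U).symm (ap_freeDesc_freeWedge _ U T)).trans ?_
  exact rs_contraction (hyperplane_preimage_le_chart hU) _

end Maps

section Frames

theorem sum_map_single {R S W J : Type*} [CommRing R] [CommRing S] [AddCommGroup W] [Module S W]
    [Fintype J] [DecidableEq J] (σ : R →+* S) (v : J → W) (a : J) :
    ∑ j, σ (Pi.single (M := fun _ => R) a 1 j) • v j = v a := by
  refine (Finset.sum_eq_single a (fun l _ hl => ?_) (fun h => (h (Finset.mem_univ a)).elim)).trans ?_
  · rw [Pi.single_eq_of_ne hl, map_zero, zero_smul]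
  · rw [Pi.single_eq_same, map_one, one_smul]

theorem sum_map_single_sub {R S W J : Type*} [CommRing R] [CommRing S] [AddCommGroup W]
    [Module S W] [Fintype J] [DecidableEq J] (σ : R →+* S) (v : J → W) (a i : J) (y : R) :
    ∑ j, σ ((Pi.single a 1 - y • Pi.single i 1 : J → R) j) • v j = v a - σ y • v i := by
  simp only [Pi.sub_apply, Pi.smul_apply, smul_eq_mul, map_sub, map_mul, sub_smul, mul_smul,
    Finset.sum_sub_distrib, ← Finset.smul_sum, sum_map_single]

variable {k : Type u} [Field k] {n p : ℕ}

theorem coordPair_sub (i : Fin (n + 1)) {U : (ProjectiveSpace k n).Opens} (hU : U ≤ chart k n i)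
    (j : Fin (n + 1)) : coordPair i hU j - coord i hU j • coordPair i hU i =
      (0, dSec _ (coord i hU j)) := by
  rw [coordPair_self]
  refine Prod.ext ?_ ?_
  · change coord i hU j - coord i hU j * 1 = 0
    rw [mul_one, sub_self]
  · change dSec _ (coord i hU j) - coord i hU j • 0 = dSec _ (coord i hU j)
    rw [smul_zero, sub_zero]

/-- The twisted form `(m₁ · dy) ∧ ⋯ ∧ (m_q · dy) ⊗ xᵢᵈ`, for vectors `mₗ` of functions and the affine
coordinates `y` on the chart `xᵢ ≠ 0`. -/
def coordWedge (q d : ℕ) (i : Fin (n + 1)) {U : (ProjectiveSpace k n).Opens} (hU : U ≤ chart k n i) :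
    (Fin n → Γ(ProjectiveSpace k n, U)) [⋀^Fin q]→ₗ[Γ(ProjectiveSpace k n, U)]
      Sec (twistedForms k n q d) U :=
  (twForm q d i U).compAlternatingMap ((wedge _ q U).compLinearMap
    (Fintype.linearCombination Γ(ProjectiveSpace k n, U)
      (fun j => dSec (ProjectiveSpace.toSpec k n) (coord i hU (i.succAbove j)))))

theorem coordWedge_eq {q d : ℕ} {i : Fin (n + 1)} {U : (ProjectiveSpace k n).Opens}
    {hU : U ≤ chart k n i} {m : Fin q → Fin n → Γ(ProjectiveSpace k n, U)}
    {ω : Fin q → (kaehlerPresheaf (ProjectiveSpace.toSpec k n)).obj (op U)}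
    (h : ∀ l, Fintype.linearCombination Γ(ProjectiveSpace k n, U)
      (fun j => dSec (ProjectiveSpace.toSpec k n) (coord i hU (i.succAbove j))) (m l) = ω l) :
    coordWedge q d i hU m = twForm q d i U (wedge _ q U ω) :=
  congrArg (fun ω => twForm q d i U (wedge _ q U ω)) (funext h)

theorem linearCombination_single {R M J : Type*} [CommRing R] [AddCommGroup M] [Module R M]
    [Fintype J] [DecidableEq J] (v : J → M) (j : J) :
    Fintype.linearCombination R v (Pi.single j 1) = v j := by
  rw [Fintype.linearCombination_apply_single, one_smul]

theorem coordWedge_single {q d : ℕ} {i : Fin (n + 1)} {U : (ProjectiveSpace k (n + 1)).Opens}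
    (hU : U ≤ chart k (n + 1) i.castSucc) (T : Fin q → Fin n) :
    coordWedge q d i.castSucc hU ((fun j => Pi.single j.castSucc 1) ∘ T) =
      twForm q d i.castSucc U (wedge _ q U
        (fun l => dSec _ (coord i.castSucc hU (i.succAbove (T l)).castSucc))) :=
  coordWedge_eq fun l => (linearCombination_single _ _).trans (by
    rw [Fin.castSucc_succAbove_castSucc])

theorem isFrame_coordWedge (q d : ℕ) {i : Fin (n + 1)} {U : (ProjectiveSpace k n).Opens}
    (hU : U ≤ chart k n i) :
    IsFrame (twistedForms k n q d) (fun T : Set.powersetCard (Fin n) q =>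
      coordWedge q d i hU ((fun j => Pi.single j 1) ∘ Set.powersetCard.ofFinEmbEquiv.symm T)) := by
  refine Eq.mp (congrArg (IsFrame (twistedForms k n q d)) (funext fun T => ?_))
    (isFrame_twForm q d hU)
  exact (coordWedge_eq fun l => linearCombination_single _ _).symm

theorem ap_mulLast_coordWedge {q d : ℕ} {i : Fin (n + 1)} {U : (ProjectiveSpace k n).Opens}
    (hU : U ≤ chart k n i) (m : Fin q → Fin n → Γ(ProjectiveSpace k n, U)) :
    ap (mulLast k n q d) U (coordWedge q d i hU m) =
      coord i hU (Fin.last n) • coordWedge q (d + 1) i hU m :=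
  ap_mulLast hU _

/-- The vectors `eⱼ - yⱼ eᵢ` which, together with `eᵢ`, replace the standard basis. -/
def shearVec (i : Fin (n + 1)) {U : (ProjectiveSpace k (n + 1)).Opens}
    (hU : U ≤ chart k (n + 1) i.castSucc) (j : Fin n) :
    Fin (n + 1) → Γ(ProjectiveSpace k (n + 1), U) :=
  Pi.single (i.succAbove j) 1 - coord i.castSucc hU (i.succAbove j).castSucc • Pi.single i 1

theorem span_shearVec (i : Fin (n + 1)) {U : (ProjectiveSpace k (n + 1)).Opens}
    (hU : U ≤ chart k (n + 1) i.castSucc) : Submodule.span Γ(ProjectiveSpace k (n + 1), U)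
      (insert (Pi.single i 1) (Set.range (shearVec i hU))) = ⊤ := by
  have h0 : Pi.single i 1 ∈ Submodule.span Γ(ProjectiveSpace k (n + 1), U)
      (insert (Pi.single i 1) (Set.range (shearVec i hU))) :=
    Submodule.subset_span (Set.mem_insert _ _)
  refine span_eq_top_of_single_mem fun j => ?_
  obtain rfl | ⟨j, rfl⟩ := Fin.eq_self_or_eq_succAbove i j
  · exact h0
  · have h1 : shearVec i hU j ∈ Submodule.span Γ(ProjectiveSpace k (n + 1), U)
      (insert (Pi.single i 1) (Set.range (shearVec i hU))) :=
      Submodule.subset_span (Set.mem_insert_of_mem _ ⟨j, rfl⟩)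
    have h2 := Submodule.add_mem _ h1 (Submodule.smul_mem _
      (coord i.castSucc hU (i.succAbove j).castSucc) h0)
    rwa [shearVec, sub_add_cancel] at h2

theorem span_single_castSucc {R : Type*} [CommRing R] :
    Submodule.span R (insert (-Pi.single (Fin.last n) 1)
      (Set.range fun j : Fin n => Pi.single (M := fun _ : Fin (n + 1) => R) j.castSucc 1)) = ⊤ := by
  refine span_eq_top_of_single_mem fun j => ?_
  refine Fin.lastCases ?_ (fun j => ?_) j
  · exact (Submodule.neg_mem_iff _).1 (Submodule.subset_span (Set.mem_insert _ _))
  · exact Submodule.subset_span (Set.mem_insert_of_mem _ ⟨j, rfl⟩)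

/-- The linear forms `∑ⱼ cⱼ (yⱼ, dyⱼ)` take `eⱼ - yⱼ eᵢ` to `(0, dyⱼ)`. -/
theorem sum_shearVec_smul (i : Fin (n + 1)) {U : (ProjectiveSpace k (n + 1)).Opens}
    (hU : U ≤ chart k (n + 1) i.castSucc) (j : Fin n) :
    ∑ l, shearVec i hU j l • coordPair i.castSucc hU l.castSucc =
      (0, dSec _ (coord i.castSucc hU (i.succAbove j).castSucc)) :=
  (sum_map_single_sub (RingHom.id _) _ _ _ _).trans (coordPair_sub _ _ _)

theorem sum_app_shearVec_smul (i : Fin (n + 1)) {U : (ProjectiveSpace k (n + 1)).Opens}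
    (hU : U ≤ chart k (n + 1) i.castSucc) (j : Fin n) :
    ∑ l, ((hyperplane k n).app U).hom (shearVec i hU j l) •
        coordPair i (hyperplane_preimage_le_chart hU) l =
      (0, dSec _ (coord i (hyperplane_preimage_le_chart hU) (i.succAbove j))) := by
  refine (sum_map_single_sub ((hyperplane k n).app U).hom _ _ _ _).trans ?_
  rw [app_coord_castSucc]
  exact coordPair_sub _ _ _

/-- On the products without `eᵢ`, only the entry `(t, dt)` has a nonzero first component, and the value
of `lastContraction` is `t` times a product of the `dyⱼ`. -/
theorem ap_lastContraction_shearVec {i : Fin (n + 1)} {U : (ProjectiveSpace k (n + 1)).Opens}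
    (hU : U ≤ chart k (n + 1) i.castSucc) (T : Fin (p + 1) → Fin n) :
    ap (lastContraction k n p) U (freeWedge (n + 1) (p + 1) U (shearVec i hU ∘ T)) =
      coord i.castSucc hU (Fin.last (n + 1)) • coordWedge (p + 1) (p + 2) i.castSucc hU
        ((fun j => Pi.single j.castSucc 1) ∘ T) := by
  rw [ap_lastContraction hU, coordWedge_single, ← map_smul]
  refine congrArg (twForm (p + 1) (p + 2) i.castSucc U) ?_
  refine Eq.trans ?_ (eulerForm_cons (coordPair i.castSucc hU (Fin.last (n + 1))) _)
  refine congrArg (fun m => eulerWedge _ (p + 1) U (Fin.cons _ m)) (funext fun l => ?_)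
  exact sum_shearVec_smul i hU (T l)

/-- On the products with `eᵢ`, which goes to `(1, 0)`, the value of `lastContraction` is a product of
the `dyⱼ` with the factor `-dt`. -/
theorem ap_lastContraction_cons {i : Fin (n + 1)} {U : (ProjectiveSpace k (n + 1)).Opens}
    (hU : U ≤ chart k (n + 1) i.castSucc) (T : Fin p → Fin n) :
    ap (lastContraction k n p) U
        (freeWedge (n + 1) (p + 1) U (Fin.cons (Pi.single i 1) (shearVec i hU ∘ T))) =
      coordWedge (p + 1) (p + 2) i.castSucc hU (Fin.cons (-Pi.single (Fin.last n) 1)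
        ((fun j => Pi.single j.castSucc 1) ∘ T)) := by
  rw [ap_lastContraction hU, coordWedge_eq (ω := Fin.cons
    (-dSec _ (coord i.castSucc hU (Fin.last (n + 1)))) fun l => dSec _ (coord i.castSucc hU
    (i.succAbove (T l)).castSucc)) fun l => ?_]
  · refine congrArg (twForm (p + 1) (p + 2) i.castSucc U) ?_
    refine Eq.trans ?_ (eulerForm_cons_cons_one (coordPair i.castSucc hU (Fin.last (n + 1)))
      (fun l => (0, dSec _ (coord i.castSucc hU (i.succAbove (T l)).castSucc))))
    refine congrArg (fun m => eulerWedge _ (p + 1) U (Fin.cons _ m)) (funext fun l => ?_)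
    refine Fin.cases ?_ (fun l => ?_) l
    · exact (sum_map_single (RingHom.id _) _ _).trans (coordPair_self _ _)
    · exact sum_shearVec_smul i hU (T l)
  · refine Fin.cases ?_ (fun l => ?_) l
    · refine (map_neg _ _).trans (congrArg Neg.neg ((linearCombination_single _ _).trans ?_))
      rw [Fin.succAbove_ne_last_last (Fin.castSucc_lt_last i).ne]
    · refine (linearCombination_single _ _).trans ?_
      rw [Fin.castSucc_succAbove_castSucc]
      rfl

/-- All entries of the contraction have first component zero. -/
theorem apush_hyperplaneContraction_shearVec {i : Fin (n + 1)}
    {U : (ProjectiveSpace k (n + 1)).Opens} (hU : U ≤ chart k (n + 1) i.castSucc)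
    (T : Fin (p + 1) → Fin n) :
    apush (hyperplane k n) (hyperplaneContraction k n p) U
      (freeWedge (n + 1) (p + 1) U (shearVec i hU ∘ T)) = 0 := by
  rw [apush_hyperplaneContraction hU, ← map_zero (twForm p (p + 1) i (hyperplane k n ⁻¹ᵁ U))]
  refine congrArg (twForm p (p + 1) i (hyperplane k n ⁻¹ᵁ U)) ?_
  refine (congrArg (eulerWedge _ p _) (funext fun l => sum_app_shearVec_smul i hU (T l))).trans ?_
  refine (eulerForm_apply _).trans (Finset.sum_eq_zero fun l _ => ?_)
  rw [zero_smul, smul_zero]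

/-- The vector `eᵢ` goes to `(1, 0)`, so that the contraction is the product of the remaining `dyⱼ`. -/
theorem apush_hyperplaneContraction_cons {i : Fin (n + 1)}
    {U : (ProjectiveSpace k (n + 1)).Opens} (hU : U ≤ chart k (n + 1) i.castSucc)
    (T : Fin p → Fin n) :
    apush (hyperplane k n) (hyperplaneContraction k n p) U
        (freeWedge (n + 1) (p + 1) U (Fin.cons (Pi.single i 1) (shearVec i hU ∘ T))) =
      twForm p (p + 1) i (hyperplane k n ⁻¹ᵁ U) (wedge _ p _
        ((fun j => dSec _ (coord i (hyperplane_preimage_le_chart hU) (i.succAbove j))) ∘ T)) := by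
  rw [apush_hyperplaneContraction hU]
  refine congrArg (twForm p (p + 1) i (hyperplane k n ⁻¹ᵁ U)) ?_
  refine Eq.trans ?_ (eulerForm_cons_one (fun l => (0, dSec _ (coord i
    (hyperplane_preimage_le_chart hU) (i.succAbove (T l))))))
  refine congrArg (eulerWedge _ p _) (funext fun l => ?_)
  refine Fin.cases ?_ (fun l => ?_) l
  · exact (sum_map_single ((hyperplane k n).app U).hom _ _).trans (coordPair_self _ _)
  · exact sum_app_shearVec_smul i hU (T l)

theorem apush_restrictForms_single {q d : ℕ} {i : Fin (n + 1)}
    {U : (ProjectiveSpace k (n + 1)).Opens} (hU : U ≤ chart k (n + 1) i.castSucc)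
    (T : Fin q → Fin n) :
    apush (hyperplane k n) (restrictForms k n q d) U
        (coordWedge q d i.castSucc hU ((fun j => Pi.single j.castSucc 1) ∘ T)) =
      twForm q d i (hyperplane k n ⁻¹ᵁ U) (wedge _ q _
        ((fun j => dSec _ (coord i (hyperplane_preimage_le_chart hU) (i.succAbove j))) ∘ T)) := by
  rw [coordWedge_single, apush_restrictForms]
  refine congrArg (fun ω => twForm q d i _ (wedge _ q _ ω)) (funext fun l => ?_)
  rw [pullD_dSec, app_coord_castSucc]
  rfl

theorem apush_restrictForms_cons {q d : ℕ} {i : Fin (n + 1)}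
    {U : (ProjectiveSpace k (n + 1)).Opens} (hU : U ≤ chart k (n + 1) i.castSucc)
    (m : Fin q → Fin (n + 1) → Γ(ProjectiveSpace k (n + 1), U)) :
    apush (hyperplane k n) (restrictForms k n (q + 1) d) U
      (coordWedge (q + 1) d i.castSucc hU (Fin.cons (-Pi.single (Fin.last n) 1) m)) = 0 := by
  rw [coordWedge_eq fun l => rfl, apush_restrictForms,
    ← map_zero (twForm (q + 1) d i (hyperplane k n ⁻¹ᵁ U))]
  refine congrArg (twForm (q + 1) d i (hyperplane k n ⁻¹ᵁ U)) ?_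
  refine AlternatingMap.map_coord_zero _ 0 ?_
  refine (congrArg (pullD _ _ U) (map_neg _ _)).trans ((map_neg _ _).trans ?_)
  refine (congrArg (fun ω => -pullD _ _ U ω) (linearCombination_single _ _)).trans ?_
  rw [Fin.succAbove_ne_last_last (Fin.castSucc_lt_last i).ne, pullD_dSec, app_coord_last, dSec_zero, neg_zero]

end Frames

section Display

variable (k : Type u) [Field k] (n p : ℕ)

/-- On a chart that meets the hyperplane, the forms without and with a factor `dyₙ₊₁` are adapted
frames, where `yₙ₊₁` is an equation of the hyperplane. -/
def adaptedFramesCastSucc (i : Fin (n + 1)) :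
    AdaptedFrames (hyperplane k n) (mulLast k (n + 1) (p + 1) (p + 1))
      (restrictForms k n (p + 1) (p + 2)) (lastContraction k n p) (hyperplaneContraction k n p)
      (chart k (n + 1) i.castSucc) where
  I := Set.powersetCard (Fin n) (p + 1)
  J := Set.powersetCard (Fin n) p
  t := coord i.castSucc le_rfl (Fin.last (n + 1))
  t_injective V h c hc := coord_mul_eq_zero (i := i.castSucc) h (Fin.last (n + 1)) (by
    rwa [rr_coord] at hc)
  t_ker V h c hc x hx := by
    obtain ⟨W, hW, hxW, d, hd⟩ := exists_eq_coord_mul h hc hx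
    exact ⟨W, hW, hxW, d, by rw [hd, rr_coord]⟩
  t_zero := app_coord_last le_rfl
  f T := coordWedge (p + 1) (p + 2) i.castSucc le_rfl
    ((fun j => Pi.single j.castSucc 1) ∘ Set.powersetCard.ofFinEmbEquiv.symm T)
  f' T := coordWedge (p + 1) (p + 2) i.castSucc le_rfl (Fin.cons (-Pi.single (Fin.last n) 1)
    ((fun j => Pi.single j.castSucc 1) ∘ Set.powersetCard.ofFinEmbEquiv.symm T))
  g T := coordWedge (p + 1) (p + 1) i.castSucc le_rfl
    ((fun j => Pi.single j.castSucc 1) ∘ Set.powersetCard.ofFinEmbEquiv.symm T)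
  g' T := coordWedge (p + 1) (p + 1) i.castSucc le_rfl (Fin.cons (-Pi.single (Fin.last n) 1)
    ((fun j => Pi.single j.castSucc 1) ∘ Set.powersetCard.ofFinEmbEquiv.symm T))
  e T := freeWedge (n + 1) (p + 1) _
    (shearVec i le_rfl ∘ Set.powersetCard.ofFinEmbEquiv.symm T)
  e' T := freeWedge (n + 1) (p + 1) _ (Fin.cons (Pi.single i 1)
    (shearVec i le_rfl ∘ Set.powersetCard.ofFinEmbEquiv.symm T))
  frame_F := (isFrame_coordWedge _ _ _).split span_single_castSucc
  frame_FH := (isFrame_coordWedge _ _ _).split span_single_castSucc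
  frame_E := (isFrame_freeWedge _).split (span_shearVec i le_rfl)
  frame_F' := by
    simp only [apush_restrictForms_single]
    exact isFrame_twForm _ _ _
  frame_F'' := by
    simp only [apush_hyperplaneContraction_cons]
    exact isFrame_twForm _ _ _
  m_g T := ap_mulLast_coordWedge _ _
  m_g' T := ap_mulLast_coordWedge _ _
  a_e T := ap_lastContraction_shearVec _ _
  a_e' T := ap_lastContraction_cons _ _
  ψ_f' T := apush_restrictForms_cons _ _
  b_e T := apush_hyperplaneContraction_shearVec _ _

variable {k n p} in
theorem ap_lastContraction_single {U : (ProjectiveSpace k (n + 1)).Opens}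
    (hU : U ≤ chart k (n + 1) (Fin.last (n + 1))) (T : Fin (p + 1) → Fin (n + 1)) :
    ap (lastContraction k n p) U
        (freeWedge (n + 1) (p + 1) U ((fun j => Pi.single j 1) ∘ T)) =
      coordWedge (p + 1) (p + 2) (Fin.last (n + 1)) hU ((fun j => Pi.single j 1) ∘ T) := by
  rw [ap_lastContraction hU, coordPair_self]
  refine congrArg (twForm (p + 1) (p + 2) (Fin.last (n + 1)) U) ?_
  refine (eulerForm_cons_one _).trans (congrArg (wedge _ (p + 1) U) (funext fun l => ?_))
  refine (congrArg Prod.snd (sum_map_single (RingHom.id _) _ _)).trans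
    (Eq.trans ?_ (linearCombination_single _ _).symm)
  rw [Fin.succAbove_last]
  rfl

/-- On the chart `xₙ₊₁ ≠ 0`, the complement of the hyperplane, the map to the forms is an
isomorphism. -/
def adaptedFramesLast :
    AdaptedFrames (hyperplane k n) (mulLast k (n + 1) (p + 1) (p + 1))
      (restrictForms k n (p + 1) (p + 2)) (lastContraction k n p) (hyperplaneContraction k n p)
      (chart k (n + 1) (Fin.last (n + 1))) where
  I := Set.powersetCard (Fin (n + 1)) (p + 1)
  J := Empty
  t := 1
  t_injective V h c hc := by rwa [map_one (rr h), one_mul] at hc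
  t_ker V h c hc x hx := ⟨V, le_rfl, hx, c, by rw [map_one (rr _), one_mul, rr_self]⟩
  -- The inverse image of the chart in the hyperplane is empty, so that `1 = 0` there.
  t_zero := fun_ext fun y hy => (hyperplane_preimage_chart_last.le hy).elim
  f T := coordWedge (p + 1) (p + 2) (Fin.last (n + 1)) le_rfl
    ((fun j => Pi.single j 1) ∘ Set.powersetCard.ofFinEmbEquiv.symm T)
  f' := Empty.elim
  g T := coordWedge (p + 1) (p + 1) (Fin.last (n + 1)) le_rfl
    ((fun j => Pi.single j 1) ∘ Set.powersetCard.ofFinEmbEquiv.symm T)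
  g' := Empty.elim
  e T := freeWedge (n + 1) (p + 1) _
    ((fun j => Pi.single j 1) ∘ Set.powersetCard.ofFinEmbEquiv.symm T)
  e' := Empty.elim
  frame_F := (isFrame_coordWedge _ _ _).sumElim_of_isEmpty _
  frame_FH := (isFrame_coordWedge _ _ _).sumElim_of_isEmpty _
  frame_E := (isFrame_freeWedge _).sumElim_of_isEmpty _
  frame_F' := isFrame_of_le_bot _ _ hyperplane_preimage_chart_last.le
  frame_F'' := isFrame_of_le_bot _ _ hyperplane_preimage_chart_last.le
  m_g T := (ap_mulLast_coordWedge _ _).trans (by rw [coord_self])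
  m_g' := fun j => j.elim
  a_e T := (ap_lastContraction_single _ _).trans (one_smul _ _).symm
  a_e' := fun j => j.elim
  ψ_f' := fun j => j.elim
  b_e T := sec_eq_of_le_bot _ hyperplane_preimage_chart_last.le _ _

theorem exists_adaptedFrames (x : ProjectiveSpace k (n + 1)) : ∃ U, x ∈ U ∧
    Nonempty (AdaptedFrames (hyperplane k n) (mulLast k (n + 1) (p + 1) (p + 1))
      (restrictForms k n (p + 1) (p + 2)) (lastContraction k n p) (hyperplaneContraction k n p) U) := by
  obtain ⟨i, hi⟩ := exists_mem_chart x
  refine Fin.lastCases (fun hi => ?_) (fun i hi => ?_) i hi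
  · exact ⟨_, hi, ⟨adaptedFramesLast k n p⟩⟩
  · exact ⟨_, hi, ⟨adaptedFramesCastSucc k n p i⟩⟩

end Display

end ElementaryTransformations

end

theorem mainTheorem1 (k : Type u) [Field k] (n p : ℕ) :
    Nonempty (ElementaryTransformations.ElementaryTransformation
      (ElementaryTransformations.hyperplane k n)
      (ElementaryTransformations.mulLast k (n + 1) (p + 1) (p + 1))
      (ElementaryTransformations.restrictForms k n (p + 1) (p + 2))
      (ElementaryTransformations.freeModule
        (ElementaryTransformations.ProjectiveSpace k (n + 1)) ((n + 1).choose (p + 1)))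
      (ElementaryTransformations.twistedForms k n p (p + 1))) :=
  ElementaryTransformations.nonempty_elementaryTransformation
    (ElementaryTransformations.exists_adaptedFrames k n p)
    ElementaryTransformations.hyperplane_surjectiveOnFunctions
    (ElementaryTransformations.twistedForms_isVectorBundle _ _)
    (ElementaryTransformations.twistedForms_isVectorBundle _ _)
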